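/- Let $s\ge 1$ be an integer, let $(c_{0\beta})_{\beta\ge 3}$ be any sequence of real numbers, and let all $a_{kj}$ be real. For a planar polynomial system $\dot x=X(x,y)$, $\dot y=Y(x,y)$ consider formal power series $$M(x,y)=y^2+\sum_{\alpha+\beta\ge 3}c_{\alpha\beta}x^\alpha y^\beta$$ with the prescribed coefficients $c_{0\beta}$ such that $$\Big(\frac{\partial X}{\partial x}+\frac{\partial Y}{\partial y}\Big)M-(s+1)\Big(\frac{\partial M}{\partial x}X+\frac{\partial M}{\partial y}Y\Big)=\sum_{m\ge 3}\omega_m x^m .\qquad(*)$$ For such an $M$ the quasi-Lyapunov constants are $\lambda_m=\dfrac{\omega_{2m+4}}{2m-4s-1}$, $m\ge 1$. For each of the two systems $$\text{(A)}\quad \dot x=y+\sum_{(k,j)}a_{kj}x^ky^j,\quad \dot y=-2x^3;\qquad\qquad \text{(B)}\quad \dot x=y,\quad \dot y=-2x^3+\sum_{(k,j)}a_{kj}x^ky^j,$$ where in both sums $(k,j)$ runs over $(2,1),(1,2),(0,3),(5,0),(4,1),(3,2),(2,3),(1,4),(0,5)$ and, for (A) only, also over $(3,0)$, there is exactly one such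 series $M$ satisfying $(*)$. Its quasi-Lyapunov constants satisfy the following, where the formula for $\lambda_k$ ($k\ge2$) is asserted under the hypothesis $\lambda_1=\dots=\lambda_{k-1}=0$. **System (A).** $$\begin{aligned} \lambda_1&=a_{30},\qquad \lambda_2=\tfrac15(2a_{12}+5a_{50}),\qquad \lambda_3=\tfrac17(2a_{32}+3a_{21}a_{50}),\\ \lambda_4&=\tfrac1{45}(12a_{14}+30a_{03}a_{50}+5a_{41}a_{50}),\qquad \lambda_5=\tfrac{3a_{50}}{77}(6a_{23}+a_{21}a_{41}-10a_{50}^2),\\ \lambda_6&=\tfrac{a_{50}}{117}(60a_{05}+10a_{03}a_{41}+a_{41}^2-3a_{21}a_{50}^2),\\ \lambda_7&=-\tfrac{a_{50}}{1155}(2a_{21}a_{41}^2+300a_{03}a_{50}^2+9a_{21}^2a_{50}^2+100a_{41}a_{50}^2). \end{aligned}$$ If $a_{50}=0$, then $\lambda_8=\lambda_9=\lambda_{10}=0$. If $a_{50}\ne0$, then $$\begin{aligned} \lambda_8&=\frac{1}{895050\,a_{50}}(28a_{21}a_{41}^4+252a_{21}^2a_{41}^2a_{50}^2+800a_{41}^3a_{50}^2+567a_{21}^3a_{50}^4+3600a_{21}a_{41}a_{50}^4+4500a_{50}^6),\\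 \lambda_9&=-\frac{4}{235125\,a_{50}}(4a_{21}^2a_{41}^4+36a_{21}^3a_{41}^2a_{50}^2+100a_{21}a_{41}^3a_{50}^2+81a_{21}^4a_{50}^4+450a_{21}^2a_{41}a_{50}^4-125a_{41}^2a_{50}^4),\\ \lambda_{10}&=-\frac{f_1}{42089726250000\,(s+1)(4s-19)\,a_{50}^3}, \end{aligned}$$ where $$f_1=\begin{aligned} &-15174868212 a_{21}^{6} a_{41}^{4}-84454927200 a_{21}^{4} a_{41}^{5}+22768748000 a_{21}^{2} a_{41}^{6} \\ &\quad -136573813908 a_{21}^{7} a_{41}^{2} a_{50}^{2}-1193662008000 a_{21}^{5} a_{41}^{3} a_{50}^{2} \\ &\quad -2087643726000 a_{21}^{3} a_{41}^{4} a_{50}^{2}+651216400000 a_{21} a_{41}^{5} a_{50}^{2} \\ &\quad -307291081293 a_{21}^{8} a_{50}^{4}-3661266760200 a_{21}^{6} a_{41} a_{50}^{4} \\ &\quad -9313504335000 a_{21}^{4} a_{41}^{2} a_{50}^{4}+5946721200000 a_{21}^{2} a_{41}^{3} a_{50}^{4} \\ &\quad +23826000000 a_{41}^{4} a_{50}^{4}-17785962180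 a_{21}^{6} a_{41}^{4} s-98929404000 a_{21}^{4} a_{41}^{5} s \\ &\quad +26934900000 a_{21}^{2} a_{41}^{6} s-160073659620 a_{21}^{7} a_{41}^{2} a_{50}^{2} s \\ &\quad -1398534984000 a_{21}^{5} a_{41}^{3} a_{50}^{2} s-2442981870000 a_{21}^{3} a_{41}^{4} a_{50}^{2} s \\ &\quad +18810000000 a_{41}^{4} a_{50}^{4} s+770106000000 a_{21} a_{41}^{5} a_{50}^{2} s \\ &\quad -360165734145 a_{21}^{8} a_{50}^{4} s+6998670000000 a_{21}^{2} a_{41}^{3} a_{50}^{4} s \\ &\quad -4290086997000 a_{21}^{6} a_{41} a_{50}^{4} s-10903637205000 a_{21}^{4} a_{41}^{2} a_{50}^{4} s \\ &\quad +4967473392 a_{21}^{6} a_{41}^{4} s^{2}+27628675200 a_{21}^{4} a_{41}^{5} s^{2} \\ &\quad -7529168000 a_{21}^{2} a_{41}^{6} s^{2}+44707260528 a_{21}^{7} a_{41}^{2} a_{50}^{2} s^{2} \\ &\quad +390585888000 a_{21}^{5} a_{41}^{3} a_{50}^{2} s^{2}+682203816000 a_{21}^{3} a_{41}^{4} a_{50}^{2}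 s^{2} \\ &\quad -215262400000 a_{21} a_{41}^{5} a_{50}^{2} s^{2}+100591336188 a_{21}^{8} a_{50}^{4} s^{2} \\ &\quad +1198155823200 a_{21}^{6} a_{41} a_{50}^{4} s^{2}+3044973060000 a_{21}^{4} a_{41}^{2} a_{50}^{4} s^{2} \\ &\quad -1955419200000 a_{21}^{2} a_{41}^{3} a_{50}^{4} s^{2}-5016000000 a_{41}^{4} a_{50}^{4} s^{2} \end{aligned}.$$ **System (B).** $$\begin{aligned} \lambda_1&=\tfrac13a_{21},\qquad \lambda_2=\tfrac15(6a_{03}+a_{41}),\qquad \lambda_3=-\tfrac17(2a_{03}a_{12}-2a_{23}+3a_{03}a_{50}),\\ \lambda_4&=\tfrac1{30}(40a_{05}-4a_{03}a_{32}-2a_{03}a_{12}a_{50}-5a_{03}a_{50}^2),\\ \lambda_5&=-\tfrac{a_{03}}{154}(48a_{03}^2-40a_{14}+12a_{12}a_{32}+6a_{12}^2a_{50}+12a_{32}a_{50}+21a_{12}a_{50}^2+18a_{50}^3). \end{aligned}$$ If $a_{12}+2a_{50}\neq0$, put $W=4a_{32}+2a_{12}a_{50}+5a_{50}^2$; then $$\begin{aligned}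 \lambda_6&=-\tfrac{a_{03}}{520}(64a_{03}^2a_{12}+16a_{32}^2+128a_{03}^2a_{50}+16a_{12}a_{32}a_{50}+4a_{12}^2a_{50}^2+32a_{32}a_{50}^2+20a_{12}a_{50}^3+23a_{50}^4),\\ \lambda_7&=-\frac{a_{03}W}{61600(a_{12}+2a_{50})}(112a_{12}^2a_{32}-432a_{32}^2+56a_{12}^3a_{50}-96a_{12}a_{32}a_{50}+200a_{12}^2a_{50}^2-640a_{32}a_{50}^2+120a_{12}a_{50}^3-85a_{50}^4),\\ \lambda_8&=\frac{7a_{03}W}{651463800(a_{12}+2a_{50})^2}(14372996a_{12}^4a_{32}-63894256a_{12}^2a_{32}^2+34076160a_{32}^3+7186498a_{12}^5a_{50}-10734116a_{12}^3a_{32}a_{50}\\ &\qquad-12772032a_{12}a_{32}^2a_{50}+28572751a_{12}^4a_{50}^2-99036264a_{12}^2a_{32}a_{50}^2+45544768a_{32}^2a_{50}^2+26958196a_{12}^3a_{50}^3-39087216a_{12}a_{32}a_{50}^3),\\ \lambda_9&=-\frac{a_{03}W\,f_4}{34719763221000\,(s+1)(4s-17)(a_{12}+2a_{50})^2}, \end{aligned}$$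 where $$f_4=\begin{aligned} &-175151884140096 a_{12}^{5} a_{32}+900479057104608 a_{12}^{3} a_{32}^{2}-870691837997952 a_{12} a_{32}^{3} \\ &\quad -87575942070048 a_{12}^{6} a_{50}+191710117401504 a_{12}^{4} a_{32} a_{50} \\ &\quad +108696440458488 a_{12}^{2} a_{32}^{2} a_{50}-135343772601984 a_{32}^{3} a_{50} \\ &\quad -348204560750520 a_{12}^{5} a_{50}^{2}+1449441463187484 a_{12}^{3} a_{32} a_{50}^{2} \\ &\quad -1227387674864544 a_{12} a_{32}^{2} a_{50}^{2}-328545834076764 a_{12}^{4} a_{50}^{3} \\ &\quad +705733010157654 a_{12}^{2} a_{32} a_{50}^{3}-180965555611680 a_{32}^{2} a_{50}^{3} \\ &\quad -196530256579516 a_{12}^{5} a_{32} s+956545497558256 a_{12}^{3} a_{32}^{2} s \\ &\quad -775708121404800 a_{12} a_{32}^{3} s-98265128289758 a_{12}^{6} a_{50} s \\ &\quad +188198718433828 a_{12}^{4} a_{32} a_{50} s-92031891970176 a_{32}^{3} a_{50} s \\ &\quad -390699835897045 a_{12}^{5} a_{50}^{2} s+1519172249991516 a_{12}^{3} a_{32}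 a_{50}^{2} s \\ &\quad -1080068393470816 a_{12} a_{32}^{2} a_{50}^{2} s-368634374118786 a_{12}^{4} a_{50}^{3} s \\ &\quad +690504693129726 a_{12}^{2} a_{32} a_{50}^{3} s-123060065895200 a_{32}^{2} a_{50}^{3} s \\ &\quad +80500800862640 a_{12}^{5} a_{32} s^{2}-396831061224512 a_{12}^{3} a_{32}^{2} s^{2} \\ &\quad +336523546570752 a_{12} a_{32}^{3} s^{2}+40250400431320 a_{12}^{6} a_{50} s^{2} \\ &\quad -79597335692936 a_{12}^{4} a_{32} a_{50} s^{2}-56511998888512 a_{12}^{2} a_{32}^{2} a_{50} s^{2} \\ &\quad +43311880631808 a_{32}^{3} a_{50} s^{2}+160035098537960 a_{12}^{5} a_{50}^{2} s^{2} \\ &\quad -632261525950008 a_{12}^{3} a_{32} a_{50}^{2} s^{2}+470151299998208 a_{12} a_{32}^{2} a_{50}^{2} s^{2} \\ &\quad +150997488382038 a_{12}^{4} a_{50}^{3} s^{2}+142715605813496 a_{12}^{2} a_{32}^{2} a_{50} s \\ &\quad -292287689531688 a_{12}^{2} a_{32} a_{50}^{3} s^{2}+57905489716480 a_{32}^{2}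 a_{50}^{3} s^{2} \end{aligned}.$$ If $a_{12}+2a_{50}=0$, then $\lambda_6=\frac{a_{03}}{520}(-4a_{32}+a_{50}^2)(4a_{32}+a_{50}^2)$; in addition, if $a_{32}=\frac{a_{50}^2}4$ and $a_{50}\ne0$, then $$\lambda_7=-\frac{9a_{03}}{7700}(4a_{32}+a_{50}^2)(24a_{03}^2+a_{50}^3),\qquad \lambda_8=\frac{7a_{03}}{13260}a_{50}^6,\qquad \lambda_9=\frac{a_{03}a_{50}^7(5391-205861s+66718s^2)}{13856700(1+s)(4s-17)},$$ and if $a_{32}=-\frac{a_{50}^2}4$, then $$\lambda_7=0,\qquad \lambda_8=-\frac{2a_{03}}{5525}(16a_{03}^2+a_{50}^3)(27a_{03}^2+2a_{50}^3),$$ $$\lambda_9=\frac{4a_{03}a_{50}(84+3064s-991s^2)}{1154725(1+s)(4s-17)}(16a_{03}^2+a_{50}^3)(27a_{03}^2+2a_{50}^3).$$ -/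

import Mathlib

namespace QuasiLyapunov

noncomputable section

/-- The monomial `a x^i y^j`, where `x` and `y` are the variables `0` and `1`. -/
def mono (a : ℝ) (i j : ℕ) : MvPolynomial (Fin 2) ℝ :=
  MvPolynomial.C a * MvPolynomial.X 0 ^ i * MvPolynomial.X 1 ^ j

/-- The coefficient of `x^i y^j` in a formal power series in `x` and `y`. -/
def cf (F : MvPowerSeries (Fin 2) ℝ) (i j : ℕ) : ℝ :=
  MvPowerSeries.coeff (Finsupp.single 0 i + Finsupp.single 1 j) F

/-- The formal series `(∂X/∂x + ∂Y/∂y) M - (s + 1) (∂M/∂x X + ∂M/∂y Y)` of the planar system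
`x' = X(x, y)`, `y' = Y(x, y)` and the formal series `M`. -/
def defect (X Y : MvPolynomial (Fin 2) ℝ) (s : ℕ) (M : MvPowerSeries (Fin 2) ℝ) :
    MvPowerSeries (Fin 2) ℝ :=
  ((MvPolynomial.pderiv 0 X + MvPolynomial.pderiv 1 Y : MvPolynomial (Fin 2) ℝ) :
      MvPowerSeries (Fin 2) ℝ) * M
    - ((s : ℝ) + 1) • (MvPowerSeries.pderiv ℝ 0 M * (X : MvPowerSeries (Fin 2) ℝ)
        + MvPowerSeries.pderiv ℝ 1 M * (Y : MvPowerSeries (Fin 2) ℝ))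

/-- `M = y^2 + (terms of degree at least 3)` is a formal series whose pure powers `y^β`, `β ≥ 3`,
have the prescribed coefficients `c β`, and for which the defect is a series in `x` alone which
starts with `x^3` or later. -/
structure IsFormalSeries (X Y : MvPolynomial (Fin 2) ℝ) (s : ℕ) (c : ℕ → ℝ)
    (M : MvPowerSeries (Fin 2) ℝ) : Prop where
  coeff_low : ∀ i j : ℕ, i + j < 3 → cf M i j = if i = 0 ∧ j = 2 then 1 else 0
  coeff_y : ∀ j : ℕ, 3 ≤ j → cf M 0 j = c j
  defect_eq : ∀ i j : ℕ, i < 3 ∨ 1 ≤ j → cf (defect X Y s M) i j = 0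

/-- The coefficient `ω_m` of `x^m` in the defect of `M`. -/
def omega (X Y : MvPolynomial (Fin 2) ℝ) (s : ℕ) (M : MvPowerSeries (Fin 2) ℝ) (m : ℕ) : ℝ :=
  cf (defect X Y s M) m 0

/-- The `m`-th quasi-Lyapunov constant `λ_m = ω_{2m+4} / (2m - 4s - 1)`. The denominator is an odd
integer, hence never zero. -/
def lam (X Y : MvPolynomial (Fin 2) ℝ) (s : ℕ) (M : MvPowerSeries (Fin 2) ℝ) (m : ℕ) : ℝ :=
  omega X Y s M (2 * m + 4) / (2 * (m : ℝ) - 4 * (s : ℝ) - 1)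

/-- The constants `λ_1, …, λ_{k-1}` all vanish. -/
def VanishBefore (X Y : MvPolynomial (Fin 2) ℝ) (s : ℕ) (M : MvPowerSeries (Fin 2) ℝ)
    (k : ℕ) : Prop :=
  ∀ j : ℕ, 1 ≤ j → j < k → lam X Y s M j = 0

/-- The cubic and quintic homogeneous terms shared by the two systems. -/
def H35 (a30 a21 a12 a03 a50 a41 a32 a23 a14 a05 : ℝ) : MvPolynomial (Fin 2) ℝ :=
  mono a30 3 0 + mono a21 2 1 + mono a12 1 2 + mono a03 0 3
    + mono a50 5 0 + mono a41 4 1 + mono a32 3 2 + mono a23 2 3 + mono a14 1 4 + mono a05 0 5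

/-- First component of the first system: `y + a30 x^3 + ⋯ + a05 y^5`. -/
def systemAX (a30 a21 a12 a03 a50 a41 a32 a23 a14 a05 : ℝ) : MvPolynomial (Fin 2) ℝ :=
  mono 1 0 1 + H35 a30 a21 a12 a03 a50 a41 a32 a23 a14 a05

/-- Second component of the first system: `-2 x^3`. -/
def systemAY : MvPolynomial (Fin 2) ℝ := mono (-2) 3 0

/-- First component of the second system: `y`. -/
def systemBX : MvPolynomial (Fin 2) ℝ := mono 1 0 1

/-- Second component of the second system: `-2 x^3 + a21 x^2 y + ⋯ + a05 y^5`; there is no further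
`x^3` term. -/
def systemBY (a21 a12 a03 a50 a41 a32 a23 a14 a05 : ℝ) : MvPolynomial (Fin 2) ℝ :=
  mono (-2) 3 0 + H35 0 a21 a12 a03 a50 a41 a32 a23 a14 a05

/-- The polynomial in the tenth constant of the first system. -/
def f1 (a21 a41 a50 s : ℝ) : ℝ :=
  -15174868212 * a21 ^ 6 * a41 ^ 4 - 84454927200 * a21 ^ 4 * a41 ^ 5
  + 22768748000 * a21 ^ 2 * a41 ^ 6 - 136573813908 * a21 ^ 7 * a41 ^ 2 * a50 ^ 2
  - 1193662008000 * a21 ^ 5 * a41 ^ 3 * a50 ^ 2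
  - 2087643726000 * a21 ^ 3 * a41 ^ 4 * a50 ^ 2 + 651216400000 * a21 * a41 ^ 5 * a50 ^ 2
  - 307291081293 * a21 ^ 8 * a50 ^ 4 - 3661266760200 * a21 ^ 6 * a41 * a50 ^ 4
  - 9313504335000 * a21 ^ 4 * a41 ^ 2 * a50 ^ 4
  + 5946721200000 * a21 ^ 2 * a41 ^ 3 * a50 ^ 4 + 23826000000 * a41 ^ 4 * a50 ^ 4
  - 17785962180 * a21 ^ 6 * a41 ^ 4 * s - 98929404000 * a21 ^ 4 * a41 ^ 5 * s
  + 26934900000 * a21 ^ 2 * a41 ^ 6 * s - 160073659620 * a21 ^ 7 * a41 ^ 2 * a50 ^ 2 * s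
  - 1398534984000 * a21 ^ 5 * a41 ^ 3 * a50 ^ 2 * s
  - 2442981870000 * a21 ^ 3 * a41 ^ 4 * a50 ^ 2 * s + 18810000000 * a41 ^ 4 * a50 ^ 4 * s
  + 770106000000 * a21 * a41 ^ 5 * a50 ^ 2 * s - 360165734145 * a21 ^ 8 * a50 ^ 4 * s
  + 6998670000000 * a21 ^ 2 * a41 ^ 3 * a50 ^ 4 * s
  - 4290086997000 * a21 ^ 6 * a41 * a50 ^ 4 * s
  - 10903637205000 * a21 ^ 4 * a41 ^ 2 * a50 ^ 4 * s
  + 4967473392 * a21 ^ 6 * a41 ^ 4 * s ^ 2 + 27628675200 * a21 ^ 4 * a41 ^ 5 * s ^ 2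
  - 7529168000 * a21 ^ 2 * a41 ^ 6 * s ^ 2
  + 44707260528 * a21 ^ 7 * a41 ^ 2 * a50 ^ 2 * s ^ 2
  + 390585888000 * a21 ^ 5 * a41 ^ 3 * a50 ^ 2 * s ^ 2
  + 682203816000 * a21 ^ 3 * a41 ^ 4 * a50 ^ 2 * s ^ 2
  - 215262400000 * a21 * a41 ^ 5 * a50 ^ 2 * s ^ 2
  + 100591336188 * a21 ^ 8 * a50 ^ 4 * s ^ 2
  + 1198155823200 * a21 ^ 6 * a41 * a50 ^ 4 * s ^ 2
  + 3044973060000 * a21 ^ 4 * a41 ^ 2 * a50 ^ 4 * s ^ 2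
  - 1955419200000 * a21 ^ 2 * a41 ^ 3 * a50 ^ 4 * s ^ 2
  - 5016000000 * a41 ^ 4 * a50 ^ 4 * s ^ 2

/-- The polynomial in the eighth constant of the first system. -/
def f2 (a21 a41 a50 : ℝ) : ℝ :=
  28 * a21 * a41 ^ 4 + 252 * a21 ^ 2 * a41 ^ 2 * a50 ^ 2 + 800 * a41 ^ 3 * a50 ^ 2
  + 567 * a21 ^ 3 * a50 ^ 4 + 3600 * a21 * a41 * a50 ^ 4 + 4500 * a50 ^ 6

/-- The polynomial in the ninth constant of the first system. -/
def f3 (a21 a41 a50 : ℝ) : ℝ :=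
  4 * a21 ^ 2 * a41 ^ 4 + 36 * a21 ^ 3 * a41 ^ 2 * a50 ^ 2 + 100 * a21 * a41 ^ 3 * a50 ^ 2
  + 81 * a21 ^ 4 * a50 ^ 4 + 450 * a21 ^ 2 * a41 * a50 ^ 4 - 125 * a41 ^ 2 * a50 ^ 4

/-- The polynomial in the ninth constant of the second system. -/
def f4 (a12 a32 a50 s : ℝ) : ℝ :=
  -175151884140096 * a12 ^ 5 * a32 + 900479057104608 * a12 ^ 3 * a32 ^ 2
  - 870691837997952 * a12 * a32 ^ 3 - 87575942070048 * a12 ^ 6 * a50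
  + 191710117401504 * a12 ^ 4 * a32 * a50 + 108696440458488 * a12 ^ 2 * a32 ^ 2 * a50
  - 135343772601984 * a32 ^ 3 * a50 - 348204560750520 * a12 ^ 5 * a50 ^ 2
  + 1449441463187484 * a12 ^ 3 * a32 * a50 ^ 2
  - 1227387674864544 * a12 * a32 ^ 2 * a50 ^ 2 - 328545834076764 * a12 ^ 4 * a50 ^ 3
  + 705733010157654 * a12 ^ 2 * a32 * a50 ^ 3 - 180965555611680 * a32 ^ 2 * a50 ^ 3
  - 196530256579516 * a12 ^ 5 * a32 * s + 956545497558256 * a12 ^ 3 * a32 ^ 2 * s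
  - 775708121404800 * a12 * a32 ^ 3 * s - 98265128289758 * a12 ^ 6 * a50 * s
  + 188198718433828 * a12 ^ 4 * a32 * a50 * s - 92031891970176 * a32 ^ 3 * a50 * s
  - 390699835897045 * a12 ^ 5 * a50 ^ 2 * s
  + 1519172249991516 * a12 ^ 3 * a32 * a50 ^ 2 * s
  - 1080068393470816 * a12 * a32 ^ 2 * a50 ^ 2 * s
  - 368634374118786 * a12 ^ 4 * a50 ^ 3 * s
  + 690504693129726 * a12 ^ 2 * a32 * a50 ^ 3 * s
  - 123060065895200 * a32 ^ 2 * a50 ^ 3 * s + 80500800862640 * a12 ^ 5 * a32 * s ^ 2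
  - 396831061224512 * a12 ^ 3 * a32 ^ 2 * s ^ 2 + 336523546570752 * a12 * a32 ^ 3 * s ^ 2
  + 40250400431320 * a12 ^ 6 * a50 * s ^ 2 - 79597335692936 * a12 ^ 4 * a32 * a50 * s ^ 2
  - 56511998888512 * a12 ^ 2 * a32 ^ 2 * a50 * s ^ 2
  + 43311880631808 * a32 ^ 3 * a50 * s ^ 2 + 160035098537960 * a12 ^ 5 * a50 ^ 2 * s ^ 2
  - 632261525950008 * a12 ^ 3 * a32 * a50 ^ 2 * s ^ 2
  + 470151299998208 * a12 * a32 ^ 2 * a50 ^ 2 * s ^ 2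
  + 150997488382038 * a12 ^ 4 * a50 ^ 3 * s ^ 2
  + 142715605813496 * a12 ^ 2 * a32 ^ 2 * a50 * s
  - 292287689531688 * a12 ^ 2 * a32 * a50 ^ 3 * s ^ 2
  + 57905489716480 * a32 ^ 2 * a50 ^ 3 * s ^ 2

/-- The polynomial in the seventh constant of the second system. -/
def f5 (a12 a32 a50 : ℝ) : ℝ :=
  112 * a12 ^ 2 * a32 - 432 * a32 ^ 2 + 56 * a12 ^ 3 * a50 - 96 * a12 * a32 * a50
  + 200 * a12 ^ 2 * a50 ^ 2 - 640 * a32 * a50 ^ 2 + 120 * a12 * a50 ^ 3 - 85 * a50 ^ 4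

/-- The polynomial in the eighth constant of the second system. -/
def f6 (a12 a32 a50 : ℝ) : ℝ :=
  14372996 * a12 ^ 4 * a32 - 63894256 * a12 ^ 2 * a32 ^ 2 + 34076160 * a32 ^ 3
  + 7186498 * a12 ^ 5 * a50 - 10734116 * a12 ^ 3 * a32 * a50 - 12772032 * a12 * a32 ^ 2 * a50
  + 28572751 * a12 ^ 4 * a50 ^ 2 - 99036264 * a12 ^ 2 * a32 * a50 ^ 2
  + 45544768 * a32 ^ 2 * a50 ^ 2 + 26958196 * a12 ^ 3 * a50 ^ 3
  - 39087216 * a12 * a32 * a50 ^ 3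

end

end QuasiLyapunov

namespace QuasiLyapunov

noncomputable section

/-- The polynomial with the terms `a x^k y^l`, for `(k, l, a)` in the list. -/
def ofTerms (T : List (ℕ × ℕ × ℝ)) : MvPolynomial (Fin 2) ℝ :=
  (T.map fun t => mono t.2.2 t.1 t.2.1).sum

/-- The contribution of the term `a x^k y^l` of the first component to the coefficient of
`x^p y^q` in `σ (div V) M - V · ∇M`, where `c` is the coefficient function of `M`. -/
def contribX (σ : ℝ) (c : ℕ → ℕ → ℝ) (p q : ℕ) (t : ℕ × ℕ × ℝ) : ℝ :=
  if t.1 ≤ p + 1 ∧ t.2.1 ≤ q then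
    t.2.2 * (σ * t.1 - (p + 1 - t.1 : ℕ)) * c (p + 1 - t.1) (q - t.2.1)
  else 0

/-- The contribution of the term `a x^k y^l` of the second component to the coefficient of
`x^p y^q` in `σ (div V) M - V · ∇M`, where `c` is the coefficient function of `M`. -/
def contribY (σ : ℝ) (c : ℕ → ℕ → ℝ) (p q : ℕ) (t : ℕ × ℕ × ℝ) : ℝ :=
  if t.1 ≤ p ∧ t.2.1 ≤ q + 1 then
    t.2.2 * (σ * t.2.1 - (q + 1 - t.2.1 : ℕ)) * c (p - t.1) (q + 1 - t.2.1)
  else 0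

/-- The coefficient of `x^p y^q` in `σ (div V) M - V · ∇M`, where `V` has the given terms. -/
def transport (σ : ℝ) (TX TY : List (ℕ × ℕ × ℝ)) (c : ℕ → ℕ → ℝ) (p q : ℕ) : ℝ :=
  (TX.map (contribX σ c p q)).sum + (TY.map (contribY σ c p q)).sum

lemma cf_add (F G : MvPowerSeries (Fin 2) ℝ) (i j : ℕ) : cf (F + G) i j = cf F i j + cf G i j := by
  simp [cf]

lemma cf_sub (F G : MvPowerSeries (Fin 2) ℝ) (i j : ℕ) : cf (F - G) i j = cf F i j - cf G i j := by
  simp [cf]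

lemma cf_smul (r : ℝ) (F : MvPowerSeries (Fin 2) ℝ) (i j : ℕ) : cf (r • F) i j = r * cf F i j := by
  simp [cf]

lemma ext_cf {F G : MvPowerSeries (Fin 2) ℝ} (h : ∀ i j, cf F i j = cf G i j) : F = G := by
  ext n
  have hn : n = Finsupp.single 0 (n 0) + Finsupp.single 1 (n 1) := by
    ext i
    fin_cases i <;> simp
  rw [hn]
  exact h _ _

lemma mono_eq_monomial (a : ℝ) (k l : ℕ) :
    mono a k l = MvPolynomial.monomial (Finsupp.single 0 k + Finsupp.single 1 l) a := by
  rw [mono, MvPolynomial.X_pow_eq_monomial, MvPolynomial.X_pow_eq_monomial,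
    MvPolynomial.C_mul_monomial, MvPolynomial.monomial_mul]
  simp

lemma pderiv_zero_mono (a : ℝ) (k l : ℕ) :
    MvPolynomial.pderiv 0 (mono a k l) = mono (a * k) (k - 1) l := by
  rw [mono_eq_monomial, mono_eq_monomial, MvPolynomial.pderiv_monomial]
  have h : (Finsupp.single 0 k + Finsupp.single 1 l - Finsupp.single 0 1 : Fin 2 →₀ ℕ) =
      Finsupp.single 0 (k - 1) + Finsupp.single 1 l := by
    ext i
    fin_cases i <;> simp
  rw [h]
  simp

lemma pderiv_one_mono (a : ℝ) (k l : ℕ) :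
    MvPolynomial.pderiv 1 (mono a k l) = mono (a * l) k (l - 1) := by
  rw [mono_eq_monomial, mono_eq_monomial, MvPolynomial.pderiv_monomial]
  have h : (Finsupp.single 0 k + Finsupp.single 1 l - Finsupp.single 1 1 : Fin 2 →₀ ℕ) =
      Finsupp.single 0 k + Finsupp.single 1 (l - 1) := by
    ext i
    fin_cases i <;> simp
  rw [h]
  simp

lemma single_add_single_le {k l p q : ℕ} :
    (Finsupp.single 0 k + Finsupp.single 1 l : Fin 2 →₀ ℕ) ≤
      Finsupp.single 0 p + Finsupp.single 1 q ↔ k ≤ p ∧ l ≤ q := by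
  rw [Finsupp.le_def]
  simp [Fin.forall_fin_two]

lemma single_add_single_sub (k l p q : ℕ) :
    (Finsupp.single 0 p + Finsupp.single 1 q : Fin 2 →₀ ℕ) -
      (Finsupp.single 0 k + Finsupp.single 1 l) =
      Finsupp.single 0 (p - k) + Finsupp.single 1 (q - l) := by
  ext i
  fin_cases i <;> simp

lemma cf_mono_mul (a : ℝ) (k l : ℕ) (F : MvPowerSeries (Fin 2) ℝ) (p q : ℕ) :
    cf ((mono a k l : MvPowerSeries (Fin 2) ℝ) * F) p q =
      if k ≤ p ∧ l ≤ q then a * cf F (p - k) (q - l) else 0 := by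
  rw [mono_eq_monomial, MvPolynomial.coe_monomial, cf, MvPowerSeries.coeff_monomial_mul]
  simp only [single_add_single_le, single_add_single_sub, cf]

lemma cf_pderiv_zero (F : MvPowerSeries (Fin 2) ℝ) (p q : ℕ) :
    cf (MvPowerSeries.pderiv ℝ 0 F) p q = (p + 1) * cf F (p + 1) q := by
  rw [cf, MvPowerSeries.coeff_pderiv, cf, mul_comm]
  congr 2
  · simp
  · rw [Finsupp.single_add]
    abel_nf

lemma cf_pderiv_one (F : MvPowerSeries (Fin 2) ℝ) (p q : ℕ) :
    cf (MvPowerSeries.pderiv ℝ 1 F) p q = (q + 1) * cf F p (q + 1) := by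
  rw [cf, MvPowerSeries.coeff_pderiv, cf, mul_comm]
  congr 2
  · simp
  · rw [Finsupp.single_add]
    abel_nf

lemma cf_termX (s : ℕ) (M : MvPowerSeries (Fin 2) ℝ) (a : ℝ) (k l p q : ℕ) :
    cf ((MvPolynomial.pderiv 0 (mono a k l) : MvPolynomial (Fin 2) ℝ) * M
      - ((s : ℝ) + 1) • (MvPowerSeries.pderiv ℝ 0 M * (mono a k l : MvPowerSeries (Fin 2) ℝ))) p q
      = (s + 1) * contribX (1 / (s + 1)) (cf M) p q (k, l, a) := by
  have hs : (s : ℝ) + 1 ≠ 0 := by positivity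
  rw [cf_sub, cf_smul, mul_comm (MvPowerSeries.pderiv ℝ 0 M), pderiv_zero_mono, cf_mono_mul,
    cf_mono_mul, cf_pderiv_zero, contribX]
  by_cases hl : l ≤ q
  · rcases Nat.lt_trichotomy k (p + 1) with hk | hk | hk
    · have h1 : p - k + 1 = p + 1 - k := by omega
      have h3 : ((p - k : ℕ) : ℝ) + 1 = ((p + 1 - k : ℕ) : ℝ) := by rw [← h1]; push_cast; ring
      rcases Nat.eq_zero_or_pos k with rfl | hk0
      · simp only [Nat.zero_le, hl, and_self, if_true, h1, h3]
        push_cast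
        rw [mul_zero, zero_mul, ite_self]
        field_simp
        ring
      · have h2 : p - (k - 1) = p + 1 - k := by omega
        rw [if_pos ⟨by omega, hl⟩, if_pos ⟨by omega, hl⟩, if_pos ⟨by simp; omega, hl⟩, h1, h2, h3]
        field_simp
    · subst hk
      simp [hl]
      field_simp
    · rw [if_neg (by omega), if_neg (by omega), if_neg (by simp; omega)]
      simp
  · simp [hl]

lemma cf_termY (s : ℕ) (M : MvPowerSeries (Fin 2) ℝ) (a : ℝ) (k l p q : ℕ) :
    cf ((MvPolynomial.pderiv 1 (mono a k l) : MvPolynomial (Fin 2) ℝ) * M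
      - ((s : ℝ) + 1) • (MvPowerSeries.pderiv ℝ 1 M * (mono a k l : MvPowerSeries (Fin 2) ℝ))) p q
      = (s + 1) * contribY (1 / (s + 1)) (cf M) p q (k, l, a) := by
  have hs : (s : ℝ) + 1 ≠ 0 := by positivity
  rw [cf_sub, cf_smul, mul_comm (MvPowerSeries.pderiv ℝ 1 M), pderiv_one_mono, cf_mono_mul,
    cf_mono_mul, cf_pderiv_one, contribY]
  by_cases hk : k ≤ p
  · rcases Nat.lt_trichotomy l (q + 1) with hl | hl | hl
    · have h1 : q - l + 1 = q + 1 - l := by omega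
      have h3 : ((q - l : ℕ) : ℝ) + 1 = ((q + 1 - l : ℕ) : ℝ) := by rw [← h1]; push_cast; ring
      rcases Nat.eq_zero_or_pos l with rfl | hl0
      · simp only [Nat.zero_le, hk, and_self, if_true, h1, h3]
        push_cast
        rw [mul_zero, zero_mul, ite_self]
        field_simp
        ring
      · have h2 : q - (l - 1) = q + 1 - l := by omega
        rw [if_pos ⟨hk, by omega⟩, if_pos ⟨hk, by omega⟩, if_pos ⟨hk, by simp; omega⟩, h1, h2, h3]
        field_simp
    · subst hl
      simp [hk]
      field_simp
    · rw [if_neg (by omega), if_neg (by omega), if_neg (by simp; omega)]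
      simp
  · simp [hk]

lemma cf_termsX (s : ℕ) (M : MvPowerSeries (Fin 2) ℝ) (T : List (ℕ × ℕ × ℝ)) (p q : ℕ) :
    cf ((MvPolynomial.pderiv 0 (ofTerms T) : MvPolynomial (Fin 2) ℝ) * M
      - ((s : ℝ) + 1) • (MvPowerSeries.pderiv ℝ 0 M * (ofTerms T : MvPowerSeries (Fin 2) ℝ))) p q
      = (s + 1) * (T.map (contribX (1 / (s + 1)) (cf M) p q)).sum := by
  induction T with
  | nil => simp [ofTerms, cf]
  | cons t T ih =>
    have h : ofTerms (t :: T) = mono t.2.2 t.1 t.2.1 + ofTerms T := by simp [ofTerms]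
    rw [h, List.map_cons, List.sum_cons, mul_add, ← ih, ← cf_termX, ← cf_add]
    congr 1
    simp only [map_add, MvPolynomial.coe_add, smul_add, mul_add, add_mul]
    abel

lemma cf_termsY (s : ℕ) (M : MvPowerSeries (Fin 2) ℝ) (T : List (ℕ × ℕ × ℝ)) (p q : ℕ) :
    cf ((MvPolynomial.pderiv 1 (ofTerms T) : MvPolynomial (Fin 2) ℝ) * M
      - ((s : ℝ) + 1) • (MvPowerSeries.pderiv ℝ 1 M * (ofTerms T : MvPowerSeries (Fin 2) ℝ))) p q
      = (s + 1) * (T.map (contribY (1 / (s + 1)) (cf M) p q)).sum := by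
  induction T with
  | nil => simp [ofTerms, cf]
  | cons t T ih =>
    have h : ofTerms (t :: T) = mono t.2.2 t.1 t.2.1 + ofTerms T := by simp [ofTerms]
    rw [h, List.map_cons, List.sum_cons, mul_add, ← ih, ← cf_termY, ← cf_add]
    congr 1
    simp only [map_add, MvPolynomial.coe_add, smul_add, mul_add, add_mul]
    abel

lemma cf_defect {X Y : MvPolynomial (Fin 2) ℝ} {TX TY : List (ℕ × ℕ × ℝ)}
    (hX : X = mono 1 0 1 + ofTerms TX) (hY : Y = ofTerms TY) (s : ℕ)
    (M : MvPowerSeries (Fin 2) ℝ) (p q : ℕ) :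
    cf (defect X Y s M) p q = (s + 1) * (transport (1 / (s + 1)) TX TY (cf M) p q
      - if 1 ≤ q then (p + 1) * cf M (p + 1) (q - 1) else 0) := by
  have hy := cf_termX s M 1 0 1 p q
  have h : defect X Y s M =
      ((MvPolynomial.pderiv 0 (mono 1 0 1) : MvPolynomial (Fin 2) ℝ) * M
      - ((s : ℝ) + 1) • (MvPowerSeries.pderiv ℝ 0 M * (mono 1 0 1 : MvPowerSeries (Fin 2) ℝ)))
      + ((MvPolynomial.pderiv 0 (ofTerms TX) : MvPolynomial (Fin 2) ℝ) * M
      - ((s : ℝ) + 1) • (MvPowerSeries.pderiv ℝ 0 M * (ofTerms TX : MvPowerSeries (Fin 2) ℝ)))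
      + ((MvPolynomial.pderiv 1 (ofTerms TY) : MvPolynomial (Fin 2) ℝ) * M
      - ((s : ℝ) + 1) • (MvPowerSeries.pderiv ℝ 1 M * (ofTerms TY : MvPowerSeries (Fin 2) ℝ))) := by
    rw [defect, hX, hY]
    simp only [map_add, MvPolynomial.coe_add, smul_add, mul_add, add_mul]
    abel
  rw [h, cf_add, cf_add, cf_termsX, cf_termsY, hy, transport, contribX]
  simp only [Nat.zero_le, true_and]
  split_ifs <;> simp <;> ring

/-- The coefficient function of a formal series of the system satisfies the recursion which
determines it. -/
lemma IsFormalSeries.recursion {X Y : MvPolynomial (Fin 2) ℝ} {TX TY : List (ℕ × ℕ × ℝ)}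
    (hX : X = mono 1 0 1 + ofTerms TX) (hY : Y = ofTerms TY) {s : ℕ} {γ : ℕ → ℝ}
    {M : MvPowerSeries (Fin 2) ℝ} (hM : IsFormalSeries X Y s γ M) (p q : ℕ) :
    (p + 1) * cf M (p + 1) q = transport (1 / (s + 1)) TX TY (cf M) p (q + 1) := by
  have h := hM.defect_eq p (q + 1) (by omega)
  have hs : (s : ℝ) + 1 ≠ 0 := by positivity
  rw [cf_defect hX hY, mul_eq_zero, or_iff_right hs] at h
  simp at h
  rw [one_div]
  linarith

lemma omega_eq_transport {X Y : MvPolynomial (Fin 2) ℝ} {TX TY : List (ℕ × ℕ × ℝ)}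
    (hX : X = mono 1 0 1 + ofTerms TX) (hY : Y = ofTerms TY) (s : ℕ)
    (M : MvPowerSeries (Fin 2) ℝ) (m : ℕ) :
    omega X Y s M m = (s + 1) * transport (1 / (s + 1)) TX TY (cf M) m 0 := by
  rw [omega, cf_defect hX hY]
  simp

/-- The transport coefficients depend only on the coefficients of lower total degree. -/
lemma transport_congr {σ : ℝ} {TX TY : List (ℕ × ℕ × ℝ)} (hTX : ∀ t ∈ TX, 3 ≤ t.1 + t.2.1)
    (hTY : ∀ t ∈ TY, 3 ≤ t.1 + t.2.1) {c c' : ℕ → ℕ → ℝ} {p q : ℕ}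
    (h : ∀ i j, i + j + 2 ≤ p + q → c i j = c' i j) :
    transport σ TX TY c p q = transport σ TX TY c' p q := by
  rw [transport, transport]
  congr 2
  · refine List.map_congr_left fun t ht => ?_
    have := hTX t ht
    rw [contribX, contribX]
    split_ifs with h1
    · rw [h _ _ (by omega)]
    · rfl
  · refine List.map_congr_left fun t ht => ?_
    have := hTY t ht
    rw [contribY, contribY]
    split_ifs with h1
    · rw [h _ _ (by omega)]
    · rfl

lemma transport_zero (σ : ℝ) (TX TY : List (ℕ × ℕ × ℝ)) (p q : ℕ) :
    transport σ TX TY (fun _ _ => 0) p q = 0 := by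
  have h1 : contribX σ (fun _ _ => 0) p q = fun _ => 0 := by
    ext t
    simp [contribX]
  have h2 : contribY σ (fun _ _ => 0) p q = fun _ => 0 := by
    ext t
    simp [contribY]
  simp [transport, h1, h2]

/-- The `n`-th approximation of the coefficient function of the formal series. -/
def approx (σ : ℝ) (TX TY : List (ℕ × ℕ × ℝ)) (γ : ℕ → ℝ) : ℕ → ℕ → ℕ → ℝ
  | 0, _, _ => 0
  | n + 1, i, j =>
    if i + j < 3 then if i = 0 ∧ j = 2 then 1 else 0
    else if i = 0 then γ j
    else transport σ TX TY (approx σ TX TY γ n) (i - 1) (j + 1) / i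

lemma approx_stable {σ : ℝ} {TX TY : List (ℕ × ℕ × ℝ)} (hTX : ∀ t ∈ TX, 3 ≤ t.1 + t.2.1)
    (hTY : ∀ t ∈ TY, 3 ≤ t.1 + t.2.1) (γ : ℕ → ℝ) :
    ∀ n m i j : ℕ, i + j < n → i + j < m →
      approx σ TX TY γ n i j = approx σ TX TY γ m i j := by
  intro n
  induction n with
  | zero => intro m i j h; omega
  | succ n ih =>
    intro m i j hn hm
    obtain ⟨m, rfl⟩ : ∃ k, m = k + 1 := ⟨m - 1, by omega⟩
    rw [approx, approx]
    split_ifs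
    · rfl
    · rfl
    · rfl
    · rw [transport_congr hTX hTY fun i j h => ih m i j (by omega) (by omega)]

theorem existsUnique_isFormalSeries {X Y : MvPolynomial (Fin 2) ℝ} {TX TY : List (ℕ × ℕ × ℝ)}
    (hX : X = mono 1 0 1 + ofTerms TX) (hY : Y = ofTerms TY)
    (hTX : ∀ t ∈ TX, 3 ≤ t.1 + t.2.1) (hTY : ∀ t ∈ TY, 3 ≤ t.1 + t.2.1) (s : ℕ) (γ : ℕ → ℝ) :
    ∃! M : MvPowerSeries (Fin 2) ℝ, IsFormalSeries X Y s γ M := by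
  set σ : ℝ := 1 / (s + 1)
  have hs : (s : ℝ) + 1 ≠ 0 := by positivity
  set A := approx σ TX TY γ
  let M : MvPowerSeries (Fin 2) ℝ := fun n => A (n 0 + n 1 + 1) (n 0) (n 1)
  have hM : ∀ i j, cf M i j = A (i + j + 1) i j := by
    intro i j
    change M _ = _
    simp [M]
  have hlow : ∀ i j, i + j < 3 → cf M i j = if i = 0 ∧ j = 2 then 1 else 0 := by
    intro i j h
    rw [hM]
    simp only [A]
    rw [approx, if_pos h]
  have hzero : ∀ p q, p + q < 4 → transport σ TX TY (cf M) p q = 0 := by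
    intro p q h
    rw [← transport_zero σ TX TY p q]
    refine transport_congr hTX hTY fun i j hij => ?_
    rw [hlow i j (by omega), if_neg (by omega)]
  refine ⟨M, ⟨hlow, ?_, ?_⟩, ?_⟩
  · intro j hj
    rw [hM]
    simp only [A]
    rw [approx, if_neg (by omega), if_pos rfl]
  · intro p q hpq
    rw [cf_defect hX hY]
    rcases Nat.eq_zero_or_pos q with rfl | hq
    · rw [hzero p 0 (by omega)]
      simp
    · obtain ⟨q, rfl⟩ : ∃ k, q = k + 1 := ⟨q - 1, by omega⟩
      rw [if_pos (by omega), Nat.add_sub_cancel]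
      have hp : (p : ℝ) + 1 ≠ 0 := by positivity
      by_cases h : p + 1 + q < 3
      · rw [hzero p (q + 1) (by omega), hlow _ _ h, if_neg (by omega)]
        simp
      · have h1 : cf M (p + 1) q = transport σ TX TY (cf M) p (q + 1) / (p + 1) := by
          rw [hM]
          simp only [A]
          rw [approx, if_neg h, if_neg (by omega), Nat.add_sub_cancel, Nat.cast_add_one]
          congr 1
          refine transport_congr hTX hTY fun i j hij => ?_
          rw [hM]
          exact approx_stable hTX hTY γ _ _ i j (by omega) (by omega)
        rw [h1, mul_div_cancel₀ _ hp, sub_self, mul_zero]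
  · intro N hN
    refine ext_cf fun i j => ?_
    induction h : i + j using Nat.strong_induction_on generalizing i j with
    | _ n ih =>
      by_cases h3 : i + j < 3
      · rw [hN.coeff_low i j h3, hlow i j h3]
      · rw [hM]
        simp only [A]
        rw [approx, if_neg h3]
        cases i with
        | zero => exact hN.coeff_y j (by omega)
        | succ p =>
          have hp : (p : ℝ) + 1 ≠ 0 := by positivity
          rw [if_neg (by omega), Nat.add_sub_cancel, Nat.cast_add_one, eq_div_iff hp, mul_comm, hN.recursion hX hY p j]
          refine transport_congr hTX hTY fun i' j' hij => ?_
          rw [ih (i' + j') (by omega) i' j' rfl, hM]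
          exact approx_stable hTX hTY γ _ _ i' j' (by omega) (by omega)

/-- If the system is reversible with respect to `(x, t) ↦ (-x, -t)`, the formal series is even
in `x` and its constants vanish. -/
theorem lam_eq_zero_of_reversible {X Y : MvPolynomial (Fin 2) ℝ} {TX TY : List (ℕ × ℕ × ℝ)}
    (hX : X = mono 1 0 1 + ofTerms TX) (hY : Y = ofTerms TY)
    (hTX : ∀ t ∈ TX, 3 ≤ t.1 + t.2.1) (hTY : ∀ t ∈ TY, 3 ≤ t.1 + t.2.1)
    (hX' : ∀ t ∈ TX, Odd t.1 → t.2.2 = 0) (hY' : ∀ t ∈ TY, Even t.1 → t.2.2 = 0)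
    {s : ℕ} {γ : ℕ → ℝ} {M : MvPowerSeries (Fin 2) ℝ} (hM : IsFormalSeries X Y s γ M) (m : ℕ) :
    lam X Y s M m = 0 := by
  have key : ∀ σ : ℝ, ∀ c : ℕ → ℕ → ℝ, ∀ p q, Even p →
      (∀ i j, i + j + 2 ≤ p + q → Odd i → c i j = 0) → transport σ TX TY c p q = 0 := by
    intro σ c p q hp hc
    rw [transport, List.sum_eq_zero, List.sum_eq_zero, add_zero]
    · simp only [List.mem_map]
      rintro _ ⟨t, ht, rfl⟩
      rw [contribY]
      have := hTY t ht
      split_ifs with h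
      · rcases Nat.even_or_odd t.1 with h1 | h1
        · simp [hY' t ht h1]
        · rw [hc _ _ (by omega) (Nat.Even.sub_odd h.1 hp h1), mul_zero]
      · rfl
    · simp only [List.mem_map]
      rintro _ ⟨t, ht, rfl⟩
      rw [contribX]
      have := hTX t ht
      split_ifs with h
      · rcases Nat.even_or_odd t.1 with h1 | h1
        · rw [hc _ _ (by omega) (Nat.Odd.sub_even h.1 hp.add_one h1), mul_zero]
        · simp [hX' t ht h1]
      · rfl
  have hodd : ∀ n i j, i + j = n → Odd i → cf M i j = 0 := by
    intro n
    induction n using Nat.strong_induction_on with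
    | _ n ih =>
      intro i j hij hi
      obtain ⟨k, rfl⟩ := hi
      have h := hM.recursion hX hY (2 * k) j
      rw [key _ _ _ _ (even_two_mul k) fun i' j' h' hi' => ih (i' + j') (by omega) i' j' rfl hi',
        mul_eq_zero] at h
      exact h.resolve_left (by positivity)
  rw [lam, omega_eq_transport hX hY, key _ _ _ _ ⟨m + 2, by ring⟩ fun i j _ hi => hodd _ i j rfl hi]
  simp

end

end QuasiLyapunov


namespace QuasiLyapunov

noncomputable section

/-! ### Polynomials with integer coefficients which the kernel can compute with

The operations are written with recursors, which the kernel evaluates faster than compiled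
pattern matching. -/

/-- A polynomial with integer coefficients, as a list of terms `(code, coefficient)`, where the
digits of the code in base `64` are the exponents of the monomial. -/
abbrev CodedPoly := List (ℕ × ℤ)

namespace CodedPoly

/-- The value of the monomial with the given code in the first `n` variables. -/
def mval : ℕ → (ℕ → ℝ) → ℕ → ℝ
  | 0, _, _ => 1
  | n + 1, v, c => v 0 ^ (c % 64) * mval n (fun k => v (k + 1)) (c / 64)

/-- The value of a polynomial in `n` variables. -/
def eval (n : ℕ) (v : ℕ → ℝ) (p : CodedPoly) : ℝ :=
  (p.map fun t => (t.2 : ℝ) * mval n v t.1).sum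

/-- The first `n` exponents of the monomial are less than `b`. -/
def smallCode (b : ℕ) : ℕ → ℕ → Bool
  | 0, _ => true
  | n + 1, c => Nat.blt (c % 64) b && smallCode b n (c / 64)

/-- All exponents are less than `b`. -/
def small (b n : ℕ) (p : CodedPoly) : Bool := p.all fun t => smallCode b n t.1

def isZeroInt (z : ℤ) : Bool := Int.rec (fun n => Nat.beq n 0) (fun _ => false) z

/-- Put a term in front of a polynomial, unless its coefficient is zero. -/
def consTerm (c : ℕ) (z : ℤ) (p : CodedPoly) : CodedPoly :=
  Bool.rec ((c, z) :: p) p (isZeroInt z)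

/-- The sum of two polynomials, by merging. -/
def add (p : CodedPoly) : CodedPoly → CodedPoly :=
  List.rec (fun q => q) (fun a as ih q =>
    List.rec (a :: as) (fun b bs ihb =>
      Bool.rec (Bool.rec (consTerm a.1 (Int.add a.2 b.2) (ih bs)) (b :: ihb) (Nat.blt b.1 a.1))
        (a :: ih (b :: bs)) (Nat.blt a.1 b.1)) q) p

/-- The product of a term and a polynomial. -/
def scale (c : ℕ) (z : ℤ) (p : CodedPoly) : CodedPoly :=
  List.rec [] (fun a _ ih => (Nat.add c a.1, Int.mul z a.2) :: ih) p

/-- The product of two polynomials. -/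
def mul (p q : CodedPoly) : CodedPoly :=
  List.rec [] (fun a _ ih => add (scale a.1 a.2 q) ih) p

/-- The quotient of a polynomial by an integer which divides all its coefficients. -/
def divExact (d : ℤ) (p : CodedPoly) : Option CodedPoly :=
  List.rec (some []) (fun a _ ih => Option.rec none (fun l =>
    Bool.rec none (some ((a.1, a.2 / d) :: l)) (isZeroInt (Int.sub (Int.mul d (a.2 / d)) a.2))) ih) p

/-- All coefficients are zero. -/
def allZero (p : CodedPoly) : Bool :=
  List.rec true (fun a _ ih => Bool.rec false ih (isZeroInt a.2)) p

lemma eval_nil (n : ℕ) (v : ℕ → ℝ) : eval n v [] = 0 := by simp [eval]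

lemma eval_cons (n : ℕ) (v : ℕ → ℝ) (t : ℕ × ℤ) (p : CodedPoly) :
    eval n v (t :: p) = t.2 * mval n v t.1 + eval n v p := by simp [eval]

lemma small_cons {b n : ℕ} {t : ℕ × ℤ} {p : CodedPoly} :
    small b n (t :: p) = true ↔ smallCode b n t.1 = true ∧ small b n p = true := by
  simp [small]

lemma eq_zero_of_isZeroInt {z : ℤ} (h : isZeroInt z = true) : z = 0 := by
  cases z with
  | ofNat n =>
    have h : Nat.beq n 0 = true := h
    simp [Nat.eq_of_beq_eq_true h]
  | negSucc n => exact absurd h Bool.false_ne_true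

lemma eval_consTerm (n : ℕ) (v : ℕ → ℝ) (c : ℕ) (z : ℤ) (p : CodedPoly) :
    eval n v (consTerm c z p) = z * mval n v c + eval n v p := by
  rw [consTerm]
  cases h : isZeroInt z with
  | false => exact eval_cons n v _ _
  | true => simp [eq_zero_of_isZeroInt h]

lemma small_consTerm {b n c : ℕ} {z : ℤ} {p : CodedPoly} (hc : smallCode b n c = true)
    (hp : small b n p = true) : small b n (consTerm c z p) = true := by
  rw [consTerm]
  cases isZeroInt z with
  | false => exact small_cons.2 ⟨hc, hp⟩
  | true => exact hp

lemma add_nil_left (q : CodedPoly) : add [] q = q := rfl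

lemma add_nil_right (a : ℕ × ℤ) (p : CodedPoly) : add (a :: p) [] = a :: p := rfl

lemma add_cons_cons (a b : ℕ × ℤ) (p q : CodedPoly) :
    add (a :: p) (b :: q) = Bool.rec
      (Bool.rec (consTerm a.1 (a.2 + b.2) (add p q)) (b :: add (a :: p) q) (Nat.blt b.1 a.1))
      (a :: add p (b :: q)) (Nat.blt a.1 b.1) := rfl

lemma eval_add (n : ℕ) (v : ℕ → ℝ) (p q : CodedPoly) :
    eval n v (add p q) = eval n v p + eval n v q := by
  induction p generalizing q with
  | nil => simp [add_nil_left, eval_nil]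
  | cons a p ihp =>
    induction q with
    | nil => simp [add_nil_right, eval_nil]
    | cons b q ihq =>
      rw [add_cons_cons]
      cases h1 : Nat.blt a.1 b.1 with
      | true =>
        simp only [eval_cons, ihp]
        ring
      | false =>
        cases h2 : Nat.blt b.1 a.1 with
        | true =>
          simp only [eval_cons, ihq]
          ring
        | false =>
          have h : a.1 = b.1 := by
            simp only [Nat.blt_eq, Bool.eq_false_iff, ne_eq, not_lt] at h1 h2
            omega
          simp only [eval_cons, eval_consTerm, ihp, h]
          push_cast
          ring

lemma small_add {b n : ℕ} {p q : CodedPoly} (hp : small b n p = true) (hq : small b n q = true) :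
    small b n (add p q) = true := by
  induction p generalizing q with
  | nil => exact hq
  | cons a p ihp =>
    induction q with
    | nil => exact hp
    | cons b q ihq =>
      have hp' := small_cons.1 hp
      have hq' := small_cons.1 hq
      rw [add_cons_cons]
      cases Nat.blt a.1 b.1 with
      | true => exact small_cons.2 ⟨hp'.1, ihp hp'.2 hq⟩
      | false =>
        cases Nat.blt b.1 a.1 with
        | true => exact small_cons.2 ⟨hq'.1, ihq hq'.2⟩
        | false => exact small_consTerm hp'.1 (ihp hp'.2 hq'.2)

lemma mval_add {a b : ℕ} (hab : a + b ≤ 64) (n : ℕ) (v : ℕ → ℝ) {c d : ℕ}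
    (hc : smallCode a n c = true) (hd : smallCode b n d = true) :
    mval n v (c + d) = mval n v c * mval n v d := by
  induction n generalizing v c d with
  | zero => simp [mval]
  | succ n ih =>
    simp only [smallCode, Bool.and_eq_true, Nat.blt_eq] at hc hd
    have h1 : (c + d) % 64 = c % 64 + d % 64 := by omega
    have h2 : (c + d) / 64 = c / 64 + d / 64 := by omega
    rw [mval, mval, mval, h1, h2, ih _ hc.2 hd.2, pow_add]
    ring

lemma smallCode_add {a b : ℕ} (hab : a + b ≤ 64) {n c d : ℕ}
    (hc : smallCode a n c = true) (hd : smallCode b n d = true) :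
    smallCode (a + b) n (c + d) = true := by
  induction n generalizing c d with
  | zero => rfl
  | succ n ih =>
    simp only [smallCode, Bool.and_eq_true, Nat.blt_eq] at hc hd ⊢
    have h2 : (c + d) / 64 = c / 64 + d / 64 := by omega
    rw [h2]
    exact ⟨by omega, ih hc.2 hd.2⟩

lemma scale_cons (c : ℕ) (z : ℤ) (a : ℕ × ℤ) (p : CodedPoly) :
    scale c z (a :: p) = (c + a.1, z * a.2) :: scale c z p := rfl

lemma eval_scale {a b : ℕ} (hab : a + b ≤ 64) (n : ℕ) (v : ℕ → ℝ) {c : ℕ} (z : ℤ) {p : CodedPoly}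
    (hc : smallCode a n c = true) (hp : small b n p = true) :
    eval n v (scale c z p) = z * mval n v c * eval n v p := by
  induction p with
  | nil => simp [scale, eval]
  | cons t p ih =>
    have hp' := small_cons.1 hp
    rw [scale_cons, eval_cons, eval_cons, ih hp'.2, mval_add hab n v hc hp'.1]
    push_cast
    ring

lemma small_scale {a b : ℕ} (hab : a + b ≤ 64) {n c : ℕ} {z : ℤ} {p : CodedPoly}
    (hc : smallCode a n c = true) (hp : small b n p = true) :
    small (a + b) n (scale c z p) = true := by
  induction p with
  | nil => rfl
  | cons t p ih =>
    have hp' := small_cons.1 hp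
    rw [scale_cons, small_cons]
    exact ⟨smallCode_add hab hc hp'.1, ih hp'.2⟩

lemma mul_cons (a : ℕ × ℤ) (p q : CodedPoly) :
    mul (a :: p) q = add (scale a.1 a.2 q) (mul p q) := rfl

lemma eval_mul {a b : ℕ} (hab : a + b ≤ 64) (n : ℕ) (v : ℕ → ℝ) {p q : CodedPoly}
    (hp : small a n p = true) (hq : small b n q = true) :
    eval n v (mul p q) = eval n v p * eval n v q := by
  induction p with
  | nil => simp [mul, eval]
  | cons t p ih =>
    have hp' := small_cons.1 hp
    rw [mul_cons, eval_add, eval_scale hab n v _ hp'.1 hq, ih hp'.2, eval_cons]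
    ring

lemma small_mul {a b : ℕ} (hab : a + b ≤ 64) {n : ℕ} {p q : CodedPoly}
    (hp : small a n p = true) (hq : small b n q = true) : small (a + b) n (mul p q) = true := by
  induction p with
  | nil => rfl
  | cons t p ih =>
    have hp' := small_cons.1 hp
    rw [mul_cons]
    exact small_add (small_scale hab hp'.1 hq) (ih hp'.2)

lemma eval_divExact {d : ℤ} {p q : CodedPoly} (h : divExact d p = some q) (n : ℕ) (v : ℕ → ℝ) :
    d * eval n v q = eval n v p := by
  induction p generalizing q with
  | nil =>
    obtain rfl : [] = q := Option.some.inj h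
    simp [eval]
  | cons t p ih =>
    have h' : Option.rec none (fun l => Bool.rec none (some ((t.1, t.2 / d) :: l))
      (isZeroInt (d * (t.2 / d) - t.2))) (divExact d p) = some q := h
    cases hp : divExact d p with
    | none => simp [hp] at h'
    | some l =>
      rw [hp] at h'
      cases hz : isZeroInt (d * (t.2 / d) - t.2) with
      | false => simp [hz] at h'
      | true =>
        simp only [hz, Option.some.injEq] at h'
        have hz' : d * (t.2 / d) = t.2 := by
          have := eq_zero_of_isZeroInt hz
          omega
        have hz' : (d : ℝ) * ((t.2 / d : ℤ) : ℝ) = t.2 := by exact_mod_cast hz'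
        rw [← h', eval_cons, eval_cons, mul_add, ih hp, ← mul_assoc, hz']

lemma eval_of_allZero {p : CodedPoly} (h : allZero p = true) (n : ℕ) (v : ℕ → ℝ) :
    eval n v p = 0 := by
  induction p with
  | nil => exact eval_nil n v
  | cons t p ih =>
    have h' : Bool.rec false (allZero p) (isZeroInt t.2) = true := h
    cases hz : isZeroInt t.2 with
    | false => simp [hz] at h'
    | true =>
      simp only [hz] at h'
      rw [eval_cons, ih h', eq_zero_of_isZeroInt hz]
      simp

lemma mval_zero (n : ℕ) (v : ℕ → ℝ) : mval n v 0 = 1 := by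
  induction n generalizing v with
  | zero => rfl
  | succ n ih => simp [mval, ih]

lemma smallCode_zero {b : ℕ} (hb : 0 < b) (n : ℕ) : smallCode b n 0 = true := by
  induction n with
  | zero => rfl
  | succ n ih => simp [smallCode, ih, hb]

lemma mval_pow {n k : ℕ} (hk : k < n) (v : ℕ → ℝ) : mval n v (64 ^ k) = v k := by
  induction k generalizing n v with
  | zero =>
    obtain ⟨n, rfl⟩ : ∃ l, n = l + 1 := ⟨n - 1, by omega⟩
    simp [mval, mval_zero]
  | succ k ih =>
    obtain ⟨n, rfl⟩ : ∃ l, n = l + 1 := ⟨n - 1, by omega⟩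
    have h1 : 64 ^ (k + 1) % 64 = 0 := by rw [pow_succ]; omega
    have h2 : 64 ^ (k + 1) / 64 = 64 ^ k := by rw [pow_succ]; omega
    rw [mval, h1, h2, ih (by omega)]
    simp

lemma smallCode_pow {b : ℕ} (hb : 1 < b) (n k : ℕ) : smallCode b n (64 ^ k) = true := by
  induction k generalizing n with
  | zero =>
    cases n with
    | zero => rfl
    | succ n => simp [smallCode, smallCode_zero (by omega : 0 < b), hb]
  | succ k ih =>
    cases n with
    | zero => rfl
    | succ n =>
      have h1 : 64 ^ (k + 1) % 64 = 0 := by rw [pow_succ]; omega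
      have h2 : 64 ^ (k + 1) / 64 = 64 ^ k := by rw [pow_succ]; omega
      simp only [smallCode, h1, h2, ih, Bool.and_true, Nat.blt_eq]
      omega

end CodedPoly

open CodedPoly

/-! ### The recursion for symbolic systems -/

/-- A family of systems whose terms of degree `3` and `5` have coefficients which are polynomials
in the first `params` variables, divided by `den`. The next variables stand for `1 / (s + 1)` and
for the prescribed coefficients of `y^4, y^6, …`; there are `vars` variables in all. The
coefficients of the formal series are computed after multiplication by `mult`. -/
structure SymbolicSystem where
  params : ℕ
  vars : ℕ
  den : ℤ
  mult : ℤ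
  termsX : List (ℕ × ℕ × CodedPoly)
  termsY : List (ℕ × ℕ × CodedPoly)

namespace SymbolicSystem

/-- Look up an entry in the row of the coefficients whose total degree is lower by `d - 1`. -/
def lookup (r₁ r₂ : List CodedPoly) (d q : ℕ) : Option CodedPoly :=
  bif Nat.beq d 3 then r₁[q]? else bif Nat.beq d 5 then r₂[q]? else none

/-- The polynomial `σ k - n`. -/
def factor (S : SymbolicSystem) (k n : ℕ) : CodedPoly :=
  consTerm 0 (-n) (consTerm (64 ^ S.params) k [])

def termX (S : SymbolicSystem) (r₁ r₂ : List CodedPoly) (p q : ℕ)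
    (t : ℕ × ℕ × CodedPoly) : Option CodedPoly :=
  bif Nat.ble t.1 (p + 1) && Nat.ble t.2.1 q then
    (lookup r₁ r₂ (t.1 + t.2.1) (q - t.2.1)).map
      fun c => t.2.2.mul ((S.factor t.1 (p + 1 - t.1)).mul c)
  else some []

def termY (S : SymbolicSystem) (r₁ r₂ : List CodedPoly) (p q : ℕ)
    (t : ℕ × ℕ × CodedPoly) : Option CodedPoly :=
  bif Nat.ble t.1 p && Nat.ble t.2.1 (q + 1) then
    (lookup r₁ r₂ (t.1 + t.2.1) (q + 1 - t.2.1)).map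
      fun c => t.2.2.mul ((S.factor t.2.1 (q + 1 - t.2.1)).mul c)
  else some []

def sumOption {α : Type} (f : α → Option CodedPoly) : List α → Option CodedPoly
  | [] => some []
  | t :: l => (f t).bind fun a => (sumOption f l).bind fun b => some (a.add b)

/-- The symbolic version of `QuasiLyapunov.transport`, multiplied by `den * mult`. -/
def transport (S : SymbolicSystem) (r₁ r₂ : List CodedPoly) (p q : ℕ) : Option CodedPoly :=
  (sumOption (S.termX r₁ r₂ p q) S.termsX).bind fun a =>
    (sumOption (S.termY r₁ r₂ p q) S.termsY).bind fun b => some (a.add b)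

/-- The coefficient of `x^(n - j) y^j` for even `n ≥ 4`. -/
def entry (S : SymbolicSystem) (r₁ r₂ : List CodedPoly) (n j : ℕ) : Option CodedPoly :=
  bif Nat.blt j n then
    (S.transport r₁ r₂ (n - j - 1) (j + 1)).bind fun a =>
      (divExact (S.den * (n - j : ℕ)) a).bind fun a' => bif small 16 S.vars a' then some a' else none
  else bif Nat.blt (S.params + (n / 2 - 1)) S.vars then
    some [(64 ^ (S.params + (n / 2 - 1)), S.mult)]
  else none

/-- The `len` coefficients of `x^(n - j) y^j, x^(n - j - 1) y^(j + 1), …`. -/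
def row (S : SymbolicSystem) (r₁ r₂ : List CodedPoly) (n : ℕ) :
    ℕ → ℕ → Option (List CodedPoly)
  | 0, _ => some []
  | len + 1, j => (S.entry r₁ r₂ n j).bind fun a =>
    (S.row r₁ r₂ n len (j + 1)).bind fun l => some (a :: l)

/-- The rows of the coefficients of total degree `2 h + 2` and `2 h`, up to the weight `m - 1`,
where `x` has weight `1` and `y` has weight `2`. -/
def rows (S : SymbolicSystem) (m : ℕ) : ℕ → Option (List CodedPoly × List CodedPoly)
  | 0 => some ([[], [], [(0, S.mult)]], [[]])
  | h + 1 => (S.rows m h).bind fun r =>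
      (S.row r.1 r.2 (2 * h + 4) (min (2 * h + 5) (m - (2 * h + 4))) 0).bind fun r₁ =>
        some (r₁, r.1)

/-- The polynomial `r` is `den * mult` times the coefficient of `x^(2 h + 4)`. -/
def checkOmega (S : SymbolicSystem) (m : ℕ) (h : ℕ) (r : CodedPoly) : Bool :=
  Option.rec false (fun a => (a.add (r.scale 0 (-1))).allZero)
    ((S.rows m h).bind fun r => S.transport r.1 r.2 (2 * h + 4) 0)

/-- The coefficients of the system and the polynomials `r` of the list have small exponents, and
the latter pass `checkOmega`. -/
def check (S : SymbolicSystem) (m : ℕ) (l : List (ℕ × CodedPoly)) : Bool :=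
  Nat.blt S.params S.vars && (S.termsX.all fun t => small 32 S.vars t.2.2) &&
    (S.termsY.all fun t => small 32 S.vars t.2.2) &&
    l.all fun hr => small 32 S.vars hr.2 && S.checkOmega m hr.1 hr.2

/-- The values of the variables. -/
def assignment (S : SymbolicSystem) (a : List ℝ) (σ : ℝ) (γ : ℕ → ℝ) (k : ℕ) : ℝ :=
  if k < S.params then a.getD k 0 else if k = S.params then σ else γ (2 * (k - S.params) + 2)

/-- The terms of the system for given values of the variables. -/
def realTerms (S : SymbolicSystem) (v : ℕ → ℝ) (T : List (ℕ × ℕ × CodedPoly)) :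
    List (ℕ × ℕ × ℝ) :=
  T.map fun t => (t.1, t.2.1, eval S.vars v t.2.2 / S.den)

/-- The list holds coefficients of total degree `n`. -/
def RowValid (S : SymbolicSystem) (v : ℕ → ℝ) (c : ℕ → ℕ → ℝ) (n : ℕ) (r : List CodedPoly) :
    Prop :=
  ∀ q P, r[q]? = some P → q ≤ n →
    small 16 S.vars P = true ∧ eval S.vars v P = S.mult * c (n - q) q

variable {S : SymbolicSystem} {v : ℕ → ℝ} {c : ℕ → ℕ → ℝ}

lemma eval_factor (hS : S.params < S.vars) (k n : ℕ) :
    eval S.vars v (S.factor k n) = v S.params * k - n := by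
  rw [factor, eval_consTerm, eval_consTerm, mval_zero, mval_pow hS, eval_nil]
  push_cast
  ring

lemma small_factor (k n : ℕ) : small 16 S.vars (S.factor k n) = true :=
  small_consTerm (smallCode_zero (by norm_num) _)
    (small_consTerm (smallCode_pow (by norm_num) _ _) rfl)

lemma lookup_valid {h d q i j : ℕ} {r₁ r₂ : List CodedPoly} {P : CodedPoly}
    (h₁ : S.RowValid v c (2 * h + 2) r₁) (h₂ : S.RowValid v c (2 * h) r₂)
    (hP : lookup r₁ r₂ d q = some P) (hij : i + j + d = 2 * h + 5) (hq : q = j) :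
    small 16 S.vars P = true ∧ eval S.vars v P = S.mult * c i j := by
  subst hq
  rw [lookup] at hP
  cases hd : Nat.beq d 3 with
  | true =>
    rw [hd] at hP
    obtain rfl := Nat.eq_of_beq_eq_true hd
    have := h₁ q P hP (by omega)
    rwa [show 2 * h + 2 - q = i by omega] at this
  | false =>
    rw [hd] at hP
    cases hd' : Nat.beq d 5 with
    | true =>
      rw [hd'] at hP
      obtain rfl := Nat.eq_of_beq_eq_true hd'
      have := h₂ q P hP (by omega)
      rwa [show 2 * h - q = i by omega] at this
    | false =>
      rw [hd'] at hP
      simp at hP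

lemma termX_valid (hS : S.params < S.vars) (hden : S.den ≠ 0) {h p q : ℕ}
    (hpq : p + q = 2 * h + 4) {r₁ r₂ : List CodedPoly} (h₁ : S.RowValid v c (2 * h + 2) r₁)
    (h₂ : S.RowValid v c (2 * h) r₂) {t : ℕ × ℕ × CodedPoly} (ht : small 32 S.vars t.2.2 = true)
    {P : CodedPoly} (hP : S.termX r₁ r₂ p q t = some P) :
    eval S.vars v P = S.den * S.mult *
      contribX (v S.params) c p q (t.1, t.2.1, eval S.vars v t.2.2 / S.den) := by
  have hd : (S.den : ℝ) ≠ 0 := by exact_mod_cast hden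
  rw [termX] at hP
  rw [contribX]
  cases hb : (Nat.ble t.1 (p + 1) && Nat.ble t.2.1 q) with
  | true =>
    rw [hb] at hP
    simp only [Bool.and_eq_true, Nat.ble_eq] at hb
    rw [if_pos hb]
    simp only [cond_true, Option.map_eq_some_iff] at hP
    obtain ⟨C, hC, rfl⟩ := hP
    obtain ⟨hs, he⟩ := lookup_valid h₁ h₂ hC
      (show (p + 1 - t.1) + (q - t.2.1) + _ = 2 * h + 5 by omega) rfl
    rw [eval_mul (by norm_num) _ _ ht (small_mul (by norm_num) (small_factor _ _) hs),
      eval_mul (by norm_num) _ _ (small_factor _ _) hs, he, eval_factor hS]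
    field_simp
  | false =>
    rw [hb] at hP
    rw [← Bool.not_eq_true, Bool.and_eq_true, Nat.ble_eq, Nat.ble_eq] at hb
    rw [if_neg hb]
    obtain rfl : [] = P := Option.some.inj hP
    simp [eval]

lemma termY_valid (hS : S.params < S.vars) (hden : S.den ≠ 0) {h p q : ℕ}
    (hpq : p + q = 2 * h + 4) {r₁ r₂ : List CodedPoly} (h₁ : S.RowValid v c (2 * h + 2) r₁)
    (h₂ : S.RowValid v c (2 * h) r₂) {t : ℕ × ℕ × CodedPoly} (ht : small 32 S.vars t.2.2 = true)
    {P : CodedPoly} (hP : S.termY r₁ r₂ p q t = some P) :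
    eval S.vars v P = S.den * S.mult *
      contribY (v S.params) c p q (t.1, t.2.1, eval S.vars v t.2.2 / S.den) := by
  have hd : (S.den : ℝ) ≠ 0 := by exact_mod_cast hden
  rw [termY] at hP
  rw [contribY]
  cases hb : (Nat.ble t.1 p && Nat.ble t.2.1 (q + 1)) with
  | true =>
    rw [hb] at hP
    simp only [Bool.and_eq_true, Nat.ble_eq] at hb
    rw [if_pos hb]
    simp only [cond_true, Option.map_eq_some_iff] at hP
    obtain ⟨C, hC, rfl⟩ := hP
    obtain ⟨hs, he⟩ := lookup_valid h₁ h₂ hC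
      (show (p - t.1) + (q + 1 - t.2.1) + _ = 2 * h + 5 by omega) rfl
    rw [eval_mul (by norm_num) _ _ ht (small_mul (by norm_num) (small_factor _ _) hs),
      eval_mul (by norm_num) _ _ (small_factor _ _) hs, he, eval_factor hS]
    field_simp
  | false =>
    rw [hb] at hP
    rw [← Bool.not_eq_true, Bool.and_eq_true, Nat.ble_eq, Nat.ble_eq] at hb
    rw [if_neg hb]
    obtain rfl : [] = P := Option.some.inj hP
    simp [eval]

lemma sumOption_valid {α : Type} {f : α → Option CodedPoly} {g : α → ℝ} {l : List α}
    (h : ∀ t ∈ l, ∀ P, f t = some P → eval S.vars v P = g t) {P : CodedPoly}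
    (hP : sumOption f l = some P) : eval S.vars v P = (l.map g).sum := by
  induction l generalizing P with
  | nil =>
    obtain rfl : [] = P := Option.some.inj hP
    simp [eval]
  | cons t l ih =>
    simp only [sumOption, Option.bind_eq_some_iff, Option.some.injEq] at hP
    obtain ⟨a, ha, b, hb, rfl⟩ := hP
    rw [eval_add, h t (by simp) a ha, ih (fun t ht => h t (by simp [ht])) hb, List.map_cons,
      List.sum_cons]

lemma transport_valid (hS : S.params < S.vars) (hden : S.den ≠ 0)
    (hX : ∀ t ∈ S.termsX, small 32 S.vars t.2.2 = true)
    (hY : ∀ t ∈ S.termsY, small 32 S.vars t.2.2 = true) {h p q : ℕ}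
    (hpq : p + q = 2 * h + 4) {r₁ r₂ : List CodedPoly} (h₁ : S.RowValid v c (2 * h + 2) r₁)
    (h₂ : S.RowValid v c (2 * h) r₂) {P : CodedPoly} (hP : S.transport r₁ r₂ p q = some P) :
    eval S.vars v P = S.den * S.mult * QuasiLyapunov.transport (v S.params)
      (S.realTerms v S.termsX) (S.realTerms v S.termsY) c p q := by
  simp only [transport, Option.bind_eq_some_iff, Option.some.injEq] at hP
  obtain ⟨a, ha, b, hb, rfl⟩ := hP
  rw [eval_add, sumOption_valid
      (fun t ht P hP => termX_valid hS hden hpq h₁ h₂ (hX t ht) hP) ha,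
    sumOption_valid (fun t ht P hP => termY_valid hS hden hpq h₁ h₂ (hY t ht) hP) hb,
    QuasiLyapunov.transport, mul_add, realTerms, realTerms, List.map_map, List.map_map,
    ← List.sum_map_mul_left, ← List.sum_map_mul_left]
  rfl

/-- The coefficient function `c` belongs to the system with the values `v` of the variables. -/
structure Realizes (S : SymbolicSystem) (v : ℕ → ℝ) (c : ℕ → ℕ → ℝ) : Prop where
  low : ∀ i j : ℕ, i + j < 3 → c i j = if i = 0 ∧ j = 2 then 1 else 0
  pure_y : ∀ k, S.params + (k + 1) < S.vars → c 0 (2 * k + 4) = v (S.params + (k + 1))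
  recursion : ∀ p q, (p + 1) * c (p + 1) q = QuasiLyapunov.transport (v S.params)
      (S.realTerms v S.termsX) (S.realTerms v S.termsY) c p (q + 1)

lemma entry_valid (hS : S.params < S.vars) (hden : S.den ≠ 0)
    (hX : ∀ t ∈ S.termsX, small 32 S.vars t.2.2 = true)
    (hY : ∀ t ∈ S.termsY, small 32 S.vars t.2.2 = true) (hc : S.Realizes v c) {h j : ℕ}
    (hj : j ≤ 2 * h + 4) {r₁ r₂ : List CodedPoly} (h₁ : S.RowValid v c (2 * h + 2) r₁)
    (h₂ : S.RowValid v c (2 * h) r₂) {P : CodedPoly} (hP : S.entry r₁ r₂ (2 * h + 4) j = some P) :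
    small 16 S.vars P = true ∧ eval S.vars v P = S.mult * c (2 * h + 4 - j) j := by
  have hd : (S.den : ℝ) ≠ 0 := by exact_mod_cast hden
  rw [entry] at hP
  cases hb : Nat.blt j (2 * h + 4) with
  | true =>
    rw [hb] at hP
    simp only [cond_true, Option.bind_eq_some_iff] at hP
    obtain ⟨a, ha, b, hb', hP⟩ := hP
    cases hs : small 16 S.vars b with
    | false => simp [hs] at hP
    | true =>
      rw [hs] at hP
      obtain rfl : b = P := Option.some.inj hP
      refine ⟨hs, ?_⟩
      simp only [Nat.blt_eq] at hb
      obtain ⟨p, hp⟩ : ∃ p, 2 * h + 4 - j = p + 1 := ⟨2 * h + 4 - j - 1, by omega⟩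
      rw [hp] at hb' ha ⊢
      have e := eval_divExact hb' S.vars v
      rw [Nat.add_sub_cancel] at ha
      rw [transport_valid hS hden hX hY (by omega) h₁ h₂ ha, ← hc.recursion] at e
      have hp' : (p : ℝ) + 1 ≠ 0 := by positivity
      push_cast at e
      have : (S.den : ℝ) * (p + 1) * eval S.vars v b = S.den * (p + 1) * (S.mult * c (p + 1) j) := by
        rw [e]
        ring
      exact mul_left_cancel₀ (mul_ne_zero hd hp') this
  | false =>
    rw [hb, cond_false] at hP
    simp only [← Bool.not_eq_true, Nat.blt_eq] at hb
    obtain rfl : j = 2 * h + 4 := by omega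
    have hh : (2 * h + 4) / 2 - 1 = h + 1 := by omega
    rw [hh] at hP
    cases hv : Nat.blt (S.params + (h + 1)) S.vars with
    | false => simp [hv] at hP
    | true =>
      rw [hv] at hP
      rw [Nat.blt_eq] at hv
      obtain rfl := Option.some.inj hP
      refine ⟨small_cons.2 ⟨smallCode_pow (by norm_num) _ _, rfl⟩, ?_⟩
      rw [eval_cons, eval_nil, mval_pow hv, Nat.sub_self, hc.pure_y h hv, add_zero]

lemma row_valid (hS : S.params < S.vars) (hden : S.den ≠ 0)
    (hX : ∀ t ∈ S.termsX, small 32 S.vars t.2.2 = true)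
    (hY : ∀ t ∈ S.termsY, small 32 S.vars t.2.2 = true) (hc : S.Realizes v c) {h : ℕ}
    {r₁ r₂ : List CodedPoly} (h₁ : S.RowValid v c (2 * h + 2) r₁) (h₂ : S.RowValid v c (2 * h) r₂)
    (len j : ℕ) {r : List CodedPoly} (hr : S.row r₁ r₂ (2 * h + 4) len j = some r) (q : ℕ)
    (P : CodedPoly) (hP : r[q]? = some P) (hq : j + q ≤ 2 * h + 4) :
    small 16 S.vars P = true ∧ eval S.vars v P = S.mult * c (2 * h + 4 - (j + q)) (j + q) := by
  induction len generalizing j r q with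
  | zero =>
    obtain rfl : [] = r := Option.some.inj hr
    simp at hP
  | succ len ih =>
    simp only [row, Option.bind_eq_some_iff, Option.some.injEq] at hr
    obtain ⟨a, ha, l, hl, rfl⟩ := hr
    cases q with
    | zero =>
      obtain rfl : a = P := by simpa using hP
      exact entry_valid hS hden hX hY hc hq h₁ h₂ ha
    | succ q =>
      have := ih (j + 1) hl q (by simpa using hP) (by omega)
      rwa [show j + 1 + q = j + (q + 1) by ring] at this

lemma rows_valid (hS : S.params < S.vars) (hden : S.den ≠ 0)
    (hX : ∀ t ∈ S.termsX, small 32 S.vars t.2.2 = true)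
    (hY : ∀ t ∈ S.termsY, small 32 S.vars t.2.2 = true) (hc : S.Realizes v c) (m h : ℕ)
    {r : List CodedPoly × List CodedPoly} (hr : S.rows m h = some r) :
    S.RowValid v c (2 * h + 2) r.1 ∧ S.RowValid v c (2 * h) r.2 := by
  induction h generalizing r with
  | zero =>
    obtain rfl := Option.some.inj hr
    constructor
    · intro q P hP hq
      rw [hc.low _ _ (by omega)]
      interval_cases q
      · obtain rfl : [] = P := by simpa using hP
        simp [eval, small]
      · obtain rfl : [] = P := by simpa using hP
        simp [eval, small]
      · obtain rfl : [(0, S.mult)] = P := by simpa using hP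
        simp [eval_cons, eval_nil, small, mval_zero, smallCode_zero]
    · intro q P hP hq
      rw [hc.low _ _ (by omega)]
      interval_cases q
      obtain rfl : [] = P := by simpa using hP
      simp [eval, small]
  | succ h ih =>
    simp only [rows, Option.bind_eq_some_iff, Option.some.injEq] at hr
    obtain ⟨r', hr', l, hl, rfl⟩ := hr
    obtain ⟨h₁, h₂⟩ := ih hr'
    refine ⟨fun q P hP hq => ?_, h₁⟩
    have := row_valid hS hden hX hY hc h₁ h₂ _ _ hl q P hP (by omega)
    rwa [zero_add] at this

theorem eval_of_check {m : ℕ} {l : List (ℕ × CodedPoly)} (hl : S.check m l = true)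
    (hden : S.den ≠ 0) (hc : S.Realizes v c) {h : ℕ} {r : CodedPoly} (hr : (h, r) ∈ l) :
    S.den * S.mult * QuasiLyapunov.transport (v S.params) (S.realTerms v S.termsX)
      (S.realTerms v S.termsY) c (2 * h + 4) 0 = eval S.vars v r := by
  simp only [check, Bool.and_eq_true, List.all_eq_true, Nat.blt_eq] at hl
  obtain ⟨⟨⟨hS, hX⟩, hY⟩, hl⟩ := hl
  obtain ⟨hs, ho⟩ := hl _ hr
  rw [checkOmega] at ho
  cases ht : (S.rows m h).bind fun r => S.transport r.1 r.2 (2 * h + 4) 0 with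
  | none => simp [ht] at ho
  | some a =>
    simp only [ht] at ho
    rw [Option.bind_eq_some_iff] at ht
    obtain ⟨rr, hrr, ht⟩ := ht
    obtain ⟨h₁, h₂⟩ := rows_valid hS hden hX hY hc m h hrr
    have e := eval_of_allZero ho S.vars v
    rw [eval_add, eval_scale (a := 32) (by norm_num) _ _ _ (smallCode_zero (by norm_num) _) hs,
      mval_zero, transport_valid hS hden hX hY (by omega) h₁ h₂ ht] at e
    push_cast at e
    linarith

end SymbolicSystem

end

end QuasiLyapunov


namespace QuasiLyapunov

open CodedPoly

noncomputable section

namespace SymbolicSystem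

/-- The constants of a formal series, from symbolic values which have been checked. -/
theorem lam_of_check {S : SymbolicSystem} {m : ℕ} {l : List (ℕ × CodedPoly)}
    (hl : S.check m l = true) (hden : S.den ≠ 0) {s : ℕ} {γ : ℕ → ℝ} {a : List ℝ}
    {X Y : MvPolynomial (Fin 2) ℝ} {M : MvPowerSeries (Fin 2) ℝ} {v : ℕ → ℝ}
    (hv : v = S.assignment a (1 / (s + 1)) γ)
    (hX : X = mono 1 0 1 + ofTerms (S.realTerms v S.termsX))
    (hY : Y = ofTerms (S.realTerms v S.termsY)) (hM : IsFormalSeries X Y s γ M) :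
    ∀ hr ∈ l, S.den * S.mult * ((2 * hr.1 - 4 * s - 1) * lam X Y s M hr.1) =
      (s + 1) * eval S.vars v hr.2 := by
  rintro ⟨h, r⟩ hr
  have hσ : v S.params = 1 / ((s : ℝ) + 1) := by simp [hv, assignment]
  have hc : S.Realizes v (cf M) := by
    refine ⟨hM.coeff_low, fun k hk => ?_, fun p q => ?_⟩
    · rw [hM.coeff_y _ (by omega), hv, assignment, if_neg (by omega), if_neg (by omega),
        Nat.add_sub_cancel_left]
      rfl
    · rw [hσ]
      exact hM.recursion hX hY p q
  have hd : 2 * (h : ℝ) - 4 * s - 1 ≠ 0 := by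
    have : (2 * (h : ℤ) - 4 * s - 1) ≠ 0 := by omega
    exact_mod_cast this
  rw [← eval_of_check hl hden hc hr, lam, mul_div_cancel₀ _ hd, omega_eq_transport hX hY, hσ]
  ring

end SymbolicSystem

/-- The terms of degree `3` and `5` of the first system. -/
def termsAX (a30 a21 a12 a03 a50 a41 a32 a23 a14 a05 : ℝ) : List (ℕ × ℕ × ℝ) :=
  [(3, 0, a30), (2, 1, a21), (1, 2, a12), (0, 3, a03), (5, 0, a50), (4, 1, a41), (3, 2, a32),
    (2, 3, a23), (1, 4, a14), (0, 5, a05)]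

/-- The terms of the second component of the second system. -/
def termsBY (a21 a12 a03 a50 a41 a32 a23 a14 a05 : ℝ) : List (ℕ × ℕ × ℝ) :=
  (3, 0, -2) :: termsAX 0 a21 a12 a03 a50 a41 a32 a23 a14 a05

lemma systemAX_eq (a30 a21 a12 a03 a50 a41 a32 a23 a14 a05 : ℝ) :
    systemAX a30 a21 a12 a03 a50 a41 a32 a23 a14 a05 =
      mono 1 0 1 + ofTerms (termsAX a30 a21 a12 a03 a50 a41 a32 a23 a14 a05) := by
  simp [systemAX, H35, ofTerms, termsAX, add_assoc]

lemma systemAY_eq : systemAY = ofTerms [(3, 0, -2)] := by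
  simp [systemAY, ofTerms]

lemma systemBX_eq : systemBX = mono 1 0 1 + ofTerms [] := by
  simp [systemBX, ofTerms]

lemma systemBY_eq (a21 a12 a03 a50 a41 a32 a23 a14 a05 : ℝ) :
    systemBY a21 a12 a03 a50 a41 a32 a23 a14 a05 =
      ofTerms (termsBY a21 a12 a03 a50 a41 a32 a23 a14 a05) := by
  simp [systemBY, H35, ofTerms, termsAX, termsBY, add_assoc]

lemma three_le_of_mem_termsAX {a30 a21 a12 a03 a50 a41 a32 a23 a14 a05 : ℝ} :
    ∀ t ∈ termsAX a30 a21 a12 a03 a50 a41 a32 a23 a14 a05, 3 ≤ t.1 + t.2.1 := by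
  simp [termsAX]

lemma three_le_of_mem_termsBY {a21 a12 a03 a50 a41 a32 a23 a14 a05 : ℝ} :
    ∀ t ∈ termsBY a21 a12 a03 a50 a41 a32 a23 a14 a05, 3 ≤ t.1 + t.2.1 := by
  simp [termsAX, termsBY]

theorem existsUnique_A (s : ℕ) (γ : ℕ → ℝ) (a30 a21 a12 a03 a50 a41 a32 a23 a14 a05 : ℝ) :
    ∃! M : MvPowerSeries (Fin 2) ℝ, IsFormalSeries
      (systemAX a30 a21 a12 a03 a50 a41 a32 a23 a14 a05) systemAY s γ M :=
  existsUnique_isFormalSeries (systemAX_eq _ _ _ _ _ _ _ _ _ _) systemAY_eq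
    three_le_of_mem_termsAX (by simp) s γ

theorem existsUnique_B (s : ℕ) (γ : ℕ → ℝ) (a21 a12 a03 a50 a41 a32 a23 a14 a05 : ℝ) :
    ∃! M : MvPowerSeries (Fin 2) ℝ, IsFormalSeries systemBX
      (systemBY a21 a12 a03 a50 a41 a32 a23 a14 a05) s γ M :=
  existsUnique_isFormalSeries systemBX_eq (systemBY_eq _ _ _ _ _ _ _ _ _) (by simp)
    three_le_of_mem_termsBY s γ

/-- Without odd powers of `x` in the first component, the first system is reversible. -/
theorem lamA_eq_zero {s : ℕ} {γ : ℕ → ℝ} {a21 a03 a41 a23 a05 : ℝ} {M : MvPowerSeries (Fin 2) ℝ}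
    (hM : IsFormalSeries (systemAX 0 a21 0 a03 0 a41 0 a23 0 a05) systemAY s γ M) (m : ℕ) :
    lam (systemAX 0 a21 0 a03 0 a41 0 a23 0 a05) systemAY s M m = 0 :=
  lam_eq_zero_of_reversible (systemAX_eq _ _ _ _ _ _ _ _ _ _) systemAY_eq
    three_le_of_mem_termsAX (by simp) (by simp [termsAX, Nat.odd_iff])
    (by simp [Nat.even_iff]) hM m

/-- If only odd powers of `x` occur in its second component, the second system is reversible. -/
theorem lamB_eq_zero {s : ℕ} {γ : ℕ → ℝ} {a12 a50 a32 a14 : ℝ} {M : MvPowerSeries (Fin 2) ℝ}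
    (hM : IsFormalSeries systemBX (systemBY 0 a12 0 a50 0 a32 0 a14 0) s γ M) (m : ℕ) :
    lam systemBX (systemBY 0 a12 0 a50 0 a32 0 a14 0) s M m = 0 :=
  lam_eq_zero_of_reversible systemBX_eq (systemBY_eq _ _ _ _ _ _ _ _ _) (by simp)
    three_le_of_mem_termsBY (by simp) (by simp [termsBY, termsAX, Nat.even_iff]) hM m

end

end QuasiLyapunov


namespace QuasiLyapunov

open CodedPoly

noncomputable section

lemma two_mul_sub_ne_zero (h s : ℕ) : 2 * (h : ℝ) - 4 * s - 1 ≠ 0 := by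
  have : 2 * (h : ℤ) - 4 * s - 1 ≠ 0 := by omega
  exact_mod_cast this

/-- The first system. -/
def systemAGeneral : SymbolicSystem where
  params := 10
  vars := 11
  den := 1
  mult := 1
  termsX := [(3, 0, [(1, 1)]), (2, 1, [(64, 1)]), (1, 2, [(4096, 1)]), (0, 3, [(262144, 1)]), (5, 0,
    [(16777216, 1)]), (4, 1, [(1073741824, 1)]), (3, 2, [(68719476736, 1)]), (2, 3, [(4398046511104,
    1)]), (1, 4, [(281474976710656, 1)]), (0, 5, [(18014398509481984, 1)])]
  termsY := [(3, 0, [(0, -2)])]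

/-- The constants of `systemAGeneral`, as computed by the recursion. -/
def systemAGeneralValues : List (ℕ × CodedPoly) :=
  [(1, [(1, -4), (1152921504606846977, 5)])]

lemma check_systemAGeneral : systemAGeneral.check 6 systemAGeneralValues = true := by
  decide +kernel

/-- The first constant of the first system. -/
lemma lam_systemAGeneral {s : ℕ} {c : ℕ → ℝ} {a30 a21 a12 a03 a50 a41 a32 a23 a14 a05 : ℝ}
    {X Y : MvPolynomial (Fin 2) ℝ} {M : MvPowerSeries (Fin 2) ℝ}
    (hX : X = systemAX a30 a21 a12 a03 a50 a41 a32 a23 a14 a05) (hY : Y = systemAY)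
    (hM : IsFormalSeries X Y s c M) :
    lam X Y s M 1 = a30 := by
  obtain ⟨σ, hσ⟩ : ∃ σ : ℝ, σ = 1 / (s + 1) := ⟨_, rfl⟩
  have hs : (s : ℝ) + 1 ≠ 0 := by positivity
  have hS : (s + 1) * σ = 1 := by rw [hσ, mul_one_div_cancel hs]
  set v := systemAGeneral.assignment [a30, a21, a12, a03, a50, a41, a32, a23, a14, a05] σ c with hv
  have v0 : v 0 = a30 := rfl
  have v1 : v 1 = a21 := rfl
  have v2 : v 2 = a12 := rfl
  have v3 : v 3 = a03 := rfl
  have v4 : v 4 = a50 := rfl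
  have v5 : v 5 = a41 := rfl
  have v6 : v 6 = a32 := rfl
  have v7 : v 7 = a23 := rfl
  have v8 : v 8 = a14 := rfl
  have v9 : v 9 = a05 := rfl
  have v10 : v 10 = σ := rfl
  have key := SymbolicSystem.lam_of_check check_systemAGeneral (by decide)
    (a := [a30, a21, a12, a03, a50, a41, a32, a23, a14, a05]) (v := v) (by rw [hv, hσ]) (X := X) (Y
      := Y) ?_ ?_ hM
  · clear_value v
    simp only [systemAGeneralValues, List.forall_mem_cons, systemAGeneral,
      eval_cons, eval_nil, mval, Nat.reduceMod, Nat.reduceDiv,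
      Nat.reduceAdd, pow_zero, pow_one, one_mul, mul_one, zero_add, v0, v1, v2, v3, v4, v5, v6, v7,
        v8, v9, v10] at key
    obtain ⟨k1, -⟩ := key
    have d1 : 2 * ((1 : ℕ) : ℝ) - 4 * s - 1 ≠ 0 := two_mul_sub_ne_zero 1 s
    push_cast at k1 d1
    apply mul_left_cancel₀ d1
    linear_combination (1 / 1) * k1 + 5 * (a30) * hS
  · rw [hX, systemAX_eq]
    clear_value v
    simp only [systemAGeneral, SymbolicSystem.realTerms, termsAX, List.map_cons, List.map_nil,
      eval_cons, eval_nil, mval, Nat.reduceMod, Nat.reduceDiv,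
      Nat.reduceAdd, pow_zero, pow_one, one_mul, mul_one, zero_add, v0, v1, v2, v3, v4, v5, v6, v7,
        v8, v9, v10]
    push_cast
    ring_nf
  · rw [hY, systemAY_eq]
    norm_num [systemAGeneral, SymbolicSystem.realTerms, eval_cons, eval_nil, mval_zero]

/-- The first system with `a30 = 0`. -/
def systemALow : SymbolicSystem where
  params := 9
  vars := 11
  den := 1
  mult := 3150
  termsX := [(3, 0, []), (2, 1, [(1, 1)]), (1, 2, [(64, 1)]), (0, 3, [(4096, 1)]), (5, 0, [(262144,
    1)]),
    (4, 1, [(16777216, 1)]), (3, 2, [(1073741824, 1)]), (2, 3, [(68719476736, 1)]), (1, 4,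
    [(4398046511104, 1)]), (0, 5, [(281474976710656, 1)])]
  termsY := [(3, 0, [(0, -2)])]

/-- The constants of `systemALow`, as computed by the recursion. -/
def systemALowValues : List (ℕ × CodedPoly) :=
  [(2, [(64, -5040), (262144, -12600), (18014398509482048, 8820), (18014398509744128, 22050)]), (3,
  [(65, 7200), (262145, 12600), (1073741824, -3600), (18014398509482049, -19140),
  (18014398509744129, -35700), (18014399583223808, 8100), (36028797018964033, 8820),
  (36028797019226113, 22050)]), (4, [(66, -8400), (4160, 9520), (262146, -12600), (266240, 15400),
  (16777280, 5600), (17039360, 12600), (1073741825, 5600), (4398046511104, -3360),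
  (18014398509482050, 27570), (18014398509486144, -15470), (18014398509744130, 43575),
  (18014398509748224, -15575), (18014398526259264, -17290), (18014398526521344, -39375),
  (18014399583223809, -16900), (18018796555993088, 9240), (36028797018964034, -21030),
  (36028797019226114, -40425), (36028797035741248, 8820), (36028797036003328, 22050),
  (36028798092705793, 8100), (54043195528446018, 4410), (54043195528708098, 11025),
  (1152921504606847040, -12320), (1152921504607109120, -30800), (1170935903116329024, 10780),
  (1170935903116591104, 26950)])]

lemma check_systemALow : systemALow.check 12 systemALowValues = true := by
  decide +kernel

/-- The second, third and fourth constant of the first system. -/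
lemma lam_systemALow {s : ℕ} {c : ℕ → ℝ} {a21 a12 a03 a50 a41 a32 a23 a14 a05 : ℝ}
    {X Y : MvPolynomial (Fin 2) ℝ} {M : MvPowerSeries (Fin 2) ℝ}
    (hX : X = systemAX 0 a21 a12 a03 a50 a41 a32 a23 a14 a05) (hY : Y = systemAY)
    (hM : IsFormalSeries X Y s c M) :
    (lam X Y s M 2 = 1 / 5 * (2 * a12 + 5 * a50)) ∧
    (2 * a12 + 5 * a50 = 0 → lam X Y s M 3 = 1 / 7 * (2 * a32 + 3 * a21 * a50)) ∧
    (2 * a12 + 5 * a50 = 0 → 2 * a32 + 3 * a21 * a50 = 0 →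
      lam X Y s M 4 = 1 / 45 * (12 * a14 + 30 * a03 * a50 + 5 * a41 * a50)) := by
  obtain ⟨σ, hσ⟩ : ∃ σ : ℝ, σ = 1 / (s + 1) := ⟨_, rfl⟩
  have hs : (s : ℝ) + 1 ≠ 0 := by positivity
  have hS : (s + 1) * σ = 1 := by rw [hσ, mul_one_div_cancel hs]
  set v := systemALow.assignment [a21, a12, a03, a50, a41, a32, a23, a14, a05] σ c with hv
  have v0 : v 0 = a21 := rfl
  have v1 : v 1 = a12 := rfl
  have v2 : v 2 = a03 := rfl
  have v3 : v 3 = a50 := rfl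
  have v4 : v 4 = a41 := rfl
  have v5 : v 5 = a32 := rfl
  have v6 : v 6 = a23 := rfl
  have v7 : v 7 = a14 := rfl
  have v8 : v 8 = a05 := rfl
  have v9 : v 9 = σ := rfl
  have v10 : v 10 = c 4 := rfl
  have key := SymbolicSystem.lam_of_check check_systemALow (by decide)
    (a := [a21, a12, a03, a50, a41, a32, a23, a14, a05]) (v := v) (by rw [hv, hσ]) (X := X) (Y := Y)
      ?_ ?_ hM
  · clear_value v
    simp only [systemALowValues, List.forall_mem_cons, systemALow,
      eval_cons, eval_nil, mval, Nat.reduceMod, Nat.reduceDiv,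
      Nat.reduceAdd, pow_zero, pow_one, one_mul, mul_one, zero_add, v0, v1, v2, v3, v4, v5, v6, v7,
        v8, v9, v10] at key
    obtain ⟨k2, k3, k4, -⟩ := key
    have d2 : 2 * ((2 : ℕ) : ℝ) - 4 * s - 1 ≠ 0 := two_mul_sub_ne_zero 2 s
    have d3 : 2 * ((3 : ℕ) : ℝ) - 4 * s - 1 ≠ 0 := two_mul_sub_ne_zero 3 s
    have d4 : 2 * ((4 : ℕ) : ℝ) - 4 * s - 1 ≠ 0 := two_mul_sub_ne_zero 4 s
    push_cast at k2 k3 k4 d2 d3 d4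
    refine ⟨?_, ?_, ?_⟩
    · apply mul_left_cancel₀ d2
      linear_combination (1 / 3150) * k2 + 7 * (2 / 5 * a12 + a50) * hS
    · intro e2
      apply mul_left_cancel₀ d3
      linear_combination (1 / 3150) * k3 + (s + 1) * (7 / 5 * a21 * σ ^ 2 - 319 / 105 * a21 * σ + 8
        / 7 * a21) * e2 + 9 * (3 / 7 * a21 * a50 + 2 / 7 * a32) * hS
    · intro e2 e3
      apply mul_left_cancel₀ d4
      linear_combination (1 / 3150) * k4 + (s + 1) * (7 / 10 * a21 ^ 2 * σ ^ 3 - 701 / 210 * a21 ^ 2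
        * σ ^ 2 + 919 / 210 * a21 ^ 2 * σ - 4 / 3 * a21 ^ 2 - 221 / 90 * a03 * σ + 68 / 45 * a03 + 7
        / 5 * a41 * σ ^ 2 - 247 / 90 * a41 * σ + 8 / 9 * a41 + 77 / 45 * σ * (c 4) - 88 / 45 * (c
        4)) * e2 + (s + 1) * (9 / 7 * a21 * σ ^ 2 - 169 / 63 * a21 * σ + 8 / 9 * a21) * e3 + 11 * (2
        / 3 * a03 * a50 + 1 / 9 * a50 * a41 + 4 / 15 * a14) * hS
  · rw [hX, systemAX_eq]
    clear_value v
    simp only [systemALow, SymbolicSystem.realTerms, termsAX, List.map_cons, List.map_nil,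
      eval_cons, eval_nil, mval, Nat.reduceMod, Nat.reduceDiv,
      Nat.reduceAdd, pow_zero, pow_one, one_mul, mul_one, zero_add, v0, v1, v2, v3, v4, v5, v6, v7,
        v8, v9, v10]
    push_cast
    ring_nf
  · rw [hY, systemAY_eq]
    norm_num [systemALow, SymbolicSystem.realTerms, eval_cons, eval_nil, mval_zero]

/-- The first system when its first four constants vanish. -/
def systemAMiddle : SymbolicSystem where
  params := 6
  vars := 10
  den := 12
  mult := 17297280
  termsX := [(3, 0, []), (2, 1, [(1, 12)]), (1, 2, [(4096, -30)]), (0, 3, [(64, 12)]), (5, 0,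
    [(4096, 12)]),
    (4, 1, [(262144, 12)]), (3, 2, [(4097, -18)]), (2, 3, [(16777216, 12)]), (1, 4, [(4160, -30),
    (266240, -5)]), (0, 5, [(1073741824, 12)])]
  termsY := [(3, 0, [(0, -24)])]

/-- The constants of `systemAMiddle`, as computed by the recursion. -/
def systemAMiddleValues : List (ℕ × CodedPoly) :=
  [(5, [(12288, 323481600), (266241, -32348160), (16781312, -194088960), (68719489024, -1051315200),
  (68719742977, 105131520), (68736258048, 630789120)]), (6, [(12289, -678205440), (266242,
  69949440), (266304, -70963200), (528384, -7096320), (16781313, 419696640), (1073745920,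
  -425779200), (68719489025, 2570227200), (68719742978, -265006080), (68719743040, 266112000),
  (68720005120, 26611200), (68736258049, -1590036480), (69793222656, 1596672000), (137438965761,
  -1051315200), (137439219714, 105131520), (137455734785, 630789120)]), (7, [(12290, 1010460672),
  (12352, -496005120), (266243, -105910272), (266305, 254871552), (274432, -431308800), (528385,
  70127616), (16781314, -635461632), (16781376, 426995712), (17043456, 301916160), (1073745921,
  1102233600), (68719489026, -4251419136), (68719489088, 1178012160), (68719742979, 445637376),
  (68719743041, -984289536), (68719751168, 1711756800), (68720005121, -285320448), (68736258050,
  2673824256), (68736258112, -1256726016), (68736520192, -1210360320), (69793222657, -4649011200),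
  (137438965762, 2934144000), (137439219715, -301397760), (137439219777, 266112000), (137439227904,
  -1051315200), (137439481857, 131742720), (137455734786, -1808386560), (137455996928, 630789120),
  (138512699393, 1596672000), (206158442498, -525657600), (206158696451, 52565760), (206175211522,
  315394560), (4398046523392, 733224960), (4398046777345, -73322496), (4398063292416, -439934976),
  (4466766000128, -1191490560), (4466766254081, 119149056), (4466782769152, 714894336)])]

lemma check_systemAMiddle : systemAMiddle.check 18 systemAMiddleValues = true := by
  decide +kernel

/-- The fifth, sixth and seventh constant of the first system. -/
lemma lam_systemAMiddle {s : ℕ} {c : ℕ → ℝ} {a21 a03 a50 a41 a23 a05 : ℝ}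
    {X Y : MvPolynomial (Fin 2) ℝ} {M : MvPowerSeries (Fin 2) ℝ}
    (hX : X = systemAX 0 a21 (-5 / 2 * a50) a03 a50 a41 (-3 / 2 * a21 * a50) a23 (-5 / 2 * a03 * a50
    - 5 / 12 * a50 * a41) a05) (hY : Y = systemAY)
    (hM : IsFormalSeries X Y s c M) :
    (lam X Y s M 5 = 3 * a50 / 77 * (6 * a23 + a21 * a41 - 10 * a50 ^ 2)) ∧
    (a50 * (6 * a23 + a21 * a41 - 10 * a50 ^ 2) = 0 →
      lam X Y s M 6 = a50 / 117 * (60 * a05 + 10 * a03 * a41 + a41 ^ 2 - 3 * a21 * a50 ^ 2)) ∧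
    (a50 * (6 * a23 + a21 * a41 - 10 * a50 ^ 2) = 0 →
      a50 * (60 * a05 + 10 * a03 * a41 + a41 ^ 2 - 3 * a21 * a50 ^ 2) = 0 →
      lam X Y s M 7 = -(a50 / 1155) * (2 * a21 * a41 ^ 2 + 300 * a03 * a50 ^ 2
        + 9 * a21 ^ 2 * a50 ^ 2 + 100 * a41 * a50 ^ 2)) := by
  obtain ⟨σ, hσ⟩ : ∃ σ : ℝ, σ = 1 / (s + 1) := ⟨_, rfl⟩
  have hs : (s : ℝ) + 1 ≠ 0 := by positivity
  have hS : (s + 1) * σ = 1 := by rw [hσ, mul_one_div_cancel hs]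
  set v := systemAMiddle.assignment [a21, a03, a50, a41, a23, a05] σ c with hv
  have v0 : v 0 = a21 := rfl
  have v1 : v 1 = a03 := rfl
  have v2 : v 2 = a50 := rfl
  have v3 : v 3 = a41 := rfl
  have v4 : v 4 = a23 := rfl
  have v5 : v 5 = a05 := rfl
  have v6 : v 6 = σ := rfl
  have v7 : v 7 = c 4 := rfl
  have v8 : v 8 = c 6 := rfl
  have v9 : v 9 = c 8 := rfl
  have key := SymbolicSystem.lam_of_check check_systemAMiddle (by decide)
    (a := [a21, a03, a50, a41, a23, a05]) (v := v) (by rw [hv, hσ]) (X := X) (Y := Y) ?_ ?_ hM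
  · clear_value v
    simp only [systemAMiddleValues, List.forall_mem_cons, systemAMiddle,
      eval_cons, eval_nil, mval, Nat.reduceMod, Nat.reduceDiv,
      Nat.reduceAdd, pow_zero, pow_one, one_mul, mul_one, zero_add, v0, v1, v2, v3, v4, v5, v6, v7,
        v8, v9] at key
    obtain ⟨k5, k6, k7, -⟩ := key
    have d5 : 2 * ((5 : ℕ) : ℝ) - 4 * s - 1 ≠ 0 := two_mul_sub_ne_zero 5 s
    have d6 : 2 * ((6 : ℕ) : ℝ) - 4 * s - 1 ≠ 0 := two_mul_sub_ne_zero 6 s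
    have d7 : 2 * ((7 : ℕ) : ℝ) - 4 * s - 1 ≠ 0 := two_mul_sub_ne_zero 7 s
    push_cast at k5 k6 k7 d5 d6 d7
    refine ⟨?_, ?_, ?_⟩
    · apply mul_left_cancel₀ d5
      linear_combination (1 / 207567360) * k5 + 13 * (3 / 77 * a21 * a50 * a41 - 30 / 77 * a50 ^ 3 +
        18 / 77 * a50 * a23) * hS
    · intro e5
      apply mul_left_cancel₀ d6
      linear_combination (1 / 207567360) * k6 + (s + 1) * (39 / 77 * a21 * σ ^ 2 - 1278 / 1001 * a21
        * σ + 92 / 273 * a21) * e5 + 15 * (-1 / 39 * a21 * a50 ^ 3 + 10 / 117 * a03 * a50 * a41 + 1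
        / 117 * a50 * a41 ^ 2 + 20 / 39 * a50 * a05) * hS
    · intro e5 e6
      apply mul_left_cancel₀ d7
      linear_combination (1 / 207567360) * k7 + (s + 1) * (39 / 154 * a21 ^ 2 * σ ^ 3 - 2907 / 2002
        * a21 ^ 2 * σ ^ 2 + 21491 / 10010 * a21 ^ 2 * σ - 1768 / 3465 * a21 ^ 2 - 111 / 110 * a03 *
        σ + 12 / 35 * a03 + 39 / 77 * a41 * σ ^ 2 - 449 / 462 * a41 * σ + 8 / 33 * a41 + 221 / 385 *
        σ * (c 4) - 136 / 385 * (c 4)) * e5 + (s + 1) * (5 / 39 * a21 * σ ^ 2 - 1121 / 3003 * a21 *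
        σ + 184 / 2079 * a21) * e6 + 17 * (-3 / 385 * a21 ^ 2 * a50 ^ 3 - 2 / 1155 * a21 * a50 * a41
        ^ 2 - 20 / 77 * a03 * a50 ^ 3 - 20 / 231 * a50 ^ 3 * a41) * hS
  · rw [hX, systemAX_eq]
    clear_value v
    simp only [systemAMiddle, SymbolicSystem.realTerms, termsAX, List.map_cons, List.map_nil,
      eval_cons, eval_nil, mval, Nat.reduceMod, Nat.reduceDiv,
      Nat.reduceAdd, pow_zero, pow_one, one_mul, mul_one, zero_add, v0, v1, v2, v3, v4, v5, v6, v7,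
        v8, v9]
    push_cast
    ring_nf
  · rw [hY, systemAY_eq]
    norm_num [systemAMiddle, SymbolicSystem.realTerms, eval_cons, eval_nil, mval_zero]

/-- The first system with `a50 ≠ 0` when its first seven constants vanish; here `a41 = r a50`. -/
def systemAHigh : SymbolicSystem where
  params := 3
  vars := 8
  den := 1800
  mult := 5656859208000000000
  termsX := [(3, 0, []), (2, 1, [(1, 1800)]), (1, 2, [(4096, -4500)]), (0, 3, [(2, -54), (129, -12),
    (4160,
    -600)]), (5, 0, [(4096, 1800)]), (4, 1, [(4160, 1800)]), (3, 2, [(4097, -2700)]), (2, 3, [(4161,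
    -300), (8192, 3000)]), (1, 4, [(4098, 135), (4225, 30), (8256, 750)]), (0, 5, [(4162, 9), (4289,
    2), (8193, 90), (8320, 70)])]
  termsY := [(3, 0, [(0, -3600)])]

/-- The constants of `systemAHigh`, as computed by the recursion. -/
def systemAHighValues : List (ℕ × CodedPoly) :=
  [(8, [(12291, -25801421184000000000), (12418, -11467298304000000000), (12545,
  -1274144256000000000), (16449, -163818547200000000000), (16576, -36404121600000000000), (20480,
  -204773184000000000000), (274435, 122556750624000000000), (274562, 54469666944000000000), (274689,
  6052185216000000000), (278593, 778138099200000000000), (278720, 172919577600000000000), (282624,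
  972672624000000000000)]), (9, [(12292, 82847899008000000000), (12419, 36821288448000000000),
  (12546, 4091254272000000000), (16450, 481474990080000000000), (16577, 106994442240000000000),
  (20481, 212088844800000000000), (20608, -86612198400000000000), (274436, -424200877632000000000),
  (274563, -188533723392000000000), (274690, -20948191488000000000), (278594,
  -2459485969920000000000), (278721, -546552437760000000000), (282625, -1028144275200000000000),
  (282752, 454714041600000000000), (536580, 122556750624000000000), (536707, 54469666944000000000),
  (536834, 6052185216000000000), (540738, 778138099200000000000), (540865, 172919577600000000000),
  (544769, 972672624000000000000)]), (10, [(12293, -170568243659520000000), (12420,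
  -76389664135680000000), (12547, -8681592407040000000), (12674, -28718807040000000), (16451,
  -902251332864000000000), (16578, -197978010624000000000), (16705, 560507904000000000), (20482,
  179104141440000000000), (20609, 470139137280000000000), (20736, 39235553280000000000), (24640,
  227525760000000000000), (274437, 924258259320480000000), (274564, 413501860336320000000), (274691,
  46851455064960000000), (274818, 134341320960000000), (278595, 4852990503648000000000), (278722,
  1059502439808000000000), (278849, -4208865408000000000), (282626, -1218497469840000000000),
  (282753, -2671376487840000000000), (282880, -228638108160000000000), (286784,
  -1325337552000000000000), (536581, -472578542352000000000), (536708, -210034907712000000000),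
  (536835, -23337211968000000000), (540739, -2644088995296000000000), (540866,
  -560340498816000000000), (540993, 6052185216000000000), (544770, -1412093995200000000000),
  (544897, 1232852140800000000000), (545024, 172919577600000000000), (548928,
  972672624000000000000), (798725, 61278375312000000000), (798852, 27234833472000000000), (798979,
  3026092608000000000), (802883, 389069049600000000000), (803010, 86459788800000000000), (806914,
  486336312000000000000), (16789507, -56517398784000000000), (16789634, -25118843904000000000),
  (16789761, -2790982656000000000), (16793665, -358840627200000000000), (16793792,
  -79742361600000000000), (16797696, -448550784000000000000), (17051651, 134228822112000000000),
  (17051778, 59657254272000000000), (17051905, 6628583808000000000), (17055809,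
  852246489600000000000), (17055936, 189388108800000000000), (17059840, 1065308112000000000000)])]

lemma check_systemAHigh : systemAHigh.check 24 systemAHighValues = true := by
  decide +kernel

/-- The last three constants of the first system. -/
lemma lam_systemAHigh {s : ℕ} {c : ℕ → ℝ} {a21 r a50 : ℝ}
    {X Y : MvPolynomial (Fin 2) ℝ} {M : MvPowerSeries (Fin 2) ℝ}
    (hX : X = systemAX 0 a21 (-5 / 2 * a50) (-3 / 100 * a21 ^ 2 - 1 / 150 * a21 * r ^ 2 - 1 / 3 * r
    * a50) a50 (r * a50) (-3 / 2 * a21 * a50) (-1 / 6 * a21 * r * a50 + 5 / 3 * a50 ^ 2) (3 / 40 *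
    a21 ^ 2 * a50 + 1 / 60 * a21 * r ^ 2 * a50 + 5 / 12 * r * a50 ^ 2) (1 / 200 * a21 ^ 2 * r * a50
    + 1 / 900 * a21 * r ^ 3 * a50 + 1 / 20 * a21 * a50 ^ 2 + 7 / 180 * r ^ 2 * a50 ^ 2)) (hY : Y =
    systemAY)
    (hM : IsFormalSeries X Y s c M) (h50 : a50 ≠ 0) :
    (lam X Y s M 8 = 1 / (895050 * a50) * f2 a21 (r * a50) a50) ∧
    (f2 a21 (r * a50) a50 = 0 → lam X Y s M 9 = -(4 / (235125 * a50)) * f3 a21 (r * a50) a50) ∧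
    (f2 a21 (r * a50) a50 = 0 → lam X Y s M 10 =
      -(1 / (42089726250000 * ((s : ℝ) + 1) * (4 * (s : ℝ) - 19) * a50 ^ 3))
        * f1 a21 (r * a50) a50 s) := by
  obtain ⟨σ, hσ⟩ : ∃ σ : ℝ, σ = 1 / (s + 1) := ⟨_, rfl⟩
  have hs : (s : ℝ) + 1 ≠ 0 := by positivity
  have hS : (s + 1) * σ = 1 := by rw [hσ, mul_one_div_cancel hs]
  set v := systemAHigh.assignment [a21, r, a50] σ c with hv
  have v0 : v 0 = a21 := rfl
  have v1 : v 1 = r := rfl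
  have v2 : v 2 = a50 := rfl
  have v3 : v 3 = σ := rfl
  have v4 : v 4 = c 4 := rfl
  have v5 : v 5 = c 6 := rfl
  have v6 : v 6 = c 8 := rfl
  have v7 : v 7 = c 10 := rfl
  have key := SymbolicSystem.lam_of_check check_systemAHigh (by decide)
    (a := [a21, r, a50]) (v := v) (by rw [hv, hσ]) (X := X) (Y := Y) ?_ ?_ hM
  · clear_value v
    simp only [systemAHighValues, List.forall_mem_cons, systemAHigh,
      eval_cons, eval_nil, mval, Nat.reduceMod, Nat.reduceDiv,
      Nat.reduceAdd, pow_zero, pow_one, one_mul, mul_one, zero_add, v0, v1, v2, v3, v4, v5, v6, v7]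
        at key
    obtain ⟨k8, k9, k10, -⟩ := key
    have d8 : 2 * ((8 : ℕ) : ℝ) - 4 * s - 1 ≠ 0 := two_mul_sub_ne_zero 8 s
    have d9 : 2 * ((9 : ℕ) : ℝ) - 4 * s - 1 ≠ 0 := two_mul_sub_ne_zero 9 s
    have d10 : 2 * ((10 : ℕ) : ℝ) - 4 * s - 1 ≠ 0 := two_mul_sub_ne_zero 10 s
    push_cast at k8 k9 k10 d8 d9 d10
    refine ⟨?_, ?_, ?_⟩
    · have e : 1 / (895050 * a50) * f2 a21 (r * a50) a50 = 7 / 11050 * a21 ^ 3 * a50 ^ 3 + 14 /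
        49725 * a21 ^ 2 * r ^ 2 * a50 ^ 3 + 14 / 447525 * a21 * r ^ 4 * a50 ^ 3 + 8 / 1989 * a21 * r
        * a50 ^ 4 + 16 / 17901 * r ^ 3 * a50 ^ 4 + 10 / 1989 * a50 ^ 5 := by
        rw [f2]
        field_simp
        ring
      rw [e]
      apply mul_left_cancel₀ d8
      linear_combination (1 / 10182346574400000000000) * k8 + 19 * (7 / 11050 * a21 ^ 3 * a50 ^ 3 +
        14 / 49725 * a21 ^ 2 * r ^ 2 * a50 ^ 3 + 14 / 447525 * a21 * r ^ 4 * a50 ^ 3 + 8 / 1989 *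
        a21 * r * a50 ^ 4 + 16 / 17901 * r ^ 3 * a50 ^ 4 + 10 / 1989 * a50 ^ 5) * hS
    · intro e8
      have g2 : 567 * a21 ^ 3 + 252 * a21 ^ 2 * r ^ 2 + 28 * a21 * r ^ 4 + 3600 * a21 * r * a50 +
        800 * r ^ 3 * a50 + 4500 * a50 ^ 2 = 0 := by
        apply mul_left_cancel₀ (pow_ne_zero 4 h50)
        rw [f2] at e8
        linear_combination e8
      have e : -(4 / (235125 * a50)) * f3 a21 (r * a50) a50 = -36 / 26125 * a21 ^ 4 * a50 ^ 3 - 16 /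
        26125 * a21 ^ 3 * r ^ 2 * a50 ^ 3 - 16 / 235125 * a21 ^ 2 * r ^ 4 * a50 ^ 3 - 8 / 1045 * a21
        ^ 2 * r * a50 ^ 4 - 16 / 9405 * a21 * r ^ 3 * a50 ^ 4 + 4 / 1881 * r ^ 2 * a50 ^ 5 := by
        rw [f3]
        field_simp
        ring
      rw [e]
      apply mul_left_cancel₀ d9
      linear_combination (1 / 10182346574400000000000) * k9 + (s + 1) * (19 / 895050 * a21 * a50 ^ 3
        * σ ^ 2 - 31481 / 1402990875 * a21 * a50 ^ 3 * σ + 382 / 82528875 * a21 * a50 ^ 3) * g2 + 21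
        * (-36 / 26125 * a21 ^ 4 * a50 ^ 3 - 16 / 26125 * a21 ^ 3 * r ^ 2 * a50 ^ 3 - 16 / 235125 *
        a21 ^ 2 * r ^ 4 * a50 ^ 3 - 8 / 1045 * a21 ^ 2 * r * a50 ^ 4 - 16 / 9405 * a21 * r ^ 3 * a50
        ^ 4 + 4 / 1881 * r ^ 2 * a50 ^ 5) * hS
    · intro e8
      have g2 : 567 * a21 ^ 3 + 252 * a21 ^ 2 * r ^ 2 + 28 * a21 * r ^ 4 + 3600 * a21 * r * a50 +
        800 * r ^ 3 * a50 + 4500 * a50 ^ 2 = 0 := by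
        apply mul_left_cancel₀ (pow_ne_zero 4 h50)
        rw [f2] at e8
        linear_combination e8
      have d : 4 * (s : ℝ) - 19 ≠ 0 := fun h => d10 (by linear_combination -h)
      have e : (2 * 10 - 4 * s - 1) * (-(1 / (42089726250000 * ((s : ℝ) + 1) * (4 * (s : ℝ) - 19) *
        a50 ^ 3))
          * f1 a21 (r * a50) a50 s) = σ * ((f1 a21 (r * a50) a50 s / a50 ^ 3) / 42089726250000) :=
            by
        rw [hσ]
        field_simp
        ring
      have e' : f1 a21 (r * a50) a50 s / a50 ^ 3 / 42089726250000 =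
          (1815597 / 759687500 * a21 ^ 8 * a50 + 201733 / 189921875 * a21 ^ 7 * r ^ 2 * a50 + 201733
            / 1709296875 * a21 ^ 6 * r ^ 4 * a50 + 216258 / 7596875 * a21 ^ 6 * r * a50 ^ 2 + 11536
            / 1243125 * a21 ^ 5 * r ^ 3 * a50 ^ 2 + 403928 / 615346875 * a21 ^ 4 * r ^ 5 * a50 ^ 2 +
            197854 / 2734875 * a21 ^ 4 * r ^ 2 * a50 ^ 3 + 664916 / 41023125 * a21 ^ 3 * r ^ 4 * a50
            ^ 3 - 198136 / 1107624375 * a21 ^ 2 * r ^ 6 * a50 ^ 3 - 228704 / 4922775 * a21 ^ 2 * r ^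
            3 * a50 ^ 4 - 226592 / 44304975 * a21 * r ^ 5 * a50 ^ 4 - 32 / 268515 * r ^ 4 * a50 ^ 5)
            * (s + 1) ^ 2 + (-770025249 / 57736250000 * a21 ^ 8 * a50 - 85558361 / 14434062500 * a21
            ^ 7 * r ^ 2 * a50 - 85558361 / 129906562500 * a21 ^ 6 * r ^ 4 * a50 - 45860073 /
            288681250 * a21 ^ 6 * r * a50 ^ 2 - 244636 / 4723875 * a21 ^ 5 * r ^ 3 * a50 ^ 2 -
            42829654 / 11691590625 * a21 ^ 4 * r ^ 5 * a50 ^ 2 - 8391893 / 20785050 * a21 ^ 4 * r ^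
            2 * a50 ^ 3 - 70507213 / 779439375 * a21 ^ 3 * r ^ 4 * a50 ^ 3 + 20996618 / 21044863125
            * a21 ^ 2 * r ^ 6 * a50 ^ 3 + 24243352 / 93532725 * a21 ^ 2 * r ^ 3 * a50 ^ 4 + 24012616
            / 841794525 * a21 * r ^ 5 * a50 ^ 4 + 184 / 268515 * r ^ 4 * a50 ^ 5) * (s + 1) + (11907
            / 3265625 * a21 ^ 8 * a50 + 5292 / 3265625 * a21 ^ 7 * r ^ 2 * a50 + 588 / 3265625 * a21
            ^ 6 * r ^ 4 * a50 + 1134 / 26125 * a21 ^ 6 * r * a50 ^ 2 + 168 / 11875 * a21 ^ 5 * r ^ 3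
            * a50 ^ 2 + 392 / 391875 * a21 ^ 4 * r ^ 5 * a50 ^ 2 + 2877 / 26125 * a21 ^ 4 * r ^ 2 *
            a50 ^ 3 + 644 / 26125 * a21 ^ 3 * r ^ 4 * a50 ^ 3 - 196 / 705375 * a21 ^ 2 * r ^ 6 * a50
            ^ 3 - 224 / 3135 * a21 ^ 2 * r ^ 3 * a50 ^ 4 - 224 / 28215 * a21 * r ^ 5 * a50 ^ 4) :=
            by
        rw [f1]
        field_simp
        ring
      apply mul_left_cancel₀ d10
      rw [e, e']
      linear_combination (1 / 10182346574400000000000) * k10 + (s + 1) * (-21 / 3265625 * a21 ^ 5 *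
        a50 * σ ^ 2 + 12222623 / 519626250000 * a21 ^ 5 * a50 * σ - 28819 / 6837187500 * a21 ^ 5 *
        a50 - 14 / 391875 * a21 ^ 3 * r * a50 ^ 2 * σ ^ 2 + 3059261 / 23383181250 * a21 ^ 3 * r *
        a50 ^ 2 * σ - 14426 / 615346875 * a21 ^ 3 * r * a50 ^ 2 + 19 / 1790100 * a21 ^ 2 * a50 ^ 3 *
        σ ^ 3 - 172949 / 5611963500 * a21 ^ 2 * a50 ^ 3 * σ ^ 2 - 8954273 / 336717810000 * a21 ^ 2 *
        a50 ^ 3 * σ + 8659 / 2215248750 * a21 ^ 2 * a50 ^ 3 + 7 / 705375 * a21 * r ^ 2 * a50 ^ 3 * σ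
        ^ 2 - 13812641 / 392837445000 * a21 * r ^ 2 * a50 ^ 3 * σ + 5417 / 861485625 * a21 * r ^ 2 *
        a50 ^ 3 + 19 / 895050 * r * a50 ^ 4 * σ ^ 2 - 233 / 8055450 * r * a50 ^ 4 * σ + 4 / 805545 *
        r * a50 ^ 4 + 437 / 18796050 * a50 ^ 3 * σ * (c 4) - 92 / 9398025 * a50 ^ 3 * (c 4)) * g2 +
        (-(1815597 / 759687500 * a21 ^ 8 * a50 + 201733 / 189921875 * a21 ^ 7 * r ^ 2 * a50 + 201733
        / 1709296875 * a21 ^ 6 * r ^ 4 * a50 + 216258 / 7596875 * a21 ^ 6 * r * a50 ^ 2 + 11536 /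
        1243125 * a21 ^ 5 * r ^ 3 * a50 ^ 2 + 403928 / 615346875 * a21 ^ 4 * r ^ 5 * a50 ^ 2 +
        197854 / 2734875 * a21 ^ 4 * r ^ 2 * a50 ^ 3 + 664916 / 41023125 * a21 ^ 3 * r ^ 4 * a50 ^ 3
        - 198136 / 1107624375 * a21 ^ 2 * r ^ 6 * a50 ^ 3 - 228704 / 4922775 * a21 ^ 2 * r ^ 3 * a50
        ^ 4 - 226592 / 44304975 * a21 * r ^ 5 * a50 ^ 4 - 32 / 268515 * r ^ 4 * a50 ^ 5) * (s + 1) +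
        (11907 / 3265625 * a21 ^ 8 * a50 + 5292 / 3265625 * a21 ^ 7 * r ^ 2 * a50 + 588 / 3265625 *
        a21 ^ 6 * r ^ 4 * a50 + 1134 / 26125 * a21 ^ 6 * r * a50 ^ 2 + 168 / 11875 * a21 ^ 5 * r ^ 3
        * a50 ^ 2 + 392 / 391875 * a21 ^ 4 * r ^ 5 * a50 ^ 2 + 2877 / 26125 * a21 ^ 4 * r ^ 2 * a50
        ^ 3 + 644 / 26125 * a21 ^ 3 * r ^ 4 * a50 ^ 3 - 196 / 705375 * a21 ^ 2 * r ^ 6 * a50 ^ 3 -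
        224 / 3135 * a21 ^ 2 * r ^ 3 * a50 ^ 4 - 224 / 28215 * a21 * r ^ 5 * a50 ^ 4) * σ) * hS
  · rw [hX, systemAX_eq]
    clear_value v
    simp only [systemAHigh, SymbolicSystem.realTerms, termsAX, List.map_cons, List.map_nil,
      eval_cons, eval_nil, mval, Nat.reduceMod, Nat.reduceDiv,
      Nat.reduceAdd, pow_zero, pow_one, one_mul, mul_one, zero_add, v0, v1, v2, v3, v4, v5, v6, v7]
    push_cast
    ring_nf
  · rw [hY, systemAY_eq]
    norm_num [systemAHigh, SymbolicSystem.realTerms, eval_cons, eval_nil, mval_zero]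

end

end QuasiLyapunov


namespace QuasiLyapunov

open CodedPoly

noncomputable section

/-- The second system. -/
def systemBGeneral : SymbolicSystem where
  params := 9
  vars := 10
  den := 1
  mult := 3
  termsX := []
  termsY := [(3, 0, [(0, -2)]), (3, 0, []), (2, 1, [(1, 1)]), (1, 2, [(64, 1)]), (0, 3, [(4096,
    1)]), (5, 0,
    [(262144, 1)]), (4, 1, [(16777216, 1)]), (3, 2, [(1073741824, 1)]), (2, 3, [(68719476736, 1)]),
    (1, 4, [(4398046511104, 1)]), (0, 5, [(281474976710656, 1)])]

/-- The constants of `systemBGeneral`, as computed by the recursion. -/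
def systemBGeneralValues : List (ℕ × CodedPoly) :=
  [(1, [(1, -4), (18014398509481985, 5)])]

lemma check_systemBGeneral : systemBGeneral.check 6 systemBGeneralValues = true := by
  decide +kernel

/-- The first constant of the second system. -/
lemma lam_systemBGeneral {s : ℕ} {c : ℕ → ℝ} {a21 a12 a03 a50 a41 a32 a23 a14 a05 : ℝ}
    {X Y : MvPolynomial (Fin 2) ℝ} {M : MvPowerSeries (Fin 2) ℝ}
    (hX : X = systemBX) (hY : Y = systemBY a21 a12 a03 a50 a41 a32 a23 a14 a05)
    (hM : IsFormalSeries X Y s c M) :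
    lam X Y s M 1 = 1 / 3 * a21 := by
  obtain ⟨σ, hσ⟩ : ∃ σ : ℝ, σ = 1 / (s + 1) := ⟨_, rfl⟩
  have hs : (s : ℝ) + 1 ≠ 0 := by positivity
  have hS : (s + 1) * σ = 1 := by rw [hσ, mul_one_div_cancel hs]
  set v := systemBGeneral.assignment [a21, a12, a03, a50, a41, a32, a23, a14, a05] σ c with hv
  have v0 : v 0 = a21 := rfl
  have v1 : v 1 = a12 := rfl
  have v2 : v 2 = a03 := rfl
  have v3 : v 3 = a50 := rfl
  have v4 : v 4 = a41 := rfl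
  have v5 : v 5 = a32 := rfl
  have v6 : v 6 = a23 := rfl
  have v7 : v 7 = a14 := rfl
  have v8 : v 8 = a05 := rfl
  have v9 : v 9 = σ := rfl
  have key := SymbolicSystem.lam_of_check check_systemBGeneral (by decide)
    (a := [a21, a12, a03, a50, a41, a32, a23, a14, a05]) (v := v) (by rw [hv, hσ]) (X := X) (Y := Y)
      ?_ ?_ hM
  · clear_value v
    simp only [systemBGeneralValues, List.forall_mem_cons, systemBGeneral,
      eval_cons, eval_nil, mval, Nat.reduceMod, Nat.reduceDiv,
      Nat.reduceAdd, pow_zero, pow_one, one_mul, mul_one, zero_add, v0, v1, v2, v3, v4, v5, v6, v7,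
        v8, v9] at key
    obtain ⟨k1, -⟩ := key
    have d1 : 2 * ((1 : ℕ) : ℝ) - 4 * s - 1 ≠ 0 := two_mul_sub_ne_zero 1 s
    push_cast at k1 d1
    apply mul_left_cancel₀ d1
    linear_combination (1 / 3) * k1 + 5 * (1 / 3 * a21) * hS
  · rw [hX, systemBX_eq]
    simp [systemBGeneral, SymbolicSystem.realTerms]
  · rw [hY, systemBY_eq]
    clear_value v
    simp only [systemBGeneral, SymbolicSystem.realTerms, termsBY, termsAX, List.map_cons,
      List.map_nil,
      eval_cons, eval_nil, mval, Nat.reduceMod, Nat.reduceDiv,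
      Nat.reduceAdd, pow_zero, pow_one, one_mul, mul_one, zero_add, v0, v1, v2, v3, v4, v5, v6, v7,
        v8, v9]
    push_cast
    ring_nf

/-- The second system with `a21 = 0`. -/
def systemBLow : SymbolicSystem where
  params := 8
  vars := 11
  den := 1
  mult := 138600
  termsX := []
  termsY := [(3, 0, [(0, -2)]), (3, 0, []), (2, 1, []), (1, 2, [(1, 1)]), (0, 3, [(64, 1)]), (5, 0,
    [(4096,
    1)]), (4, 1, [(262144, 1)]), (3, 2, [(16777216, 1)]), (2, 3, [(1073741824, 1)]), (1, 4,
    [(68719476736, 1)]), (0, 5, [(4398046511104, 1)])]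

/-- The constants of `systemBLow`, as computed by the recursion. -/
def systemBLowValues : List (ℕ × CodedPoly) :=
  [(2, [(64, -665280), (262144, -110880), (281474976710720, 1164240), (281474976972800, 194040)]),
  (3, [(65, 728640), (4160, 570240), (262145, 95040), (266240, 55440), (1073741824, -158400),
  (281474976710721, -1861200), (281474976714816, -978120), (281474976972801, -250800),
  (281474976976896, -73920), (281476050452480, 356400), (562949953421377, 1164240),
  (562949953683457, 194040)]), (4, [(66, -413600), (4161, -637120), (8256, -118800), (262146,
  -41360), (266241, -47520), (16777280, 332640), (17039360, 43120), (1073741825, 165440),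
  (1073745920, 140800), (4398046511104, -739200), (281474976710722, 1383580), (281474976714817,
  1604900), (281474976718912, 198000), (281474976972802, 150370), (281474976976897, 113850),
  (281474993487936, -873180), (281474993750016, -111650), (281476050452481, -481360),
  (281476050456576, -301400), (285873023221760, 2032800), (562949953421378, -1528560),
  (562949953425473, -978120), (562949953683458, -195360), (562949953687553, -73920),
  (562949970198592, 582120), (562949970460672, 97020), (562951027163137, 356400), (844424930132034,
  582120), (844424930394114, 97020), (18014398509482048, -1626240), (18014398509744128, -271040),
  (18295873486192704, 1422960), (18295873486454784, 237160)]), (5, [(67, 161440), (192, -1054080),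
  (4162, 367680), (8257, 136400), (262147, 12160), (262272, -527040), (266242, 20680), (524352,
  -53760), (16777281, -381600), (16781376, -293760), (17039361, -37760), (17043456, -21560),
  (1073741826, -88480), (1073745921, -148800), (1073750016, -30800), (1090519040, 79200),
  (68719476800, 829440), (68719738880, 162240), (4398046511105, 1190400), (4398046515200, 888000),
  (281474976710723, -663940), (281474976710848, 3740256), (281474976714818, -1215970),
  (281474976718913, -337150), (281474976972803, -56680), (281474976972928, 1876176),
  (281474976976898, -71720), (281474977235008, 226464), (281474977497088, 5544), (281474993487937,
  1297620), (281474993492032, 757710), (281474993750017, 137240), (281474993754112, 52360),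
  (281476050452482, 323860), (281476050456577, 423100), (281476050460672, 61600), (281476067229696,
  -227700), (281543696187456, -2584800), (281543696449536, -508800), (285873023221761, -3868800),
  (285873023225856, -2424000), (562949953421379, 1019260), (562949953421504, -4396896),
  (562949953425474, 1319780), (562949953429569, 198000), (562949953683459, 102850),
  (562949953683584, -2190888), (562949953687554, 86130), (562949953945664, -292908),
  (562949954207744, -8316), (562949970198593, -1471140), (562949970202688, -489060),
  (562949970460673, -181610), (562949970464768, -36960), (562951027163138, -402160),
  (562951027167233, -301400), (562951043940352, 178200), (563018672898112, 1975680),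
  (563018673160192, 329280), (567347999932417, 2032800), (844424930132035, -708840),
  (844424930132160, 1741824), (844424930136130, -489060), (844424930394115, -88440),
  (844424930394240, 839160), (844424930398210, -36960), (844424930656320, 108108), (844424930918400,
  2772), (844424946909249, 582120), (844424947171329, 97020), (844426003873794, 178200),
  (1125899906842691, 194040), (1125899907104771, 32340), (18014398509482049, 2878080),
  (18014398509486144, 1939200), (18014398509744129, 417280), (18014398509748224, 229600),
  (18014399583223808, -374400), (18295873486192705, -4050960), (18295873486196800, -1673400),
  (18295873486454785, -604960), (18295873486458880, -173600), (18295874559934464, 421200),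
  (18577348462903361, 1422960), (18577348463165441, 237160)])]

lemma check_systemBLow : systemBLow.check 14 systemBLowValues = true := by
  decide +kernel

/-- The second to fifth constant of the second system. -/
lemma lam_systemBLow {s : ℕ} {c : ℕ → ℝ} {a12 a03 a50 a41 a32 a23 a14 a05 : ℝ}
    {X Y : MvPolynomial (Fin 2) ℝ} {M : MvPowerSeries (Fin 2) ℝ}
    (hX : X = systemBX) (hY : Y = systemBY 0 a12 a03 a50 a41 a32 a23 a14 a05)
    (hM : IsFormalSeries X Y s c M) :
    (lam X Y s M 2 = 1 / 5 * (6 * a03 + a41)) ∧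
    (6 * a03 + a41 = 0 → lam X Y s M 3 = -(1 / 7) * (2 * a03 * a12 - 2 * a23 + 3 * a03 * a50)) ∧
    (6 * a03 + a41 = 0 → 2 * a03 * a12 - 2 * a23 + 3 * a03 * a50 = 0 →
      lam X Y s M 4 = 1 / 30 * (40 * a05 - 4 * a03 * a32 - 2 * a03 * a12 * a50 - 5 * a03 * a50 ^ 2))
        ∧
    (6 * a03 + a41 = 0 → 2 * a03 * a12 - 2 * a23 + 3 * a03 * a50 = 0 →
      40 * a05 - 4 * a03 * a32 - 2 * a03 * a12 * a50 - 5 * a03 * a50 ^ 2 = 0 →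
      lam X Y s M 5 = -(a03 / 154) * (48 * a03 ^ 2 - 40 * a14 + 12 * a12 * a32 + 6 * a12 ^ 2 * a50
        + 12 * a32 * a50 + 21 * a12 * a50 ^ 2 + 18 * a50 ^ 3)) := by
  obtain ⟨σ, hσ⟩ : ∃ σ : ℝ, σ = 1 / (s + 1) := ⟨_, rfl⟩
  have hs : (s : ℝ) + 1 ≠ 0 := by positivity
  have hS : (s + 1) * σ = 1 := by rw [hσ, mul_one_div_cancel hs]
  set v := systemBLow.assignment [a12, a03, a50, a41, a32, a23, a14, a05] σ c with hv
  have v0 : v 0 = a12 := rfl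
  have v1 : v 1 = a03 := rfl
  have v2 : v 2 = a50 := rfl
  have v3 : v 3 = a41 := rfl
  have v4 : v 4 = a32 := rfl
  have v5 : v 5 = a23 := rfl
  have v6 : v 6 = a14 := rfl
  have v7 : v 7 = a05 := rfl
  have v8 : v 8 = σ := rfl
  have v9 : v 9 = c 4 := rfl
  have v10 : v 10 = c 6 := rfl
  have key := SymbolicSystem.lam_of_check check_systemBLow (by decide)
    (a := [a12, a03, a50, a41, a32, a23, a14, a05]) (v := v) (by rw [hv, hσ]) (X := X) (Y := Y) ?_
      ?_ hM
  · clear_value v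
    simp only [systemBLowValues, List.forall_mem_cons, systemBLow,
      eval_cons, eval_nil, mval, Nat.reduceMod, Nat.reduceDiv,
      Nat.reduceAdd, pow_zero, pow_one, one_mul, mul_one, zero_add, v0, v1, v2, v3, v4, v5, v6, v7,
        v8, v9, v10] at key
    obtain ⟨k2, k3, k4, k5, -⟩ := key
    have d2 : 2 * ((2 : ℕ) : ℝ) - 4 * s - 1 ≠ 0 := two_mul_sub_ne_zero 2 s
    have d3 : 2 * ((3 : ℕ) : ℝ) - 4 * s - 1 ≠ 0 := two_mul_sub_ne_zero 3 s
    have d4 : 2 * ((4 : ℕ) : ℝ) - 4 * s - 1 ≠ 0 := two_mul_sub_ne_zero 4 s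
    have d5 : 2 * ((5 : ℕ) : ℝ) - 4 * s - 1 ≠ 0 := two_mul_sub_ne_zero 5 s
    push_cast at k2 k3 k4 k5 d2 d3 d4 d5
    refine ⟨?_, ?_, ?_, ?_⟩
    · apply mul_left_cancel₀ d2
      linear_combination (1 / 138600) * k2 + 7 * (6 / 5 * a03 + 1 / 5 * a41) * hS
    · intro e2
      apply mul_left_cancel₀ d3
      linear_combination (1 / 138600) * k3 + (s + 1) * (7 / 5 * a12 * σ ^ 2 - 38 / 21 * a12 * σ + 24
        / 35 * a12 - 8 / 15 * a50 * σ + 2 / 5 * a50) * e2 + 9 * (-2 / 7 * a12 * a03 - 3 / 7 * a03 *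
        a50 + 2 / 7 * a23) * hS
    · intro e2 e3
      apply mul_left_cancel₀ d4
      linear_combination (1 / 138600) * k4 + (s + 1) * (7 / 10 * a12 ^ 2 * σ ^ 3 - 148 / 105 * a12 ^
        2 * σ ^ 2 + 1367 / 1260 * a12 ^ 2 * σ - 94 / 315 * a12 ^ 2 - 8 / 15 * a12 * a50 * σ ^ 2 + 23
        / 28 * a12 * a50 * σ - 12 / 35 * a12 * a50 + 7 / 10 * a32 * σ ^ 2 - 29 / 36 * a32 * σ + 14 /
        45 * a32 + 77 / 45 * σ * (c 4) - 88 / 45 * (c 4)) * e2 + (s + 1) * (-9 / 7 * a12 * σ ^ 2 +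
        547 / 315 * a12 * σ - 188 / 315 * a12 + 137 / 126 * a50 * σ - 32 / 63 * a50) * e3 + 11 * (-1
        / 15 * a12 * a03 * a50 - 1 / 6 * a03 * a50 ^ 2 - 2 / 15 * a03 * a32 + 4 / 3 * a05) * hS
    · intro e2 e3 e4
      apply mul_left_cancel₀ d5
      linear_combination (1 / 138600) * k5 + (s + 1) * (7 / 30 * a12 ^ 3 * σ ^ 4 - 67 / 105 * a12 ^
        3 * σ ^ 3 + 187 / 252 * a12 ^ 3 * σ ^ 2 - 1417 / 3465 * a12 ^ 3 * σ + 304 / 3465 * a12 ^ 3 -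
        4 / 15 * a12 ^ 2 * a50 * σ ^ 3 + 87 / 140 * a12 ^ 2 * a50 * σ ^ 2 - 163 / 315 * a12 ^ 2 *
        a50 * σ + 47 / 315 * a12 ^ 2 * a50 + 7 / 10 * a12 * a32 * σ ^ 3 - 1651 / 1260 * a12 * a32 *
        σ ^ 2 + 3431 / 3465 * a12 * a32 * σ - 944 / 3465 * a12 * a32 + 77 / 45 * a12 * σ ^ 2 * (c 4)
        - 15124 / 3465 * a12 * σ * (c 4) + 10432 / 3465 * a12 * (c 4) + 576 / 275 * a03 ^ 2 * σ ^ 3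
        - 1454 / 275 * a03 ^ 2 * σ ^ 2 + 9958 / 1925 * a03 ^ 2 * σ - 568 / 385 * a03 ^ 2 + 33 / 50 *
        a03 * a41 * σ ^ 3 - 263 / 150 * a03 * a41 * σ ^ 2 + 46 / 33 * a03 * a41 * σ - 64 / 165 * a03
        * a41 - 4 / 15 * a50 * a32 * σ ^ 2 + 17 / 45 * a50 * a32 * σ - 7 / 45 * a50 * a32 - 124 / 99
        * a50 * σ * (c 4) + 164 / 99 * a50 * (c 4) + 1 / 50 * a41 ^ 2 * σ ^ 3 - 3 / 50 * a41 ^ 2 * σ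
        ^ 2 + 1 / 25 * a41 ^ 2 * σ + 392 / 165 * a14 * σ ^ 2 - 848 / 231 * a14 * σ + 1352 / 1155 *
        a14) * e2 + (s + 1) * (-9 / 14 * a12 ^ 2 * σ ^ 3 + 457 / 315 * a12 ^ 2 * σ ^ 2 - 16193 /
        13860 * a12 ^ 2 * σ + 158 / 495 * a12 ^ 2 + 137 / 126 * a12 * a50 * σ ^ 2 - 4231 / 2772 *
        a12 * a50 * σ + 124 / 231 * a12 * a50 - 2 / 9 * a50 ^ 2 * σ + 1 / 9 * a50 ^ 2 - 9 / 14 * a32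
        * σ ^ 2 + 23 / 28 * a32 * σ - 2 / 7 * a32 - 117 / 77 * σ * (c 4) + 104 / 77 * (c 4)) * e3 +
        (s + 1) * (11 / 30 * a12 * σ ^ 2 - 806 / 1155 * a12 * σ + 248 / 1155 * a12 - 101 / 231 * a50
        * σ + 37 / 231 * a50) * e4 + 13 * (-3 / 77 * a12 ^ 2 * a03 * a50 - 3 / 22 * a12 * a03 * a50
        ^ 2 - 6 / 77 * a12 * a03 * a32 - 24 / 77 * a03 ^ 3 - 9 / 77 * a03 * a50 ^ 3 - 6 / 77 * a03 *
        a50 * a32 + 20 / 77 * a03 * a14) * hS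
  · rw [hX, systemBX_eq]
    simp [systemBLow, SymbolicSystem.realTerms]
  · rw [hY, systemBY_eq]
    clear_value v
    simp only [systemBLow, SymbolicSystem.realTerms, termsBY, termsAX, List.map_cons, List.map_nil,
      eval_cons, eval_nil, mval, Nat.reduceMod, Nat.reduceDiv,
      Nat.reduceAdd, pow_zero, pow_one, one_mul, mul_one, zero_add, v0, v1, v2, v3, v4, v5, v6, v7,
        v8, v9, v10]
    push_cast
    ring_nf

/-- The second system when its first five constants vanish. -/
def systemBHigh : SymbolicSystem where
  params := 4
  vars := 9
  den := 40
  mult := 8380532160000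
  termsX := []
  termsY := [(3, 0, [(0, -80)]), (3, 0, []), (2, 1, []), (1, 2, [(1, 40)]), (0, 3, [(64, 40)]), (5,
    0,
    [(4096, 40)]), (4, 1, [(64, -240)]), (3, 2, [(262144, 40)]), (2, 3, [(65, 40), (4160, 60)]), (1,
    4, [(128, 48), (4098, 6), (8193, 21), (12288, 18), (262145, 12), (266240, 12)]), (0, 5, [(4161,
    2), (8256, 5), (262208, 4)])]

/-- The constants of `systemBHigh`, as computed by the recursion. -/
def systemBHighValues : List (ℕ × CodedPoly) :=
  [(6, [(193, 165032017920000), (4288, 330064035840000), (8258, 10314501120000), (12353,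
  51572505600000), (16448, 59308381440000), (266305, 41258004480000), (270400, 82516008960000),
  (524352, 41258004480000), (16777409, -618870067200000), (16781504, -1237740134400000), (16785474,
  -38679379200000), (16789569, -193396896000000), (16793664, -222406430400000), (17043521,
  -154717516800000), (17047616, -309435033600000), (17301568, -154717516800000)]), (7, [(194,
  -217184993280000), (4289, -488094695424000), (8259, -11136089088000), (8384, -69834977280000),
  (12354, -61302071808000), (16449, -85349147904000), (20544, -17174090880000), (262336,
  150457761792000), (266306, -44544356352000), (270401, -106699272192000), (274496,
  -28952045568000), (524353, -44544356352000), (528448, -22486505472000), (16777410,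
  868025548800000), (16781505, 1833730762752000), (16785475, 43890211584000), (16785600,
  35497958400000), (16789570, 235177323264000), (16793665, 302136184512000), (16797760,
  26037417600000), (17039552, -639445487616000), (17043522, 175560846336000), (17047617,
  393303983616000), (17051712, 57721019904000), (17301569, 175560846336000), (17305664,
  62905061376000), (33554626, -618870067200000), (33558721, -1237740134400000), (33562691,
  -38679379200000), (33566786, -193396896000000), (33570881, -222406430400000), (33820738,
  -154717516800000), (33824833, -309435033600000), (34078785, -154717516800000)]), (8, [(195,
  148369121280000), (320, 209687740416000), (4290, 385280630784000), (8260, 4790582784000), (8385,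
  130754359296000), (12355, 27431004672000), (12480, 13929172992000), (16450, 33423829632000),
  (20545, -14935014144000), (24640, -19529524224000), (262337, -287312044032000), (266307,
  19162331136000), (266432, -262815694848000), (270402, 36294594048000), (274497, -44652833280000),
  (278592, -68147872128000), (524354, 19162331136000), (528449, -13997463552000), (532544,
  -63732953088000), (786496, -27909826560000), (16777411, -654609669120000), (16777536,
  -996016766976000), (16781506, -1578221632512000), (16785476, -20840276160000), (16785601,
  -361934714880000), (16789571, -112250244096000), (16789696, -149460982272000), (16793666,
  -108381066768000), (16797761, 108169661520000), (16801856, 81845152704000), (17039553,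
  1196672818176000), (17043523, -83361104640000), (17043648, 931062988800000), (17047618,
  -131430993984000), (17051713, 240216345792000), (17055808, 279573714000000), (17301570,
  -83361104640000), (17305665, 77168595456000), (17309760, 257941587456000), (17563712,
  109364048640000), (33554627, 785509539840000), (33558722, 1668698744832000), (33562692,
  38732961024000), (33562817, 35497958400000), (33566787, 209391070464000), (33570882,
  272481993792000), (33574977, 26037417600000), (33816769, -948880521216000), (33820739,
  154931844096000), (33820864, -618870067200000), (33824834, 332706289536000), (33828929,
  -38977428096000), (33833024, -111203215200000), (34078786, 154931844096000), (34082881,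
  -14453697024000), (34086976, -154717516800000), (34340928, -77358758400000), (50331843,
  -309435033600000), (50335938, -618870067200000), (50339908, -19339689600000), (50344003,
  -96698448000000), (50348098, -111203215200000), (50597955, -77358758400000), (50602050,
  -154717516800000), (50856002, -77358758400000), (1073742017, 368895098880000), (1073746112,
  737790197760000), (1073750082, 23055943680000), (1073754177, 115279718400000), (1073758272,
  132571676160000), (1074008129, 92223774720000), (1074012224, 184447549440000), (1074266176,
  92223774720000), (1090519233, -691678310400000), (1090523328, -1383356620800000), (1090527298,
  -43229894400000), (1090531393, -216149472000000), (1090535488, -248571892800000), (1090785345,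
  -172919577600000), (1090789440, -345839155200000), (1091043392, -172919577600000)]), (9, [(196,
  -70200705024000), (321, -952334607974400), (4291, -253204188364800), (4416, -1407538711756800),
  (8261, -31855104000), (8386, -386120731852800), (12356, -148525516800), (12481, -656714539008000),
  (16451, 4269992371200), (16576, -516299351961600), (20546, 2438525376000), (24641,
  -31177036569600), (28736, -32179959244800), (262338, 178239047270400), (266308, -127420416000),
  (266433, -19934340710400), (270403, 11141837107200), (270528, -472427535974400), (274498,
  31259506636800), (278593, -18379884211200), (282688, -61204683686400), (524355, -127420416000),
  (524480, -273192851865600), (528450, 10612200038400), (532545, 419748249600), (536640,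
  -45248453222400), (786497, 10569200025600), (790592, -5034861158400), (16777412, 343232612352000),
  (16777537, 3881238139699200), (16781507, 1124518734950400), (16781632, 5231174035046400),
  (16785477, 607965120000), (16785602, 1508950081382400), (16789572, -1155936153600), (16789697,
  2670547712256000), (16793667, -44093911593600), (16793792, 2006207508556800), (16797762,
  -62707596624000), (16801857, 106642737964800), (16805952, 128911680230400), (17039554,
  -838987003699200), (17043524, 2431860480000), (17043649, 64832704819200), (17047619,
  -66705089241600), (17047744, 1925927045683200), (17051714, -200777115686400), (17055809,
  44835539241600), (17059904, 266524944019200), (17301571, 2431860480000), (17301696,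
  1086141079756800), (17305666, -69173514547200), (17309761, -22473100108800), (17313856,
  209533511347200), (17563713, -52390467532800), (17567808, 32047360819200), (33554628,
  -546017172480000), (33554753, -3360751865856000), (33558723, -1477491563520000), (33558848,
  -4729470197760000), (33562693, -15272231616000), (33562818, -1263058202880000), (33566788,
  -90556538112000), (33566913, -2321613487872000), (33570883, -141843797136000), (33571008,
  -1709730348480000), (33574978, -118373203440000), (33579073, -232781060736000), (33583168,
  -154513941120000), (33816770, 1186306145280000), (33820740, -61088926464000), (33820865,
  231808905216000), (33824835, -115037482176000), (33824960, -1737887685120000), (33828930,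
  41945560128000), (33833025, -149888174544000), (33837120, -304966503360000), (34078787,
  -61088926464000), (34078912, -910906518528000), (34082882, 48075310080000), (34086977,
  72957037824000), (34091072, -221944727808000), (34340929, 104856830208000), (34345024,
  -40206108672000), (50331844, 379002101760000), (50331969, 293148979200000), (50335939,
  806844036096000), (50336064, 586297958400000), (50339909, 18506938752000), (50340034,
  36070790400000), (50344004, 100397826432000), (50344129, 91609056000000), (50348099,
  131298631776000), (50348224, 105350414400000), (50352194, 13018708800000), (50593986,
  -629157777408000), (50597956, 74027755008000), (50598081, -545582822400000), (50602051,
  149806965888000), (50602176, 146574489600000), (50606146, -67837938048000), (50610241,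
  -111203215200000), (50856003, 74027755008000), (50856128, 73287244800000), (50860098,
  -45906227712000), (50864193, -154717516800000), (51118145, -77358758400000), (67109060,
  -103145011200000), (67113155, -206290022400000), (67117125, -6446563200000), (67121220,
  -32232816000000), (67125315, -37067738400000), (67375172, -25786252800000), (67379267,
  -51572505600000), (67633219, -25786252800000), (1073742018, -736923156480000), (1073746113,
  -1722043072512000), (1073750083, -40668493824000), (1073750208, -413245808640000), (1073754178,
  -223859026944000), (1073758273, -321413847552000), (1073762368, -84480157440000), (1074004160,
  332590841856000), (1074008130, -162673975296000), (1074012225, -396635774976000), (1074016320,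
  -128717697024000), (1074266177, -162673975296000), (1074270272, -82066231296000), (1090519234,
  1627444224000000), (1090523329, 3605544327168000), (1090527299, 90263206656000), (1090527424,
  524622873600000), (1090531394, 483866078976000), (1090535489, 649861507008000), (1090539584,
  115996406400000), (1090781376, -706755538944000), (1090785346, 361052826624000), (1090789441,
  829401721344000), (1090793536, 185143988736000), (1091043393, 361052826624000), (1091047488,
  130200182784000), (1107296450, -691678310400000), (1107300545, -1383356620800000), (1107304515,
  -43229894400000), (1107308610, -216149472000000), (1107312705, -248571892800000), (1107562562,
  -172919577600000), (1107566657, -345839155200000), (1107820609, -172919577600000)])]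

lemma check_systemBHigh : systemBHigh.check 22 systemBHighValues = true := by
  decide +kernel

/-- The sixth to ninth constant of the second system. -/
lemma lam_systemBHigh {s : ℕ} {c : ℕ → ℝ} {a12 a03 a50 a32 : ℝ}
    {X Y : MvPolynomial (Fin 2) ℝ} {M : MvPowerSeries (Fin 2) ℝ}
    (hX : X = systemBX) (hY : Y = systemBY 0 a12 a03 a50 (-6 * a03) a32 (a12 * a03 + 3 / 2 * a03 *
    a50) (3 / 20 * a12 ^ 2 * a50 + 21 / 40 * a12 * a50 ^ 2 + 3 / 10 * a12 * a32 + 6 / 5 * a03 ^ 2 +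
    9 / 20 * a50 ^ 3 + 3 / 10 * a50 * a32) (1 / 20 * a12 * a03 * a50 + 1 / 8 * a03 * a50 ^ 2 + 1 /
    10 * a03 * a32))
    (hM : IsFormalSeries X Y s c M) :
    (lam X Y s M 6 = -(a03 / 520) * (64 * a03 ^ 2 * a12 + 16 * a32 ^ 2 + 128 * a03 ^ 2 * a50
        + 16 * a12 * a32 * a50 + 4 * a12 ^ 2 * a50 ^ 2 + 32 * a32 * a50 ^ 2
        + 20 * a12 * a50 ^ 3 + 23 * a50 ^ 4)) ∧
    (a12 + 2 * a50 ≠ 0 → a03 * (64 * a03 ^ 2 * a12 + 16 * a32 ^ 2 + 128 * a03 ^ 2 * a50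
        + 16 * a12 * a32 * a50 + 4 * a12 ^ 2 * a50 ^ 2 + 32 * a32 * a50 ^ 2
        + 20 * a12 * a50 ^ 3 + 23 * a50 ^ 4) = 0 →
      lam X Y s M 7 = -(a03 / (61600 * (a12 + 2 * a50))) * (4 * a32 + 2 * a12 * a50 + 5 * a50 ^ 2)
        * f5 a12 a32 a50) ∧
    (a12 + 2 * a50 ≠ 0 → a03 * (64 * a03 ^ 2 * a12 + 16 * a32 ^ 2 + 128 * a03 ^ 2 * a50
        + 16 * a12 * a32 * a50 + 4 * a12 ^ 2 * a50 ^ 2 + 32 * a32 * a50 ^ 2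
        + 20 * a12 * a50 ^ 3 + 23 * a50 ^ 4) = 0 →
      a03 * (4 * a32 + 2 * a12 * a50 + 5 * a50 ^ 2) * f5 a12 a32 a50 = 0 →
      lam X Y s M 8 = 7 * a03 / (651463800 * (a12 + 2 * a50) ^ 2) * (4 * a32 + 2 * a12 * a50 + 5 *
        a50 ^ 2)
        * f6 a12 a32 a50) ∧
    (a12 + 2 * a50 ≠ 0 → a03 * (64 * a03 ^ 2 * a12 + 16 * a32 ^ 2 + 128 * a03 ^ 2 * a50
        + 16 * a12 * a32 * a50 + 4 * a12 ^ 2 * a50 ^ 2 + 32 * a32 * a50 ^ 2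
        + 20 * a12 * a50 ^ 3 + 23 * a50 ^ 4) = 0 →
      a03 * (4 * a32 + 2 * a12 * a50 + 5 * a50 ^ 2) * f5 a12 a32 a50 = 0 →
      lam X Y s M 9 = -(a03 / (34719763221000 * ((s : ℝ) + 1) * (4 * (s : ℝ) - 17)
        * (a12 + 2 * a50) ^ 2)) * (4 * a32 + 2 * a12 * a50 + 5 * a50 ^ 2) * f4 a12 a32 a50 s) ∧
    (a12 + 2 * a50 = 0 → a32 = a50 ^ 2 / 4 → lam X Y s M 7 =
      -(9 * a03 / 7700) * (4 * a32 + a50 ^ 2) * (24 * a03 ^ 2 + a50 ^ 3)) ∧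
    (a12 + 2 * a50 = 0 → a32 = a50 ^ 2 / 4 → a03 * (24 * a03 ^ 2 + a50 ^ 3) = 0 →
      lam X Y s M 8 = 7 * a03 / 13260 * a50 ^ 6) ∧
    (a12 + 2 * a50 = 0 → a32 = a50 ^ 2 / 4 → a03 * (24 * a03 ^ 2 + a50 ^ 3) = 0 →
      lam X Y s M 9 = a03 * a50 ^ 7 / (13856700 * (1 + (s : ℝ)) * (4 * (s : ℝ) - 17))
        * (5391 - 205861 * (s : ℝ) + 66718 * (s : ℝ) ^ 2)) ∧
    (a12 + 2 * a50 = 0 → a32 = -(a50 ^ 2 / 4) → lam X Y s M 7 = 0) ∧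
    (a12 + 2 * a50 = 0 → a32 = -(a50 ^ 2 / 4) →
      lam X Y s M 8 = -(2 * a03 / 5525) * (16 * a03 ^ 2 + a50 ^ 3) * (27 * a03 ^ 2 + 2 * a50 ^ 3)) ∧
    (a12 + 2 * a50 = 0 → a32 = -(a50 ^ 2 / 4) →
      lam X Y s M 9 = 4 * a03 * a50 / (1154725 * (1 + (s : ℝ)) * (4 * (s : ℝ) - 17))
        * (84 + 3064 * (s : ℝ) - 991 * (s : ℝ) ^ 2)
        * (16 * a03 ^ 2 + a50 ^ 3) * (27 * a03 ^ 2 + 2 * a50 ^ 3)) := by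
  obtain ⟨σ, hσ⟩ : ∃ σ : ℝ, σ = 1 / (s + 1) := ⟨_, rfl⟩
  have hs : (s : ℝ) + 1 ≠ 0 := by positivity
  have hS : (s + 1) * σ = 1 := by rw [hσ, mul_one_div_cancel hs]
  set v := systemBHigh.assignment [a12, a03, a50, a32] σ c with hv
  have v0 : v 0 = a12 := rfl
  have v1 : v 1 = a03 := rfl
  have v2 : v 2 = a50 := rfl
  have v3 : v 3 = a32 := rfl
  have v4 : v 4 = σ := rfl
  have v5 : v 5 = c 4 := rfl
  have v6 : v 6 = c 6 := rfl
  have v7 : v 7 = c 8 := rfl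
  have v8 : v 8 = c 10 := rfl
  have key := SymbolicSystem.lam_of_check check_systemBHigh (by decide)
    (a := [a12, a03, a50, a32]) (v := v) (by rw [hv, hσ]) (X := X) (Y := Y) ?_ ?_ hM
  · clear_value v
    simp only [systemBHighValues, List.forall_mem_cons, systemBHigh,
      eval_cons, eval_nil, mval, Nat.reduceMod, Nat.reduceDiv,
      Nat.reduceAdd, pow_zero, pow_one, one_mul, mul_one, zero_add, v0, v1, v2, v3, v4, v5, v6, v7,
        v8] at key
    obtain ⟨k6, k7, k8, k9, -⟩ := key
    have d6 : 2 * ((6 : ℕ) : ℝ) - 4 * s - 1 ≠ 0 := two_mul_sub_ne_zero 6 s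
    have d7 : 2 * ((7 : ℕ) : ℝ) - 4 * s - 1 ≠ 0 := two_mul_sub_ne_zero 7 s
    have d8 : 2 * ((8 : ℕ) : ℝ) - 4 * s - 1 ≠ 0 := two_mul_sub_ne_zero 8 s
    have d9 : 2 * ((9 : ℕ) : ℝ) - 4 * s - 1 ≠ 0 := two_mul_sub_ne_zero 9 s
    push_cast at k6 k7 k8 k9 d6 d7 d8 d9
    refine ⟨?_, ?_, ?_, ?_, ?_, ?_, ?_, ?_, ?_, ?_⟩
    · apply mul_left_cancel₀ d6
      linear_combination (1 / 335221286400000) * k6 + 15 * (-1 / 130 * a12 ^ 2 * a03 * a50 ^ 2 - 8 /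
        65 * a12 * a03 ^ 3 - 1 / 26 * a12 * a03 * a50 ^ 3 - 2 / 65 * a12 * a03 * a50 * a32 - 16 / 65
        * a03 ^ 3 * a50 - 23 / 520 * a03 * a50 ^ 4 - 4 / 65 * a03 * a50 ^ 2 * a32 - 2 / 65 * a03 *
        a32 ^ 2) * hS
    · intro hu eR
      have e : (a12 + 2 * a50) * (-(a03 / (61600 * (a12 + 2 * a50))) * (4 * a32 + 2 * a12 * a50 + 5
        * a50 ^ 2)
          * f5 a12 a32 a50) = -(a03 / 61600) * (4 * a32 + 2 * a12 * a50 + 5 * a50 ^ 2) * f5 a12 a32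
            a50 := by
        field_simp
      apply mul_left_cancel₀ (mul_ne_zero d7 hu)
      rw [mul_assoc _ _ (_ * _), e, f5]
      linear_combination (1 / 335221286400000) * (a12 + 2 * a50) * k7 + (s + 1) * (-3 / 104 * a12 ^
        2 * σ ^ 2 + 81 / 2002 * a12 ^ 2 * σ - 152 / 15015 * a12 ^ 2 - 3 / 52 * a12 * a50 * σ ^ 2 +
        4889 / 57200 * a12 * a50 * σ - 244 / 10725 * a12 * a50 + 53 / 32032 * a50 ^ 2 * σ - 391 /
        120120 * a50 ^ 2 - 459 / 15400 * a32 * σ + 27 / 3850 * a32) * eR + 17 * (-1 / 550 * a12 ^ 4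
        * a03 * a50 ^ 2 - 17 / 1540 * a12 ^ 3 * a03 * a50 ^ 3 - 2 / 275 * a12 ^ 3 * a03 * a50 * a32
        - 31 / 1540 * a12 ^ 2 * a03 * a50 ^ 4 - 73 / 3850 * a12 ^ 2 * a03 * a50 ^ 2 * a32 - 2 / 275
        * a12 ^ 2 * a03 * a32 ^ 2 - 43 / 6160 * a12 * a03 * a50 ^ 5 + 8 / 385 * a12 * a03 * a50 ^ 3
        * a32 + 39 / 1925 * a12 * a03 * a50 * a32 ^ 2 + 17 / 2464 * a03 * a50 ^ 6 + 177 / 3080 * a03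
        * a50 ^ 4 * a32 + 59 / 770 * a03 * a50 ^ 2 * a32 ^ 2 + 54 / 1925 * a03 * a32 ^ 3) * hS
    · intro hu eR eW
      have e : (a12 + 2 * a50) ^ 2 * (7 * a03 / (651463800 * (a12 + 2 * a50) ^ 2) * (4 * a32 + 2 *
        a12 * a50 + 5 * a50 ^ 2)
          * f6 a12 a32 a50) = 7 * a03 / 651463800 * (4 * a32 + 2 * a12 * a50 + 5 * a50 ^ 2) * f6 a12
            a32 a50 := by
        field_simp
      apply mul_left_cancel₀ (mul_ne_zero d8 (pow_ne_zero 2 hu))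
      rw [mul_assoc _ _ (_ * _), e, f6]
      rw [f5] at eW
      linear_combination (1 / 335221286400000) * (a12 + 2 * a50) ^ 2 * k8 + (s + 1) * (-3 / 208 *
        a12 ^ 4 * σ ^ 3 + 733 / 20020 * a12 ^ 4 * σ ^ 2 - 22657 / 742560 * a12 ^ 4 * σ + 7061 /
        1021020 * a12 ^ 4 - 3 / 52 * a12 ^ 3 * a50 * σ ^ 3 + 4651 / 30800 * a12 ^ 3 * a50 * σ ^ 2 -
        140939 / 1047200 * a12 ^ 3 * a50 * σ + 162289 / 5105100 * a12 ^ 3 * a50 - 3 / 52 * a12 ^ 2 *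
        a50 ^ 2 * σ ^ 3 + 125897 / 800800 * a12 ^ 2 * a50 ^ 2 * σ ^ 2 - 2193063 / 13613600 * a12 ^ 2
        * a50 ^ 2 * σ + 70451 / 1701700 * a12 ^ 2 * a50 ^ 2 - 17709 / 400400 * a12 ^ 2 * a32 * σ ^ 2
        + 69031 / 1237600 * a12 ^ 2 * a32 * σ - 1753 / 130900 * a12 ^ 2 * a32 - 57 / 1768 * a12 ^ 2
        * σ * (c 4) + 19 / 1105 * a12 ^ 2 * (c 4) - 513 / 11050 * a12 * a03 ^ 2 * σ + 54 / 5525 *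
        a12 * a03 ^ 2 + 53 / 16016 * a12 * a50 ^ 3 * σ ^ 2 - 2139967 / 81681600 * a12 * a50 ^ 3 * σ
        + 49949 / 5105100 * a12 * a50 ^ 3 - 5871 / 50050 * a12 * a50 * a32 * σ ^ 2 + 87211 / 523600
        * a12 * a50 * a32 * σ - 35291 / 850850 * a12 * a50 * a32 - 57 / 442 * a12 * a50 * σ * (c 4)
        + 76 / 1105 * a12 * a50 * (c 4) - 513 / 5525 * a03 ^ 2 * a50 * σ + 108 / 5525 * a03 ^ 2 *
        a50 + 21401 / 7779200 * a50 ^ 4 * σ - 12917 / 5834400 * a50 ^ 4 - 3 / 52 * a50 ^ 2 * a32 * σ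
        ^ 2 + 26743 / 243100 * a50 ^ 2 * a32 * σ - 1786 / 60775 * a50 ^ 2 * a32 - 57 / 442 * a50 ^ 2
        * σ * (c 4) + 76 / 1105 * a50 ^ 2 * (c 4) + 513 / 44200 * a32 ^ 2 * σ - 27 / 11050 * a32 ^
        2) * eR + (s + 1) * (-17 / 61600 * a12 ^ 2 * σ ^ 2 - 9002881 / 350788200 * a12 ^ 2 * σ +
        10411201 / 1929335100 * a12 ^ 2 - 17 / 30800 * a12 * a50 * σ ^ 2 - 103837733 / 11802991200 *
        a12 * a50 * σ + 10779019 / 5901495600 * a12 * a50 - 284201 / 132246400 * a50 ^ 2 * σ + 14167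
        / 33061600 * a50 ^ 2 + 2484953 / 153285600 * a32 * σ - 130787 / 38321400 * a32) * eW + 19 *
        (25152743 / 162865950 * a12 ^ 6 * a03 * a50 ^ 2 + 4790779 / 4790175 * a12 ^ 5 * a03 * a50 ^
        3 + 50305486 / 81432975 * a12 ^ 5 * a03 * a50 * a32 + 1377461029 / 651463800 * a12 ^ 4 * a03
        * a50 ^ 4 + 144101783 / 81432975 * a12 ^ 4 * a03 * a50 ^ 2 * a32 + 50305486 / 81432975 * a12
        ^ 4 * a03 * a32 ^ 2 + 47176843 / 32573190 * a12 ^ 3 * a03 * a50 ^ 5 - 83947689 / 54288650 *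
        a12 ^ 3 * a03 * a50 ^ 3 * a32 - 149384354 / 81432975 * a12 ^ 3 * a03 * a50 * a32 ^ 2 -
        167228761 / 27144325 * a12 ^ 2 * a03 * a50 ^ 4 * a32 - 25940614 / 3257319 * a12 ^ 2 * a03 *
        a50 ^ 2 * a32 ^ 2 - 223629896 / 81432975 * a12 ^ 2 * a03 * a32 ^ 3 - 670614 / 319345 * a12 *
        a03 * a50 ^ 5 * a32 - 6645856 / 4790175 * a12 * a03 * a50 ^ 3 * a32 ^ 2 + 292768 / 1596725 *
        a12 * a03 * a50 * a32 ^ 3 + 2344216 / 958035 * a03 * a50 ^ 4 * a32 ^ 2 + 18146464 / 4790175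
        * a03 * a50 ^ 2 * a32 ^ 3 + 467712 / 319345 * a03 * a32 ^ 4) * hS
    · intro hu eR eW
      have d : 4 * (s : ℝ) - 17 ≠ 0 := fun h => d9 (by linear_combination -h)
      have e : (2 * 9 - 4 * s - 1) * (a12 + 2 * a50) ^ 2 *
          (-(a03 / (34719763221000 * ((s : ℝ) + 1) * (4 * (s : ℝ) - 17) * (a12 + 2 * a50) ^ 2)) * (4
            * a32 + 2 * a12 * a50 + 5 * a50 ^ 2)
            * f4 a12 a32 a50 s) = σ * (a03 / 34719763221000 * (4 * a32 + 2 * a12 * a50 + 5 * a50 ^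
              2) * f4 a12 a32 a50 s) := by
        rw [hσ]
        field_simp
        ring
      apply mul_left_cancel₀ (mul_ne_zero d9 (pow_ne_zero 2 hu))
      rw [e, f4]
      rw [f5] at eW
      linear_combination (1 / 335221286400000) * (a12 + 2 * a50) ^ 2 * k9 + (s + 1) * (-1 / 208 *
        a12 ^ 5 * σ ^ 4 + 1061 / 60060 * a12 ^ 5 * σ ^ 3 - 15991 / 628320 * a12 ^ 5 * σ ^ 2 + 886741
        / 55426800 * a12 ^ 5 * σ - 158693 / 48498450 * a12 ^ 5 - 1 / 52 * a12 ^ 4 * a50 * σ ^ 4 +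
        175229 / 2402400 * a12 ^ 4 * a50 * σ ^ 3 - 6195809 / 51731680 * a12 ^ 4 * a50 * σ ^ 2 +
        218338151 / 2586584000 * a12 ^ 4 * a50 * σ - 2224424 / 121246125 * a12 ^ 4 * a50 - 1 / 52 *
        a12 ^ 3 * a50 ^ 2 * σ ^ 4 + 365371 / 4804800 * a12 ^ 3 * a50 ^ 2 * σ ^ 3 - 4392881 /
        23514400 * a12 ^ 3 * a50 ^ 2 * σ ^ 2 + 508595221 / 3103900800 * a12 ^ 3 * a50 ^ 2 * σ -
        15064529 / 387987600 * a12 ^ 3 * a50 ^ 2 - 5871 / 200200 * a12 ^ 3 * a32 * σ ^ 3 + 2860499 /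
        51731680 * a12 ^ 3 * a32 * σ ^ 2 - 50575509 / 1293292000 * a12 ^ 3 * a32 * σ + 4029203 /
        484984500 * a12 ^ 3 * a32 - 57 / 1768 * a12 ^ 3 * σ ^ 2 * (c 4) + 14015 / 184756 * a12 ^ 3 *
        σ * (c 4) - 23798 / 692835 * a12 ^ 3 * (c 4) + 27 / 1976 * a12 ^ 2 * a03 ^ 2 * σ ^ 3 -
        131553 / 839800 * a12 ^ 2 * a03 ^ 2 * σ ^ 2 + 4177989 / 23094500 * a12 ^ 2 * a03 ^ 2 * σ -
        256287 / 5773625 * a12 ^ 2 * a03 ^ 2 + 53 / 32032 * a12 ^ 2 * a50 ^ 3 * σ ^ 3 - 253320533 /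
        1551950400 * a12 ^ 2 * a50 ^ 3 * σ ^ 2 + 3001021831 / 15519504000 * a12 ^ 2 * a50 ^ 3 * σ -
        1814327 / 37306500 * a12 ^ 2 * a50 ^ 3 - 17517 / 200200 * a12 ^ 2 * a50 * a32 * σ ^ 3 +
        8305867 / 51731680 * a12 ^ 2 * a50 * a32 * σ ^ 2 - 62293857 / 517316800 * a12 ^ 2 * a50 *
        a32 * σ + 865987 / 32332300 * a12 ^ 2 * a50 * a32 - 57 / 442 * a12 ^ 2 * a50 * σ ^ 2 * (c 4)
        + 5907973 / 18475600 * a12 ^ 2 * a50 * σ * (c 4) - 172012 / 1154725 * a12 ^ 2 * a50 * (c 4)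
        + 27 / 494 * a12 * a03 ^ 2 * a50 * σ ^ 3 - 112059 / 209950 * a12 * a03 ^ 2 * a50 * σ ^ 2 +
        1287 / 2125 * a12 * a03 ^ 2 * a50 * σ - 81033 / 524875 * a12 * a03 ^ 2 * a50 - 25264741 /
        147804800 * a12 * a50 ^ 4 * σ ^ 2 + 3123365951 / 15519504000 * a12 * a50 ^ 4 * σ - 47364517
        / 969969000 * a12 * a50 ^ 4 - 3 / 52 * a12 * a50 ^ 2 * a32 * σ ^ 3 + 7660463 / 103463360 *
        a12 * a50 ^ 2 * a32 * σ ^ 2 - 22124661 / 397936000 * a12 * a50 ^ 2 * a32 * σ + 1359591 /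
        92378000 * a12 * a50 ^ 2 * a32 - 57 / 442 * a12 * a50 ^ 2 * σ ^ 2 * (c 4) + 13323467 /
        36951200 * a12 * a50 ^ 2 * σ * (c 4) - 830451 / 4618900 * a12 * a50 ^ 2 * (c 4) - 22437 /
        6806800 * a12 * a32 ^ 2 * σ ^ 2 + 1396503 / 258658400 * a12 * a32 ^ 2 * σ - 52911 / 32332300
        * a12 * a32 ^ 2 - 1377 / 41800 * a12 * a32 * σ * (c 4) + 81 / 5225 * a12 * a32 * (c 4) + 27
        / 494 * a03 ^ 2 * a50 ^ 2 * σ ^ 3 - 1089 / 2470 * a03 ^ 2 * a50 ^ 2 * σ ^ 2 + 2815569 /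
        5773625 * a03 ^ 2 * a50 ^ 2 * σ - 757578 / 5773625 * a03 ^ 2 * a50 ^ 2 - 99 / 1235 * a50 ^ 5
        * σ ^ 2 + 257096577 / 2586584000 * a50 ^ 5 * σ - 63508449 / 2586584000 * a50 ^ 5 - 157589 /
        3043040 * a50 ^ 3 * a32 * σ ^ 2 + 21292629 / 369512000 * a50 ^ 3 * a32 * σ - 10899781 /
        969969000 * a50 ^ 3 * a32 + 36143 / 739024 * a50 ^ 3 * σ * (c 4) - 53381 / 1385670 * a50 ^ 3
        * (c 4) - 459 / 15400 * a50 * a32 ^ 2 * σ ^ 2 + 5211279 / 129329200 * a50 * a32 ^ 2 * σ -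
        293121 / 32332300 * a50 * a32 ^ 2 - 1377 / 20900 * a50 * a32 * σ * (c 4) + 162 / 5225 * a50
        * a32 * (c 4)) * eR + (s + 1) * (-17 / 123200 * a12 ^ 3 * σ ^ 3 - 39662789 / 1543468080 *
        a12 ^ 3 * σ ^ 2 + 16922522953471 / 185172070512000 * a12 ^ 3 * σ - 667080587777 /
        32405112339600 * a12 ^ 3 - 17 / 61600 * a12 ^ 2 * a50 * σ ^ 3 - 104604161 / 11802991200 *
        a12 ^ 2 * a50 * σ ^ 2 + 63551969021 / 1829935755648 * a12 ^ 2 * a50 * σ - 1121869513 /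
        142963730910 * a12 ^ 2 * a50 - 284201 / 132246400 * a12 * a50 ^ 2 * σ ^ 2 + 144454771151 /
        13455409968000 * a12 * a50 ^ 2 * σ - 8239709111 / 3363852492000 * a12 * a50 ^ 2 + 379425443
        / 23605982400 * a12 * a32 * σ ^ 2 - 22082871072127 / 228741969456000 * a12 * a32 * σ +
        641087669207 / 28592746182000 * a12 * a32 - 51 / 167200 * a12 * σ * (c 4) + 3 / 20900 * a12
        * (c 4) + 46427177 / 26383156800 * a50 ^ 3 * σ - 11219657 / 26383156800 * a50 ^ 3 - 17 /
        61600 * a50 * a32 * σ ^ 2 - 77625077639 / 6727704984000 * a50 * a32 * σ + 4715649929 /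
        1681926246000 * a50 * a32 - 51 / 83600 * a50 * σ * (c 4) + 3 / 10450 * a50 * (c 4)) * eW +
        (-(2012520021566 / 867994080525 * a12 ^ 7 * a03 * a50 ^ 2 + 255550097663 / 17019491775 * a12
        ^ 6 * a03 * a50 ^ 3 + 8050080086264 / 867994080525 * a12 ^ 6 * a03 * a50 * a32 +
        275542617363469 / 8679940805250 * a12 ^ 5 * a03 * a50 ^ 4 + 110431215884896 / 4339970402625
        * a12 ^ 5 * a03 * a50 ^ 2 * a32 + 8050080086264 / 867994080525 * a12 ^ 5 * a03 * a32 ^ 2 +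
        25166248063673 / 1157325440700 * a12 ^ 4 * a03 * a50 ^ 5 - 12028633827688 / 394542763875 *
        a12 ^ 4 * a03 * a50 ^ 3 * a32 - 46335477717532 / 1446656800875 * a12 ^ 4 * a03 * a50 * a32 ^
        2 - 156078458700559 / 1446656800875 * a12 ^ 3 * a03 * a50 ^ 4 * a32 - 10145231157236 /
        76139831625 * a12 ^ 3 * a03 * a50 ^ 2 * a32 ^ 2 - 198415530612256 / 4339970402625 * a12 ^ 3
        * a03 * a32 ^ 3 - 716391395911 / 17019491775 * a12 ^ 2 * a03 * a50 ^ 5 * a32 - 3760354063036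
        / 255292376625 * a12 ^ 2 * a03 * a50 ^ 3 * a32 ^ 2 + 3286758070496 / 255292376625 * a12 ^ 2
        * a03 * a50 * a32 ^ 3 + 48364068224 / 680779671 * a12 * a03 * a50 ^ 4 * a32 ^ 2 +
        26837108044928 / 255292376625 * a12 * a03 * a50 ^ 2 * a32 ^ 3 + 1099750152192 / 28365819625
        * a12 * a03 * a32 ^ 4 + 5009125408 / 600687945 * a03 * a50 ^ 5 * a32 ^ 2 + 38770014016 /
        3003439725 * a03 * a50 ^ 3 * a32 ^ 3 + 438210816 / 87819875 * a03 * a50 * a32 ^ 4) * (s + 1)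
        + (477902117 / 162865950 * a12 ^ 7 * a03 * a50 ^ 2 + 91024801 / 4790175 * a12 ^ 6 * a03 *
        a50 ^ 3 + 955804234 / 81432975 * a12 ^ 6 * a03 * a50 * a32 + 26171759551 / 651463800 * a12 ^
        5 * a03 * a50 ^ 4 + 2737933877 / 81432975 * a12 ^ 5 * a03 * a50 ^ 2 * a32 + 955804234 /
        81432975 * a12 ^ 5 * a03 * a32 ^ 2 + 896360017 / 32573190 * a12 ^ 4 * a03 * a50 ^ 5 -
        1595006091 / 54288650 * a12 ^ 4 * a03 * a50 ^ 3 * a32 - 2838302726 / 81432975 * a12 ^ 4 *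
        a03 * a50 * a32 ^ 2 - 3177346459 / 27144325 * a12 ^ 3 * a03 * a50 ^ 4 * a32 - 492871666 /
        3257319 * a12 ^ 3 * a03 * a50 ^ 2 * a32 ^ 2 - 4248968024 / 81432975 * a12 ^ 3 * a03 * a32 ^
        3 - 12741666 / 319345 * a12 ^ 2 * a03 * a50 ^ 5 * a32 - 126271264 / 4790175 * a12 ^ 2 * a03
        * a50 ^ 3 * a32 ^ 2 + 5562592 / 1596725 * a12 ^ 2 * a03 * a50 * a32 ^ 3 + 44540104 / 958035
        * a12 * a03 * a50 ^ 4 * a32 ^ 2 + 344782816 / 4790175 * a12 * a03 * a50 ^ 2 * a32 ^ 3 +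
        8886528 / 319345 * a12 * a03 * a32 ^ 4) * σ) * hS
    · intro hu h32
      have h12 : a12 = -2 * a50 := by linear_combination hu
      rw [h12, h32] at k7
      rw [h32]
      apply mul_left_cancel₀ d7
      linear_combination (1 / 335221286400000) * k7 + 17 * (-108 / 1925 * a03 ^ 3 * a50 ^ 2 - 9 /
        3850 * a03 * a50 ^ 5) * hS
    · intro hu h32
      have h12 : a12 = -2 * a50 := by linear_combination hu
      rw [h12, h32] at k8
      intro e7
      apply mul_left_cancel₀ d8
      linear_combination (1 / 335221286400000) * k8 + (s + 1) * (-684 / 5525 * a03 ^ 2 * σ + 144 /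
        5525 * a03 ^ 2 + 153 / 1925 * a50 ^ 3 * σ ^ 2 - 130981 / 1276275 * a50 ^ 3 * σ + 27889 /
        1276275 * a50 ^ 3) * e7 + 19 * (7 / 13260 * a03 * a50 ^ 6) * hS
    · intro hu h32
      have h12 : a12 = -2 * a50 := by linear_combination hu
      rw [h12, h32] at k9
      intro e7
      have d : 4 * (s : ℝ) - 17 ≠ 0 := fun h => d9 (by linear_combination -h)
      have hs' : 1 + (s : ℝ) ≠ 0 := by rwa [add_comm]
      have e : (2 * 9 - 4 * s - 1) * (a03 * a50 ^ 7 / (13856700 * (1 + (s : ℝ)) * (4 * (s : ℝ) -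
        17))
              * (5391 - 205861 * (s : ℝ) + 66718 * (s : ℝ) ^ 2)) = σ * (-(a03 * a50 ^ 7 / 13856700 *
                (5391 - 205861 * (s : ℝ) + 66718 * (s : ℝ) ^ 2))) := by
        rw [hσ, add_comm (s : ℝ) 1]
        field_simp
        ring
      apply mul_left_cancel₀ d9
      rw [e]
      linear_combination (1 / 335221286400000) * k9 + (s + 1) * (1368 / 5525 * a03 ^ 2 * a50 * σ ^ 2
        - 363312 / 1154725 * a03 ^ 2 * a50 * σ + 71352 / 1154725 * a03 ^ 2 * a50 - 153 / 1925 * a50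
        ^ 4 * σ ^ 3 + 741613 / 4084080 * a50 ^ 4 * σ ^ 2 - 32795863 / 258658400 * a50 ^ 4 * σ +
        451823 / 19399380 * a50 ^ 4 - 459 / 10450 * a50 ^ 2 * σ * (c 4) + 108 / 5225 * a50 ^ 2 * (c
        4)) * e7 + (-(-33359 / 6928350 * a03 * a50 ^ 7) * (s + 1) + (-133 / 6630 * a03 * a50 ^ 7) *
        σ) * hS
    · intro hu h32
      have h12 : a12 = -2 * a50 := by linear_combination hu
      rw [h12, h32] at k7
      apply mul_left_cancel₀ d7
      linear_combination (1 / 335221286400000) * k7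
    · intro hu h32
      have h12 : a12 = -2 * a50 := by linear_combination hu
      rw [h12, h32] at k8
      apply mul_left_cancel₀ d8
      linear_combination (1 / 335221286400000) * k8 + 19 * (-864 / 5525 * a03 ^ 5 - 118 / 5525 * a03
        ^ 3 * a50 ^ 3 - 4 / 5525 * a03 * a50 ^ 6) * hS
    · intro hu h32
      have h12 : a12 = -2 * a50 := by linear_combination hu
      rw [h12, h32] at k9
      have d : 4 * (s : ℝ) - 17 ≠ 0 := fun h => d9 (by linear_combination -h)
      have hs' : 1 + (s : ℝ) ≠ 0 := by rwa [add_comm]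
      have e : (2 * 9 - 4 * s - 1) * (4 * a03 * a50 / (1154725 * (1 + (s : ℝ)) * (4 * (s : ℝ) - 17))
              * (84 + 3064 * (s : ℝ) - 991 * (s : ℝ) ^ 2)
              * (16 * a03 ^ 2 + a50 ^ 3) * (27 * a03 ^ 2 + 2 * a50 ^ 3)) = σ * (-(4 * a03 * a50 /
                1154725 * (84 + 3064 * (s : ℝ) - 991 * (s : ℝ) ^ 2)
          * (16 * a03 ^ 2 + a50 ^ 3) * (27 * a03 ^ 2 + 2 * a50 ^ 3))) := by
        rw [hσ, add_comm (s : ℝ) 1]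
        field_simp
        ring
      apply mul_left_cancel₀ d9
      rw [e]
      linear_combination (1 / 335221286400000) * k9 + (-(1712448 / 1154725 * a03 ^ 5 * a50 + 233876
        / 1154725 * a03 ^ 3 * a50 ^ 4 + 7928 / 1154725 * a03 * a50 ^ 7) * (s + 1) + (32832 / 5525 *
        a03 ^ 5 * a50 + 4484 / 5525 * a03 ^ 3 * a50 ^ 4 + 152 / 5525 * a03 * a50 ^ 7) * σ) * hS
  · rw [hX, systemBX_eq]
    simp [systemBHigh, SymbolicSystem.realTerms]
  · rw [hY, systemBY_eq]
    clear_value v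
    simp only [systemBHigh, SymbolicSystem.realTerms, termsBY, termsAX, List.map_cons, List.map_nil,
      eval_cons, eval_nil, mval, Nat.reduceMod, Nat.reduceDiv,
      Nat.reduceAdd, pow_zero, pow_one, one_mul, mul_one, zero_add, v0, v1, v2, v3, v4, v5, v6, v7,
        v8]
    push_cast
    ring_nf

end

end QuasiLyapunov


theorem theorem3p1 (s : ℕ) (hs : 1 ≤ s) (c : ℕ → ℝ)
    (a30 a21 a12 a03 a50 a41 a32 a23 a14 a05 : ℝ) :
    (∃! M : MvPowerSeries (Fin 2) ℝ, QuasiLyapunov.IsFormalSeries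
      (QuasiLyapunov.systemAX a30 a21 a12 a03 a50 a41 a32 a23 a14 a05)
      QuasiLyapunov.systemAY s c M) ∧
    (∃! M : MvPowerSeries (Fin 2) ℝ, QuasiLyapunov.IsFormalSeries QuasiLyapunov.systemBX
      (QuasiLyapunov.systemBY a21 a12 a03 a50 a41 a32 a23 a14 a05) s c M) ∧
    (∀ (X Y : MvPolynomial (Fin 2) ℝ) (M : MvPowerSeries (Fin 2) ℝ),
      X = QuasiLyapunov.systemAX a30 a21 a12 a03 a50 a41 a32 a23 a14 a05 →
      Y = QuasiLyapunov.systemAY →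
      QuasiLyapunov.IsFormalSeries X Y s c M →
      (QuasiLyapunov.lam X Y s M 1 = a30) ∧
      (QuasiLyapunov.VanishBefore X Y s M 2 →
        QuasiLyapunov.lam X Y s M 2 = 1 / 5 * (2 * a12 + 5 * a50)) ∧
      (QuasiLyapunov.VanishBefore X Y s M 3 →
        QuasiLyapunov.lam X Y s M 3 = 1 / 7 * (2 * a32 + 3 * a21 * a50)) ∧
      (QuasiLyapunov.VanishBefore X Y s M 4 →
        QuasiLyapunov.lam X Y s M 4
          = 1 / 45 * (12 * a14 + 30 * a03 * a50 + 5 * a41 * a50)) ∧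
      (QuasiLyapunov.VanishBefore X Y s M 5 →
        QuasiLyapunov.lam X Y s M 5
          = 3 * a50 / 77 * (6 * a23 + a21 * a41 - 10 * a50 ^ 2)) ∧
      (QuasiLyapunov.VanishBefore X Y s M 6 →
        QuasiLyapunov.lam X Y s M 6
          = a50 / 117 * (60 * a05 + 10 * a03 * a41 + a41 ^ 2 - 3 * a21 * a50 ^ 2)) ∧
      (QuasiLyapunov.VanishBefore X Y s M 7 →
        QuasiLyapunov.lam X Y s M 7
          = -(a50 / 1155) * (2 * a21 * a41 ^ 2 + 300 * a03 * a50 ^ 2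
              + 9 * a21 ^ 2 * a50 ^ 2 + 100 * a41 * a50 ^ 2)) ∧
      (a50 ≠ 0 →
        (QuasiLyapunov.VanishBefore X Y s M 8 →
          QuasiLyapunov.lam X Y s M 8
            = 1 / (895050 * a50) * QuasiLyapunov.f2 a21 a41 a50) ∧
        (QuasiLyapunov.VanishBefore X Y s M 9 →
          QuasiLyapunov.lam X Y s M 9
            = -(4 / (235125 * a50)) * QuasiLyapunov.f3 a21 a41 a50) ∧
        (QuasiLyapunov.VanishBefore X Y s M 10 →
          QuasiLyapunov.lam X Y s M 10
            = -(1 / (42089726250000 * ((s : ℝ) + 1) * (4 * (s : ℝ) - 19) * a50 ^ 3))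
                * QuasiLyapunov.f1 a21 a41 a50 s)) ∧
      (a50 = 0 →
        (QuasiLyapunov.VanishBefore X Y s M 8 → QuasiLyapunov.lam X Y s M 8 = 0) ∧
        (QuasiLyapunov.VanishBefore X Y s M 9 → QuasiLyapunov.lam X Y s M 9 = 0) ∧
        (QuasiLyapunov.VanishBefore X Y s M 10 → QuasiLyapunov.lam X Y s M 10 = 0))) ∧
    (∀ (X Y : MvPolynomial (Fin 2) ℝ) (M : MvPowerSeries (Fin 2) ℝ),
      X = QuasiLyapunov.systemBX →
      Y = QuasiLyapunov.systemBY a21 a12 a03 a50 a41 a32 a23 a14 a05 →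
      QuasiLyapunov.IsFormalSeries X Y s c M →
      (QuasiLyapunov.lam X Y s M 1 = 1 / 3 * a21) ∧
      (QuasiLyapunov.VanishBefore X Y s M 2 →
        QuasiLyapunov.lam X Y s M 2 = 1 / 5 * (6 * a03 + a41)) ∧
      (QuasiLyapunov.VanishBefore X Y s M 3 →
        QuasiLyapunov.lam X Y s M 3
          = -(1 / 7) * (2 * a03 * a12 - 2 * a23 + 3 * a03 * a50)) ∧
      (QuasiLyapunov.VanishBefore X Y s M 4 →
        QuasiLyapunov.lam X Y s M 4
          = 1 / 30 * (40 * a05 - 4 * a03 * a32 - 2 * a03 * a12 * a50 - 5 * a03 * a50 ^ 2)) ∧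
      (QuasiLyapunov.VanishBefore X Y s M 5 →
        QuasiLyapunov.lam X Y s M 5
          = -(a03 / 154) * (48 * a03 ^ 2 - 40 * a14 + 12 * a12 * a32 + 6 * a12 ^ 2 * a50
              + 12 * a32 * a50 + 21 * a12 * a50 ^ 2 + 18 * a50 ^ 3)) ∧
      (a12 + 2 * a50 ≠ 0 →
        (QuasiLyapunov.VanishBefore X Y s M 6 →
          QuasiLyapunov.lam X Y s M 6
            = -(a03 / 520) * (64 * a03 ^ 2 * a12 + 16 * a32 ^ 2 + 128 * a03 ^ 2 * a50
                + 16 * a12 * a32 * a50 + 4 * a12 ^ 2 * a50 ^ 2 + 32 * a32 * a50 ^ 2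
                + 20 * a12 * a50 ^ 3 + 23 * a50 ^ 4)) ∧
        (QuasiLyapunov.VanishBefore X Y s M 7 →
          QuasiLyapunov.lam X Y s M 7
            = -(a03 / (61600 * (a12 + 2 * a50)))
                * (4 * a32 + 2 * a12 * a50 + 5 * a50 ^ 2) * QuasiLyapunov.f5 a12 a32 a50) ∧
        (QuasiLyapunov.VanishBefore X Y s M 8 →
          QuasiLyapunov.lam X Y s M 8
            = 7 * a03 / (651463800 * (a12 + 2 * a50) ^ 2)
                * (4 * a32 + 2 * a12 * a50 + 5 * a50 ^ 2) * QuasiLyapunov.f6 a12 a32 a50) ∧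
        (QuasiLyapunov.VanishBefore X Y s M 9 →
          QuasiLyapunov.lam X Y s M 9
            = -(a03 / (34719763221000 * ((s : ℝ) + 1) * (4 * (s : ℝ) - 17)
                  * (a12 + 2 * a50) ^ 2))
                * (4 * a32 + 2 * a12 * a50 + 5 * a50 ^ 2)
                * QuasiLyapunov.f4 a12 a32 a50 s)) ∧
      (a12 + 2 * a50 = 0 →
        (QuasiLyapunov.VanishBefore X Y s M 6 →
          QuasiLyapunov.lam X Y s M 6
            = a03 / 520 * (-4 * a32 + a50 ^ 2) * (4 * a32 + a50 ^ 2)) ∧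
        (a32 = a50 ^ 2 / 4 → a50 ≠ 0 →
          (QuasiLyapunov.VanishBefore X Y s M 7 →
            QuasiLyapunov.lam X Y s M 7
              = -(9 * a03 / 7700) * (4 * a32 + a50 ^ 2) * (24 * a03 ^ 2 + a50 ^ 3)) ∧
          (QuasiLyapunov.VanishBefore X Y s M 8 →
            QuasiLyapunov.lam X Y s M 8 = 7 * a03 / 13260 * a50 ^ 6) ∧
          (QuasiLyapunov.VanishBefore X Y s M 9 →
            QuasiLyapunov.lam X Y s M 9
              = a03 * a50 ^ 7 / (13856700 * (1 + (s : ℝ)) * (4 * (s : ℝ) - 17))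
                  * (5391 - 205861 * (s : ℝ) + 66718 * (s : ℝ) ^ 2))) ∧
        (a32 = -(a50 ^ 2 / 4) →
          (QuasiLyapunov.VanishBefore X Y s M 7 → QuasiLyapunov.lam X Y s M 7 = 0) ∧
          (QuasiLyapunov.VanishBefore X Y s M 8 →
            QuasiLyapunov.lam X Y s M 8
              = -(2 * a03 / 5525) * (16 * a03 ^ 2 + a50 ^ 3) * (27 * a03 ^ 2 + 2 * a50 ^ 3)) ∧
          (QuasiLyapunov.VanishBefore X Y s M 9 →
            QuasiLyapunov.lam X Y s M 9
              = 4 * a03 * a50 / (1154725 * (1 + (s : ℝ)) * (4 * (s : ℝ) - 17))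
                  * (84 + 3064 * (s : ℝ) - 991 * (s : ℝ) ^ 2)
                  * (16 * a03 ^ 2 + a50 ^ 3) * (27 * a03 ^ 2 + 2 * a50 ^ 3))))) := by
  refine ⟨QuasiLyapunov.existsUnique_A s c _ _ _ _ _ _ _ _ _ _,
    QuasiLyapunov.existsUnique_B s c _ _ _ _ _ _ _ _ _, ?_, ?_⟩
  · intro X Y M hX hY hM
    have l1 := QuasiLyapunov.lam_systemAGeneral hX hY hM
    have v1 : ∀ k, 2 ≤ k → QuasiLyapunov.VanishBefore X Y s M k → a30 = 0 :=
      fun k hk h => l1.symm.trans (h 1 (by norm_num) (by omega))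
    have low := fun h : a30 = 0 =>
      QuasiLyapunov.lam_systemALow (hX.trans (by rw [h])) hY hM
    have v2 : ∀ k, 3 ≤ k → QuasiLyapunov.VanishBefore X Y s M k → 2 * a12 + 5 * a50 = 0 := by
      intro k hk h
      have := h 2 (by norm_num) (by omega)
      rw [(low (v1 k (by omega) h)).1] at this
      linarith
    have v3 : ∀ k, 4 ≤ k → QuasiLyapunov.VanishBefore X Y s M k →
        2 * a32 + 3 * a21 * a50 = 0 := by
      intro k hk h
      have := h 3 (by norm_num) (by omega)
      rw [(low (v1 k (by omega) h)).2.1 (v2 k (by omega) h)] at this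
      linarith
    have v4 : ∀ k, 5 ≤ k → QuasiLyapunov.VanishBefore X Y s M k →
        12 * a14 + 30 * a03 * a50 + 5 * a41 * a50 = 0 := by
      intro k hk h
      have := h 4 (by norm_num) (by omega)
      rw [(low (v1 k (by omega) h)).2.2 (v2 k (by omega) h) (v3 k (by omega) h)] at this
      linarith
    have middle := fun k (hk : 5 ≤ k) (h : QuasiLyapunov.VanishBefore X Y s M k) =>
      QuasiLyapunov.lam_systemAMiddle (a21 := a21) (a03 := a03) (a50 := a50) (a41 := a41)
        (a23 := a23) (a05 := a05) (hX.trans (by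
          have h2 := v2 k (by omega) h
          have h3 := v3 k (by omega) h
          have h4 := v4 k (by omega) h
          rw [v1 k (by omega) h, show a12 = -5 / 2 * a50 by linarith,
            show a32 = -3 / 2 * a21 * a50 by linarith,
            show a14 = -5 / 2 * a03 * a50 - 5 / 12 * a50 * a41 by linarith])) hY hM
    have v5 : ∀ k, 6 ≤ k → QuasiLyapunov.VanishBefore X Y s M k →
        a50 * (6 * a23 + a21 * a41 - 10 * a50 ^ 2) = 0 := by
      intro k hk h
      have := h 5 (by norm_num) (by omega)
      rw [(middle k (by omega) h).1] at this
      linarith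
    have v6 : ∀ k, 7 ≤ k → QuasiLyapunov.VanishBefore X Y s M k →
        a50 * (60 * a05 + 10 * a03 * a41 + a41 ^ 2 - 3 * a21 * a50 ^ 2) = 0 := by
      intro k hk h
      have := h 6 (by norm_num) (by omega)
      rw [(middle k (by omega) h).2.1 (v5 k (by omega) h)] at this
      linarith
    have v7 : ∀ k, 8 ≤ k → QuasiLyapunov.VanishBefore X Y s M k →
        a50 * (2 * a21 * a41 ^ 2 + 300 * a03 * a50 ^ 2 + 9 * a21 ^ 2 * a50 ^ 2
          + 100 * a41 * a50 ^ 2) = 0 := by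
      intro k hk h
      have := h 7 (by norm_num) (by omega)
      rw [(middle k (by omega) h).2.2 (v5 k (by omega) h) (v6 k (by omega) h)] at this
      linarith
    refine ⟨l1, fun h => (low (v1 2 (by norm_num) h)).1,
      fun h => (low (v1 3 (by norm_num) h)).2.1 (v2 3 (by norm_num) h),
      fun h => (low (v1 4 (by norm_num) h)).2.2 (v2 4 (by norm_num) h) (v3 4 (by norm_num) h),
      fun h => (middle 5 (by norm_num) h).1,
      fun h => (middle 6 (by norm_num) h).2.1 (v5 6 (by norm_num) h),
      fun h => (middle 7 (by norm_num) h).2.2 (v5 7 (by norm_num) h) (v6 7 (by norm_num) h),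
      fun h50 => ?_, fun h50 => ?_⟩
    · have h41 : a41 = a41 / a50 * a50 := by field_simp
      have high : ∀ k, 8 ≤ k → QuasiLyapunov.VanishBefore X Y s M k → _ := fun k hk h =>
        QuasiLyapunov.lam_systemAHigh (a21 := a21) (r := a41 / a50) (a50 := a50) (hX.trans (by
          have h2 := v2 k (by omega) h
          have h3 := v3 k (by omega) h
          have h4 := v4 k (by omega) h
          have h5 := (mul_eq_zero.1 (v5 k (by omega) h)).resolve_left h50
          have h6 := (mul_eq_zero.1 (v6 k (by omega) h)).resolve_left h50
          have h7 := (mul_eq_zero.1 (v7 k (by omega) h)).resolve_left h50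
          have e03 : a03 = -3 / 100 * a21 ^ 2 - 1 / 150 * a21 * (a41 / a50) ^ 2
              - 1 / 3 * (a41 / a50) * a50 := by
            field_simp
            linear_combination 150 * h7
          have e05 : a05 = 1 / 200 * a21 ^ 2 * (a41 / a50) * a50
              + 1 / 900 * a21 * (a41 / a50) ^ 3 * a50 + 1 / 20 * a21 * a50 ^ 2
              + 7 / 180 * (a41 / a50) ^ 2 * a50 ^ 2 := by
            have : a05 = -(10 * a03 * a41 + a41 ^ 2 - 3 * a21 * a50 ^ 2) / 60 := by linarith
            rw [this, e03]
            field_simp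
            ring
          have e14 : a14 = 3 / 40 * a21 ^ 2 * a50 + 1 / 60 * a21 * (a41 / a50) ^ 2 * a50
              + 5 / 12 * (a41 / a50) * a50 ^ 2 := by
            have : a14 = -(30 * a03 * a50 + 5 * a41 * a50) / 12 := by linarith
            rw [this, e03]
            field_simp
            ring
          have e23 : a23 = -1 / 6 * a21 * (a41 / a50) * a50 + 5 / 3 * a50 ^ 2 := by
            field_simp
            linarith
          rw [v1 k (by omega) h, ← h41, ← e03, ← e05, ← e14, ← e23,
            show a12 = -5 / 2 * a50 by linarith, show a32 = -3 / 2 * a21 * a50 by linarith])) hY hM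
          h50
      simp only [← h41] at high
      have v8 : ∀ k, 9 ≤ k → QuasiLyapunov.VanishBefore X Y s M k →
          QuasiLyapunov.f2 a21 a41 a50 = 0 := by
        intro k hk h
        have := h 8 (by norm_num) (by omega)
        rw [(high k (by omega) h).1] at this
        exact (mul_eq_zero.1 this).resolve_left (by positivity)
      exact ⟨fun h => (high 8 (by norm_num) h).1,
        fun h => (high 9 (by norm_num) h).2.1 (v8 9 (by norm_num) h),
        fun h => (high 10 (by norm_num) h).2.2 (v8 10 (by norm_num) h)⟩
    · have zero : ∀ k, 8 ≤ k → QuasiLyapunov.VanishBefore X Y s M k →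
          QuasiLyapunov.lam X Y s M k = 0 := by
        intro k hk h
        have h1 := v1 k (by omega) h
        have h2 := v2 k (by omega) h
        have h3 := v3 k (by omega) h
        have h4 := v4 k (by omega) h
        simp only [h50, mul_zero, add_zero, mul_eq_zero, OfNat.ofNat_ne_zero, false_or]
          at h2 h3 h4
        subst hX hY h50 h1 h2 h3 h4
        exact QuasiLyapunov.lamA_eq_zero hM k
      exact ⟨zero 8 le_rfl, zero 9 (by norm_num), zero 10 (by norm_num)⟩
  · intro X Y M hX hY hM
    have l1 := QuasiLyapunov.lam_systemBGeneral hX hY hM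
    have v1 : ∀ k, 2 ≤ k → QuasiLyapunov.VanishBefore X Y s M k → a21 = 0 := by
      intro k hk h
      have := h 1 (by norm_num) (by omega)
      rw [l1] at this
      linarith
    have low := fun h : a21 = 0 =>
      QuasiLyapunov.lam_systemBLow hX (hY.trans (by rw [h])) hM
    have v2 : ∀ k, 3 ≤ k → QuasiLyapunov.VanishBefore X Y s M k → 6 * a03 + a41 = 0 := by
      intro k hk h
      have := h 2 (by norm_num) (by omega)
      rw [(low (v1 k (by omega) h)).1] at this
      linarith
    have v3 : ∀ k, 4 ≤ k → QuasiLyapunov.VanishBefore X Y s M k →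
        2 * a03 * a12 - 2 * a23 + 3 * a03 * a50 = 0 := by
      intro k hk h
      have := h 3 (by norm_num) (by omega)
      rw [(low (v1 k (by omega) h)).2.1 (v2 k (by omega) h)] at this
      linarith
    have v4 : ∀ k, 5 ≤ k → QuasiLyapunov.VanishBefore X Y s M k →
        40 * a05 - 4 * a03 * a32 - 2 * a03 * a12 * a50 - 5 * a03 * a50 ^ 2 = 0 := by
      intro k hk h
      have := h 4 (by norm_num) (by omega)
      rw [(low (v1 k (by omega) h)).2.2.1 (v2 k (by omega) h) (v3 k (by omega) h)] at this
      linarith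
    have l5 := fun k (hk : 5 ≤ k) (h : QuasiLyapunov.VanishBefore X Y s M k) =>
      (low (v1 k (by omega) h)).2.2.2 (v2 k (by omega) h) (v3 k (by omega) h) (v4 k (by omega) h)
    have v5 : ∀ k, 6 ≤ k → QuasiLyapunov.VanishBefore X Y s M k →
        a03 = 0 ∨ 48 * a03 ^ 2 - 40 * a14 + 12 * a12 * a32 + 6 * a12 ^ 2 * a50 + 12 * a32 * a50
          + 21 * a12 * a50 ^ 2 + 18 * a50 ^ 3 = 0 := by
      intro k hk h
      have := h 5 (by norm_num) (by omega)
      rw [l5 k (by omega) h] at this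
      exact mul_eq_zero.1 (by linarith)
    have zero : ∀ k, 6 ≤ k → QuasiLyapunov.VanishBefore X Y s M k → a03 = 0 →
        QuasiLyapunov.lam X Y s M k = 0 := by
      intro k hk h h03
      have h1 := v1 k (by omega) h
      have h2 := v2 k (by omega) h
      have h3 := v3 k (by omega) h
      have h4 := v4 k (by omega) h
      have e41 : a41 = 0 := by linear_combination h2 - 6 * h03
      have e23 : a23 = 0 := by linear_combination (-1 / 2) * h3 + (a12 + 3 / 2 * a50) * h03
      have e05 : a05 = 0 := by
        linear_combination h4 / 40 + (4 * a32 + 2 * a12 * a50 + 5 * a50 ^ 2) / 40 * h03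
      subst hX hY h1 h03 e41 e23 e05
      exact QuasiLyapunov.lamB_eq_zero hM k
    have high := fun k (hk : 6 ≤ k) (h : QuasiLyapunov.VanishBefore X Y s M k) (h03 : a03 ≠ 0) =>
      QuasiLyapunov.lam_systemBHigh (a12 := a12) (a03 := a03) (a50 := a50) (a32 := a32) hX
        (hY.trans (by
          have h2 := v2 k (by omega) h
          have h3 := v3 k (by omega) h
          have h4 := v4 k (by omega) h
          have h5 := (v5 k (by omega) h).resolve_left h03
          rw [v1 k (by omega) h, show a41 = -6 * a03 by linarith, show a23 = a12 * a03 + 3 / 2 * a03 * a50 by linarith,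
            show a05 = 1 / 20 * a12 * a03 * a50 + 1 / 8 * a03 * a50 ^ 2
              + 1 / 10 * a03 * a32 by linarith, show a14 = 3 / 20 * a12 ^ 2 * a50 + 21 / 40 * a12 * a50 ^ 2 + 3 / 10 * a12 * a32
              + 6 / 5 * a03 ^ 2 + 9 / 20 * a50 ^ 3 + 3 / 10 * a50 * a32 by linarith])) hM
    have head : (QuasiLyapunov.lam X Y s M 1 = 1 / 3 * a21) ∧
        (QuasiLyapunov.VanishBefore X Y s M 2 → _) ∧ (QuasiLyapunov.VanishBefore X Y s M 3 → _) ∧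
        (QuasiLyapunov.VanishBefore X Y s M 4 → _) ∧ (QuasiLyapunov.VanishBefore X Y s M 5 → _) :=
      ⟨l1, fun h => (low (v1 2 (by norm_num) h)).1,
        fun h => (low (v1 3 (by norm_num) h)).2.1 (v2 3 (by norm_num) h),
        fun h => (low (v1 4 (by norm_num) h)).2.2.1 (v2 4 (by norm_num) h) (v3 4 (by norm_num) h),
        fun h => l5 5 (by norm_num) h⟩
    refine ⟨head.1, head.2.1, head.2.2.1, head.2.2.2.1, head.2.2.2.2, ?_⟩
    rcases eq_or_ne a03 0 with h03 | h03
    · refine ⟨fun _ => ⟨fun h => ?_, fun h => ?_, fun h => ?_, fun h => ?_⟩,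
        fun _ => ⟨fun h => ?_, fun _ _ => ⟨fun h => ?_, fun h => ?_, fun h => ?_⟩,
          fun _ => ⟨fun h => ?_, fun h => ?_, fun h => ?_⟩⟩⟩ <;>
      exact (zero _ (by norm_num) h h03).trans (by simp [h03])
    · have v6 : ∀ k, 7 ≤ k → QuasiLyapunov.VanishBefore X Y s M k →
          a03 * (64 * a03 ^ 2 * a12 + 16 * a32 ^ 2 + 128 * a03 ^ 2 * a50 + 16 * a12 * a32 * a50
          + 4 * a12 ^ 2 * a50 ^ 2 + 32 * a32 * a50 ^ 2 + 20 * a12 * a50 ^ 3 + 23 * a50 ^ 4) = 0 := by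
        intro k hk h
        have := h 6 (by norm_num) (by omega)
        rw [(high k (by omega) h h03).1] at this
        linarith
      refine ⟨fun hu => ?_, fun hu => ?_⟩
      · have l7 := fun k (hk : 7 ≤ k) (h : QuasiLyapunov.VanishBefore X Y s M k) =>
          (high k (by omega) h h03).2.1 hu (v6 k hk h)
        have v7 : ∀ k, 8 ≤ k → QuasiLyapunov.VanishBefore X Y s M k →
            a03 * (4 * a32 + 2 * a12 * a50 + 5 * a50 ^ 2) * QuasiLyapunov.f5 a12 a32 a50 = 0 := by
          intro k hk h
          have := h 7 (by norm_num) (by omega)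
          rw [l7 k (by omega) h] at this
          field_simp at this
          linear_combination -this
        exact ⟨fun h => (high 6 le_rfl h h03).1, fun h => l7 7 le_rfl h,
          fun h => (high 8 (by norm_num) h h03).2.2.1 hu (v6 8 (by norm_num) h) (v7 8 le_rfl h),
          fun h => (high 9 (by norm_num) h h03).2.2.2.1 hu (v6 9 (by norm_num) h)
            (v7 9 (by norm_num) h)⟩
      · refine ⟨fun h => ?_, fun h32 h50 => ?_, fun h32 => ?_⟩
        · rw [(high 6 le_rfl h h03).1, show a12 = -2 * a50 by linarith]
          ring
        · have l7 := fun k (hk : 7 ≤ k) (h : QuasiLyapunov.VanishBefore X Y s M k) =>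
            (high k (by omega) h h03).2.2.2.2.1 hu h32
          have v7 : ∀ k, 8 ≤ k → QuasiLyapunov.VanishBefore X Y s M k →
              a03 * (24 * a03 ^ 2 + a50 ^ 3) = 0 := by
            intro k hk h
            have := h 7 (by norm_num) (by omega)
            rw [l7 k (by omega) h, h32] at this
            apply mul_left_cancel₀ (pow_ne_zero 2 h50)
            linear_combination (-7700 / 18) * this
          exact ⟨fun h => l7 7 le_rfl h,
            fun h => (high 8 (by norm_num) h h03).2.2.2.2.2.1 hu h32 (v7 8 le_rfl h),
            fun h => (high 9 (by norm_num) h h03).2.2.2.2.2.2.1 hu h32 (v7 9 (by norm_num) h)⟩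
        · exact ⟨fun h => (high 7 (by norm_num) h h03).2.2.2.2.2.2.2.1 hu h32,
            fun h => (high 8 (by norm_num) h h03).2.2.2.2.2.2.2.2.1 hu h32,
            fun h => (high 9 (by norm_num) h h03).2.2.2.2.2.2.2.2.2 hu h32⟩
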